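/- Let $F(z)=\sum_{n\ge 0}\zeta_n \frac{z^n}{\sqrt{n!}}$, where $\zeta_0,\zeta_1,\dots$ are independent standard complex Gaussian random variables (each $\zeta_n$ has density $\frac1\pi e^{-|\zeta|^2}$ with respect to Lebesgue measure on $\mathbb{C}$); almost surely this series converges for all $z\in\mathbb C$. Let $\mathcal Z=F^{-1}\{0\}$ be its zero set, and identify $\mathbb{R}^2$ with $\mathbb{C}$. Then for every function $h\in (L^1\cap L^2)(\mathbb{R}^2)$ (real- or complex-valued) that is not almost everywhere zero, and for every $r>0$, the sum $$n(r,h)=\sum_{a\in\mathcal Z} h\left(\tfrac{a}{r}\right)$$ almost surely converges absolutely, it defines a square-integrable random variable, and $$\operatorname{Var} n(r,h)=\mathbb{E}\bigl|n(r,h)-\mathbb{E}\,n(r,h)\bigr|^2 = r^2\int_{\mathbb{R}^2}|\widehat h(\lambda)|^2\,M(r^{-1}\lambda)\,dm(\lambda),$$ where the integral on the right-hand side is finite, $m$ is Lebesgue measure on $\mathbb{R}^2$, $$M(\lambda)=\pi^3|\lambda|^4\sum_{\alpha\ge 1}\frac{1}{\alpha^3}\,e^{-\frac{\pi^2}{\alpha}|\lambda|^2},\qquad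 \widehat h(\lambda)=\int_{\mathbb{R}^2}h(x)\,e^{-2\pi i\langle\lambda,x\rangle}\,dm(x).$$ -/

import Mathlib

open scoped Real FourierTransform
open MeasureTheory ProbabilityTheory

noncomputable section

/-- The standard complex Gaussian law: density `π⁻¹ exp (-|z|²)` with respect to Lebesgue
measure on `ℂ`. -/
def stdComplexGaussian : Measure ℂ :=
  (volume : Measure ℂ).withDensity fun z => ENNReal.ofReal (1 / π * Real.exp (-‖z‖ ^ 2))

/-- The function `z ↦ ∑ ζₙ zⁿ / √(n!)` with coefficients `ζ`. -/
def gef (ζ : ℕ → ℂ) (z : ℂ) : ℂ :=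
  ∑' n : ℕ, ζ n * (z ^ n / ((√(n.factorial : ℝ) : ℝ) : ℂ))

/-- The zero set of `gef ζ`. -/
def gefZeros (ζ : ℕ → ℂ) : Set ℂ := {z | gef ζ z = 0}

/-- The linear statistic `∑ h (a / r)`, the sum being over the zeros `a` of `gef ζ`. -/
def linearStat (ζ : ℕ → ℂ) (r : ℝ) (h : ℂ → ℂ) : ℂ :=
  ∑' a : gefZeros ζ, h ((a : ℂ) / (r : ℂ))

/-- The variance `𝔼 |X - 𝔼 X|²` of a complex-valued random variable. -/
def complexVariance {Ω : Type*} [MeasurableSpace Ω] (X : Ω → ℂ) (P : Measure Ω) : ℝ :=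
  ∫ ω, ‖X ω - ∫ ω', X ω' ∂P‖ ^ 2 ∂P

/-- For real-valued random variables this is the usual variance. -/
theorem complexVariance_ofReal {Ω : Type*} [MeasurableSpace Ω] (X : Ω → ℝ) (P : Measure Ω)
    (hX : AEMeasurable X P) :
    complexVariance (fun ω => (X ω : ℂ)) P = variance X P := by
  rw [variance_eq_integral hX, complexVariance, integral_complex_ofReal]
  congr 1
  ext ω
  rw [← Complex.ofReal_sub, Complex.norm_real, Real.norm_eq_abs, sq_abs]

/-- The function `M(λ) = π³ |λ|⁴ ∑_{α ≥ 1} α⁻³ exp (-π² |λ|² / α)`. -/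
def varianceKernel (w : ℂ) : ℝ :=
  π ^ 3 * ‖w‖ ^ 4 * ∑' α : ℕ+, 1 / (α : ℝ) ^ 3 * Real.exp (-(π ^ 2 / (α : ℝ)) * ‖w‖ ^ 2)

end

/-!
By the law of the coefficients, everything can be computed on the sequence space with the product
measure `coeffLaw`. Put `u(z) = log ‖F(z)‖ - 𝔼 log ‖F(z)‖`, the field `gefLog`. In the sense of
distributions `(2π)⁻¹ Δu` is the counting measure of the zeros minus its mean, so a linear statistic
is, up to its mean, the pairing of `u` with `(2π)⁻¹ Δh`. If `u` is stationary with spectral density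
`ρ`, the variance is therefore the integral of `‖𝓕 h‖²` against `(2π ‖w‖²)² ρ(w)`.

*Spectral density.* The normalized intensities `‖F(z)‖² exp (-‖z‖²)` and `‖F(w)‖² exp (-‖w‖²)` have
an explicit joint Laplace transform (`integral_exp_neg_gefIntensity`). Writing logarithms as
Frullani integrals turns it into the covariance of `u`, a dilogarithm: `¼ ∑ exp (-n ‖z - w‖²) / n²`
(`HasExpLaplace.hasSum_integral_log_sub_mul`, `hasSum_integral_gefLog_mul`). Its termwise Fourier
transform is `logSpectralDensity`, and `(2π ‖w‖²)²` times this density is the kernel of the theorem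
(`varianceKernel_eq`).

*Test functions.* For `log⁺ (R / ‖z - c‖)` the pairing with the Laplacian is elementary: by Jensen's
formula the linear statistic is the increment of `log ‖F‖` between the centre and the circle of
radius `R` (`hasSum_logBump_gefZeros`), while the Fourier transform satisfies the corresponding
identity for characters (`fourier_logBump`). Jensen's formula counts zeros with multiplicity; almost
surely they are simple, because, given the other coefficients, a multiple zero forces the constant
coefficient into a countable set (`ae_gefDeriv_ne_zero`). Since `u` and the characters on the
spectral measure have the same correlations, the variance formula holds for all finite combinations
of these test functions (`integral_norm_sq_centredStat`).

*General functions.* Coverings by disks give a bound for the first moment of the linear statistic of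
a nonnegative function by a multiple of its integral (`exists_linearStat_majorant`). The test
functions are dense in `L¹ ∩ L²` (`isTestLimit_of_memLp`), since differences of two of them with the
same centre approximate indicator functions of disks. The variance kernel is bounded
(`varianceKernel_le`), so by Plancherel's identity (`eLpNorm_fourier`) both sides of the variance
formula are continuous in the limit (`linearStat_variance`). Scaling by `r` gives the theorem.
-/

open Filter Topology
open scoped ENNReal

noncomputable section

/-! ### The standard complex Gaussian law and the random power series -/

theorem integral_stdComplexGaussian {E : Type*} [NormedAddCommGroup E] [NormedSpace ℝ E]
    (f : ℂ → E) :
    ∫ z, f z ∂stdComplexGaussian = ∫ z, (1 / π * Real.exp (-‖z‖ ^ 2)) • f z := by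
  rw [stdComplexGaussian, integral_withDensity_eq_integral_toReal_smul (by fun_prop) (by simp)]
  congr 1; ext z
  rw [ENNReal.toReal_ofReal (by positivity)]

/-- The Gaussian integral with a quadratic and a linear term in the exponent: the Laplace transform
of `‖z‖²` for `c = 0`, the characteristic function for `b = 0`, `c = i`. -/
theorem integral_stdComplexGaussian_cexp (b c w : ℂ) (hb : -1 < b.re) :
    ∫ z : ℂ, Complex.exp (-b * (‖z‖ : ℂ) ^ 2 + c * (inner ℝ w z : ℝ)) ∂stdComplexGaussian
      = 1 / (1 + b) * Complex.exp (c ^ 2 * (‖w‖ : ℂ) ^ 2 / (4 * (1 + b))) := by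
  have hb' : 0 < (1 + b).re := by simp; linarith
  have h := GaussianFourier.integral_cexp_neg_mul_sq_norm_add (V := ℂ) hb' c w
  rw [integral_stdComplexGaussian]
  have hpi : (π : ℂ) ≠ 0 := by exact_mod_cast Real.pi_ne_zero
  rw [Complex.finrank_real_complex] at h
  simp only [Nat.cast_ofNat, ne_eq, OfNat.ofNat_ne_zero, not_false_eq_true, div_self,
    Complex.cpow_one] at h
  calc _ = ∫ z : ℂ, (1 / (π : ℂ)) *
        Complex.exp (-(1 + b) * (‖z‖ : ℂ) ^ 2 + c * (inner ℝ w z : ℝ)) := by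
        congr 1; ext z
        rw [Complex.real_smul]; push_cast
        rw [mul_assoc, ← Complex.exp_add]
        congr 2; ring
    _ = _ := by
        rw [integral_const_mul, h]
        field_simp

instance isProbabilityMeasure_stdComplexGaussian : IsProbabilityMeasure stdComplexGaussian := by
  have h := GaussianFourier.integral_rexp_neg_mul_sq_norm (V := ℂ) one_pos
  rw [Complex.finrank_real_complex] at h
  simp only [neg_mul, one_mul, div_one, Nat.cast_ofNat, ne_eq, OfNat.ofNat_ne_zero,
    not_false_eq_true, div_self, Real.rpow_one] at h
  have hi : Integrable fun z : ℂ => Real.exp (-‖z‖ ^ 2) := by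
    by_contra hc
    rw [integral_undef hc] at h
    exact Real.pi_ne_zero h.symm
  constructor
  rw [stdComplexGaussian, withDensity_apply _ MeasurableSet.univ, Measure.restrict_univ,
    ← ofReal_integral_eq_lintegral_ofReal (hi.const_mul _) (ae_of_all _ fun _ => by positivity),
    integral_const_mul, h]
  simp [Real.pi_ne_zero]

theorem stdComplexGaussian_countable {s : Set ℂ} (hs : s.Countable) :
    stdComplexGaussian s = 0 :=
  withDensity_absolutelyContinuous _ _ (hs.measure_zero _)

/-- The law of the sequence of coefficients: independent standard complex Gaussian variables. -/
abbrev coeffLaw : Measure (ℕ → ℂ) := Measure.infinitePi fun _ => stdComplexGaussian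

/-- The coefficients `zⁿ / √(n!)`. -/
def gefCoeff (n : ℕ) (z : ℂ) : ℂ := z ^ n / ((√(n.factorial : ℝ) : ℝ) : ℂ)

theorem norm_gefCoeff_sq (n : ℕ) (z : ℂ) : ‖gefCoeff n z‖ ^ 2 = (‖z‖ ^ 2) ^ n / n.factorial := by
  rw [gefCoeff, norm_div, norm_pow, Complex.norm_real, Real.norm_of_nonneg (Real.sqrt_nonneg _),
    div_pow, Real.sq_sqrt (Nat.cast_nonneg _), ← pow_mul, ← pow_mul, mul_comm]

/-- The covariance kernel of the random entire function: `𝔼 F(z) conj F(w) = exp (z conj w)`. -/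
theorem hasSum_gefCoeff_mul_conj (z w : ℂ) :
    HasSum (fun n => gefCoeff n z * (starRingEnd ℂ) (gefCoeff n w))
      (Complex.exp (z * (starRingEnd ℂ) w)) := by
  have := NormedSpace.expSeries_div_hasSum_exp (𝔸 := ℂ) (z * (starRingEnd ℂ) w)
  rw [← Complex.exp_eq_exp_ℂ] at this
  have e : (fun n => gefCoeff n z * (starRingEnd ℂ) (gefCoeff n w)) =
      fun n : ℕ => (z * (starRingEnd ℂ) w) ^ n / (n.factorial : ℂ) := by
    ext n
    simp only [gefCoeff, map_div₀, map_pow, Complex.conj_ofReal]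
    rw [div_mul_div_comm, ← Complex.ofReal_mul, Real.mul_self_sqrt (Nat.cast_nonneg _), mul_pow]
    simp
  rw [e]
  exact this

theorem summable_norm_gefCoeff (z : ℂ) : Summable fun n => ‖gefCoeff n z‖ := by
  -- with `x = ‖gefCoeff n z‖`: `x ≤ 2⁻ⁿ + 2ⁿ x²`, and `2ⁿ x² = 2⁻ⁿ ‖gefCoeff n (2 * z)‖²`
  have hs : Summable fun n : ℕ => (1 / 2 : ℝ) ^ n + ‖gefCoeff n (2 * z)‖ ^ 2 * (1 / 2) ^ n := by
    refine (summable_geometric_two).add ?_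
    refine Summable.of_nonneg_of_le (fun _ => by positivity) (fun n => ?_)
      (Real.summable_pow_div_factorial (‖2 * z‖ ^ 2))
    rw [norm_gefCoeff_sq]
    exact mul_le_of_le_one_right (by positivity) (pow_le_one₀ (by norm_num) (by norm_num))
  refine Summable.of_nonneg_of_le (fun _ => norm_nonneg _) (fun n => ?_) hs
  have h2 : ‖gefCoeff n (2 * z)‖ = 2 ^ n * ‖gefCoeff n z‖ := by
    simp [gefCoeff, mul_pow, mul_div_assoc]
  rw [h2]
  have h4 : (2 ^ n * ‖gefCoeff n z‖) ^ 2 * (1 / 2 : ℝ) ^ n = 2 ^ n * ‖gefCoeff n z‖ ^ 2 := by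
    rw [mul_pow, one_div, inv_pow]; field_simp
  rw [h4]
  have h5 : (1 / 2 : ℝ) ^ n * 2 ^ n = 1 := by rw [← mul_pow]; norm_num
  have h6 : 0 < (2 : ℝ) ^ n := by positivity
  nlinarith [sq_nonneg ((1 / 2 : ℝ) ^ n - ‖gefCoeff n z‖),
    sq_nonneg ((2 : ℝ) ^ n * ‖gefCoeff n z‖ - 1),
    norm_nonneg (gefCoeff n z), pow_pos (show (0 : ℝ) < 1 / 2 by norm_num) n]

theorem gef_eq_tsum (ζ : ℕ → ℂ) (z : ℂ) : gef ζ z = ∑' n, ζ n * gefCoeff n z := rfl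

theorem integrable_norm_stdComplexGaussian :
    Integrable (fun z : ℂ => ‖z‖) stdComplexGaussian := by
  -- `exp (‖z‖² / 2)` is integrable, since its integral, computed above, is not the junk value `0`
  have h : Integrable (fun z : ℂ => Complex.exp (-(-(1/2) : ℂ) * (‖z‖ : ℂ) ^ 2 + 0 *
    (inner ℝ (0:ℂ) z : ℝ)))
      stdComplexGaussian := by
    by_contra hc
    have := integral_stdComplexGaussian_cexp (-(1/2)) 0 0 (by norm_num)
    rw [integral_undef hc] at this
    norm_num at this
  refine (h.norm.const_mul 2).mono' (by fun_prop) (ae_of_all _ fun z => ?_)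
  simp only [norm_norm]
  rw [Complex.norm_exp]
  have : (-(-(1/2) : ℂ) * (‖z‖ : ℂ) ^ 2 + 0 * (inner ℝ (0:ℂ) z : ℝ)).re = ‖z‖ ^ 2 / 2 := by
    have : (-(-(1/2) : ℂ) * (‖z‖ : ℂ) ^ 2 + 0 * (inner ℝ (0:ℂ) z : ℝ)) =
        ((‖z‖ ^ 2 / 2 : ℝ) : ℂ) := by
      push_cast; ring
    rw [this, Complex.ofReal_re]
  rw [this]
  nlinarith [Real.add_one_le_exp (‖z‖ ^ 2 / 2), sq_nonneg (‖z‖ - 1)]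

theorem ae_summable_norm_mul_gefCoeff (z : ℂ) :
    ∀ᵐ ζ ∂coeffLaw, Summable fun n => ‖ζ n‖ * ‖gefCoeff n z‖ := by
  have hlaw : ∀ n, ∫⁻ ζ, ‖ζ n‖ₑ ∂coeffLaw = ∫⁻ x, ‖x‖ₑ ∂stdComplexGaussian := fun n =>
    (measurePreserving_eval_infinitePi (fun _ => stdComplexGaussian) n).lintegral_comp
      (f := fun x => ‖x‖ₑ) (by fun_prop)
  have hfin : ∫⁻ x, ‖x‖ₑ ∂stdComplexGaussian ≠ ⊤ := by
    have := integrable_norm_stdComplexGaussian.2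
    rw [hasFiniteIntegral_def] at this
    simpa using this.ne
  have hm : ∀ n, Measurable fun ζ : ℕ → ℂ => ‖ζ n‖ₑ * ‖gefCoeff n z‖ₑ := fun n => by fun_prop
  have h : ∫⁻ ζ, ∑' n, ‖ζ n‖ₑ * ‖gefCoeff n z‖ₑ ∂coeffLaw ≠ ⊤ := by
    rw [lintegral_tsum fun n => (hm n).aemeasurable]
    have : ∀ n, ∫⁻ ζ, ‖ζ n‖ₑ * ‖gefCoeff n z‖ₑ ∂coeffLaw =
        (∫⁻ x, ‖x‖ₑ ∂stdComplexGaussian) * ‖gefCoeff n z‖ₑ := fun n => by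
      rw [lintegral_mul_const _ (by fun_prop), hlaw]
    simp_rw [this]
    rw [ENNReal.tsum_mul_left]
    refine ENNReal.mul_ne_top hfin ?_
    have := (summable_norm_gefCoeff z).tsum_ofReal_ne_top
    simpa [ofReal_norm] using this
  filter_upwards [ae_lt_top (Measurable.tsum hm) h] with ζ hζ
  have := ENNReal.summable_toReal hζ.ne
  simpa using this

/-- Almost sure absolute convergence on the whole plane; it suffices to consider the countably many
points of `ℕ`, because the terms increase with `‖z‖`. -/
theorem ae_forall_summable_norm_mul_gefCoeff :
    ∀ᵐ ζ ∂coeffLaw, ∀ z, Summable fun n => ‖ζ n‖ * ‖gefCoeff n z‖ := by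
  have h : ∀ᵐ ζ ∂coeffLaw, ∀ K : ℕ, Summable fun n => ‖ζ n‖ * ‖gefCoeff n (K : ℂ)‖ :=
    ae_all_iff.2 fun K => ae_summable_norm_mul_gefCoeff K
  filter_upwards [h] with ζ hζ z
  obtain ⟨K, hK⟩ := exists_nat_ge ‖z‖
  refine (hζ K).of_nonneg_of_le (fun _ => by positivity) (fun n => ?_)
  have : ‖gefCoeff n z‖ ≤ ‖gefCoeff n (K : ℂ)‖ := by
    simp only [gefCoeff, norm_div, norm_pow, Complex.norm_natCast]
    gcongr
  gcongr

/-! ### The joint Laplace transform of the intensities -/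

/-- The characteristic functional of a sequence of independent standard complex Gaussian
variables. -/
theorem integral_coeffLaw_cexp_sum (v : ℕ → ℂ) (N : ℕ) :
    ∫ ζ, Complex.exp (Complex.I * ((∑ n ∈ Finset.range N, (v n * ζ n).re : ℝ) : ℂ)) ∂coeffLaw
      = Complex.exp (-((∑ n ∈ Finset.range N, ‖v n‖ ^ 2 : ℝ) : ℂ) / 4) := by
  have hind : iIndepFun (fun (n : ℕ) (ζ : ℕ → ℂ) => ζ n) coeffLaw :=
    iIndepFun_infinitePi (Ω := fun _ : ℕ => ℂ) (P := fun _ => stdComplexGaussian)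
      (X := fun _ z => z) (fun _ => measurable_id)
  let f : ℕ → ℂ → ℂ := fun n x => Complex.exp (Complex.I * ((v n * x).re : ℂ))
  have hf : ∀ n, Measurable (f n) := fun n => by fun_prop
  have hind' : iIndepFun (fun (n : Finset.range N) (ζ : ℕ → ℂ) => f n (ζ n)) coeffLaw :=
    (hind.precomp (g := fun n : Finset.range N => (n : ℕ)) Subtype.val_injective).comp
      (fun n => f n) (fun n => hf n)
  have h1 := hind'.integral_fun_prod_eq_prod_integral
    (fun n => ((hf n).comp (measurable_pi_apply _)).aestronglyMeasurable)
  have h2 : ∀ n, ∫ ζ, f n (ζ n) ∂coeffLaw = Complex.exp (-((‖v n‖ ^ 2 : ℝ) : ℂ) / 4) := fun n => by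
    -- one coefficient: the Gaussian integral with `b = 0`, `c = i`
    have h3 := (measurePreserving_eval_infinitePi (fun _ : ℕ => stdComplexGaussian) n).hasLaw
    have h4 := h3.integral_comp (f := f n) (hf n).aestronglyMeasurable
    simp only [Function.comp_def] at h4
    rw [h4]
    have h5 := integral_stdComplexGaussian_cexp 0 Complex.I ((starRingEnd ℂ) (v n)) (by simp)
    simp only [f]
    convert h5 using 2
    · ext x; congr 1
      simp [Complex.inner]
      ring
    · simp
  simp_rw [h2] at h1
  rw [Finset.prod_coe_sort (Finset.range N) fun n => Complex.exp (-((‖v n‖ ^ 2 : ℝ) : ℂ) / 4),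
    ← Complex.exp_sum, ← Finset.sum_div, Finset.sum_neg_distrib, ← Complex.ofReal_sum] at h1
  rw [← h1]
  congr 1; ext ζ
  rw [Finset.prod_coe_sort (Finset.range N) fun n => f n (ζ n), ← Complex.exp_sum,
    ← Finset.mul_sum, Complex.ofReal_sum]

theorem measurable_gef (z : ℂ) : Measurable fun ζ : ℕ → ℂ => gef ζ z := by
  simp only [gef_eq_tsum]
  exact Measurable.tsum fun n => by fun_prop

theorem ae_hasSum_gef : ∀ᵐ ζ ∂coeffLaw, ∀ z, HasSum (fun n => ζ n * gefCoeff n z) (gef ζ z) := by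
  filter_upwards [ae_forall_summable_norm_mul_gefCoeff] with ζ hζ z
  refine (Summable.of_norm ?_).hasSum
  simpa [norm_mul] using hζ z

/-- The joint characteristic function of `F(z)` and `F(w)`: a centred complex Gaussian pair with
covariances `exp (‖z‖²)`, `exp (‖w‖²)` and `exp (z conj w)`. -/
theorem integral_cexp_gef (u v z w : ℂ) :
    ∫ ζ, Complex.exp (Complex.I * ((u * gef ζ z + v * gef ζ w).re : ℂ)) ∂coeffLaw
      = Complex.exp (-((‖u‖ ^ 2 * Real.exp (‖z‖ ^ 2) + ‖v‖ ^ 2 * Real.exp (‖w‖ ^ 2)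
        + 2 * (u * (starRingEnd ℂ) v * Complex.exp (z * (starRingEnd ℂ) w)).re : ℝ) : ℂ) / 4) := by
  have hself : ∀ z : ℂ, HasSum (fun n => ‖gefCoeff n z‖ ^ 2) (Real.exp (‖z‖ ^ 2)) := fun z => by
    have h := Complex.hasSum_re (hasSum_gefCoeff_mul_conj z z)
    simp only [Complex.mul_conj] at h
    simpa [Complex.normSq_eq_norm_sq, ← Complex.ofReal_pow, Complex.exp_ofReal_re] using h
  have hcross := Complex.hasSum_re ((hasSum_gefCoeff_mul_conj z w).mul_left (u * (starRingEnd ℂ) v))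
  have hsum := (((hself z).mul_left (‖u‖ ^ 2)).add ((hself w).mul_left (‖v‖ ^ 2))).add
    (hcross.mul_left 2)
  let c : ℕ → ℂ := fun n => u * gefCoeff n z + v * gefCoeff n w
  have hc : ∀ n, ‖c n‖ ^ 2 = ‖u‖ ^ 2 * ‖gefCoeff n z‖ ^ 2 + ‖v‖ ^ 2 * ‖gefCoeff n w‖ ^ 2 +
      2 * (u * (starRingEnd ℂ) v * (gefCoeff n z * (starRingEnd ℂ) (gefCoeff n w))).re :=
    fun n => by
    simp only [c]
    rw [← Complex.normSq_eq_norm_sq, Complex.normSq_add, ← mul_pow, ← mul_pow, ← norm_mul,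
      ← norm_mul, ← Complex.normSq_eq_norm_sq, ← Complex.normSq_eq_norm_sq]
    congr 3
    rw [map_mul]; ring
  simp only [← hc] at hsum
  have hlim1 : Tendsto (fun N => ∫ ζ, Complex.exp (Complex.I *
      ((∑ n ∈ Finset.range N, (c n * ζ n).re : ℝ) : ℂ)) ∂coeffLaw) atTop
      (𝓝 (∫ ζ, Complex.exp (Complex.I * ((u * gef ζ z + v * gef ζ w).re : ℂ)) ∂coeffLaw)) := by
    refine tendsto_integral_of_dominated_convergence (fun _ => 1) (fun N => ?_)
      (integrable_const _) (fun N => ae_of_all _ fun ζ => ?_) ?_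
    · exact Measurable.aestronglyMeasurable (by fun_prop)
    · rw [mul_comm, Complex.norm_exp_ofReal_mul_I]
    · filter_upwards [ae_hasSum_gef] with ζ hζ
      have h := Complex.hasSum_re (((hζ z).mul_left u).add ((hζ w).mul_left v))
      have h' := h.tendsto_sum_nat
      refine ((Complex.continuous_exp.comp (continuous_const.mul
        Complex.continuous_ofReal)).tendsto _).comp ?_
      refine h'.congr fun N => Finset.sum_congr rfl fun n _ => ?_
      simp only [c]; congr 1; ring
  simp only [integral_coeffLaw_cexp_sum] at hlim1
  refine tendsto_nhds_unique hlim1 ?_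
  exact ((Complex.continuous_exp.comp ((Complex.continuous_ofReal.neg).div_const 4)).tendsto _).comp
    hsum.tendsto_sum_nat

/-- Linearization of a Gaussian function of `‖x‖` by an auxiliary Gaussian variable `u`; it reduces
Laplace transforms of squared moduli to characteristic functions. -/
theorem exp_neg_mul_sq_eq_integral (s : ℝ) (hs : 0 ≤ s) (x : ℂ) :
    ((Real.exp (-(s * ‖x‖ ^ 2)) : ℝ) : ℂ)
      = ∫ u, Complex.exp (Complex.I * ((((2 * √s : ℝ) : ℂ) * u * x).re : ℂ))
          ∂stdComplexGaussian := by
  have h5 := integral_stdComplexGaussian_cexp 0 Complex.I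
    ((starRingEnd ℂ) (((2 * √s : ℝ) : ℂ) * x)) (by simp)
  have : (fun u : ℂ => Complex.exp (Complex.I * ((((2 * √s : ℝ) : ℂ) * u * x).re : ℂ))) =
    fun u : ℂ => Complex.exp (-0 * (‖u‖ : ℂ) ^ 2 + Complex.I *
      (inner ℝ ((starRingEnd ℂ) (((2 * √s : ℝ) : ℂ) * x)) u : ℝ)) := by
    ext u
    rw [Complex.inner, Complex.conj_conj, neg_zero, zero_mul, zero_add]
    congr 4; ring
  rw [this, h5, RCLike.norm_conj, norm_mul, Complex.norm_real, Real.norm_of_nonneg (by positivity)]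
  simp only [add_zero, div_one, one_mul, Complex.I_sq, mul_one]
  rw [Complex.ofReal_exp]
  congr 1
  push_cast
  have : ((√s : ℝ) : ℂ) ^ 2 = s := by exact_mod_cast congrArg ((↑) : ℝ → ℂ) (Real.sq_sqrt hs)
  linear_combination (‖x‖ : ℂ) ^ 2 * this

/-- The joint Laplace transform of `‖F(z)‖²` and `‖F(w)‖²`, before normalization. -/
theorem integral_exp_neg_gef_sq (s t : ℝ) (hs : 0 ≤ s) (ht : 0 ≤ t) (z w : ℂ) :
    ∫ ζ, Real.exp (-(s * ‖gef ζ z‖ ^ 2) - t * ‖gef ζ w‖ ^ 2) ∂coeffLaw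
      = 1 / ((1 + s * Real.exp (‖z‖ ^ 2)) * (1 + t * Real.exp (‖w‖ ^ 2))
          - s * t * ‖Complex.exp (z * (starRingEnd ℂ) w)‖ ^ 2) := by
  set A := Real.exp (‖z‖ ^ 2)
  set B := Real.exp (‖w‖ ^ 2)
  set K := Complex.exp (z * (starRingEnd ℂ) w)
  have hA : 0 < A := Real.exp_pos _
  have hB : 0 < B := Real.exp_pos _
  have hK : ‖K‖ ^ 2 ≤ A * B := by
    rw [Complex.norm_exp, ← Real.exp_add, ← Real.exp_nat_mul]
    refine Real.exp_le_exp.2 ?_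
    have : (z * (starRingEnd ℂ) w).re ≤ ‖z‖ * ‖w‖ := by
      simpa using (Complex.re_le_norm (z * (starRingEnd ℂ) w))
    push_cast
    nlinarith [sq_nonneg (‖z‖ - ‖w‖)]
  -- the integrand after linearization, with one auxiliary Gaussian variable for each square
  let Φ : ℂ → ℂ → (ℕ → ℂ) → ℂ := fun u v ζ =>
    Complex.exp (Complex.I * ((((2 * √s : ℝ) : ℂ) * u * gef ζ z +
      ((2 * √t : ℝ) : ℂ) * v * gef ζ w).re : ℂ))
  have hΦ1 : ∀ u v ζ, ‖Φ u v ζ‖ = 1 := fun u v ζ => by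
    simp only [Φ]; rw [mul_comm, Complex.norm_exp_ofReal_mul_I]
  have step1 : ∀ ζ, ((Real.exp (-(s * ‖gef ζ z‖ ^ 2) - t * ‖gef ζ w‖ ^ 2) : ℝ) : ℂ) =
      ∫ p : ℂ × ℂ, Φ p.1 p.2 ζ ∂(stdComplexGaussian.prod stdComplexGaussian) := fun ζ => by
    rw [sub_eq_add_neg, Real.exp_add, Complex.ofReal_mul, exp_neg_mul_sq_eq_integral s hs,
      exp_neg_mul_sq_eq_integral t ht, ← integral_prod_mul]
    congr 1; ext p
    simp only [Φ]
    rw [← Complex.exp_add, Complex.add_re]; push_cast; congr 1; ring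
  have hmeas : Measurable fun q : (ℕ → ℂ) × (ℂ × ℂ) => Φ q.2.1 q.2.2 q.1 := by
    have h1 : Measurable fun q : (ℕ → ℂ) × (ℂ × ℂ) => gef q.1 z :=
      (measurable_gef z).comp measurable_fst
    have h2 : Measurable fun q : (ℕ → ℂ) × (ℂ × ℂ) => gef q.1 w :=
      (measurable_gef w).comp measurable_fst
    simp only [Φ]
    fun_prop
  -- for fixed `u` and `v`, the expectation is a Gaussian function of `(u, v)`
  have step2 : ∀ u v : ℂ, ∫ ζ, Φ u v ζ ∂coeffLaw =
      Complex.exp (-((s * A * ‖u‖ ^ 2 : ℝ) : ℂ)) *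
      Complex.exp (-(t * B : ℂ) * (‖v‖ : ℂ) ^ 2 + (1 : ℂ) *
        (inner ℝ ((-2 * √s * √t : ℝ) * u * K : ℂ) v : ℝ)) := fun u v => by
    rw [integral_cexp_gef, ← Complex.exp_add]
    congr 1
    have e1 : (√s) ^ 2 = s := Real.sq_sqrt hs
    have e2 : (√t) ^ 2 = t := Real.sq_sqrt ht
    rw [real_inner_comm, Complex.inner]
    have e3 : (((2 * √s : ℝ) : ℂ) * u * (starRingEnd ℂ) (((2 * √t : ℝ) : ℂ) * v) * K).re =
        4 * √s * √t * (u * K * (starRingEnd ℂ) v).re := by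
      rw [map_mul, Complex.conj_ofReal, ← Complex.re_ofReal_mul]
      congr 1; push_cast; ring
    have e4 : (((-2 * √s * √t : ℝ) * u * K : ℂ) * (starRingEnd ℂ) v).re =
        -2 * √s * √t * (u * K * (starRingEnd ℂ) v).re := by
      rw [← Complex.re_ofReal_mul]
      congr 1; ring
    rw [e3, e4, show Real.exp (‖z‖ ^ 2) = A from rfl, show Real.exp (‖w‖ ^ 2) = B from rfl]
    simp only [norm_mul, Complex.norm_real, Real.norm_of_nonneg (show 0 ≤ 2 * √s by positivity),
      Real.norm_of_nonneg (show 0 ≤ 2 * √t by positivity), mul_pow, e1, e2]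
    push_cast
    ring
  have hD : 0 < (1 + s * A) * (1 + t * B) - s * t * ‖K‖ ^ 2 := by
    have := mul_le_mul_of_nonneg_left hK (mul_nonneg hs ht)
    nlinarith [mul_nonneg hs hA.le, mul_nonneg ht hB.le]
  have htB : 0 < 1 + t * B := by positivity
  -- the Gaussian integral over `v`, leaving a Gaussian function of `u`
  have step3 : ∀ u : ℂ, ∫ v, (∫ ζ, Φ u v ζ ∂coeffLaw) ∂stdComplexGaussian =
      1 / (1 + t * B : ℂ) *
      Complex.exp (-((s * A - s * t * ‖K‖ ^ 2 / (1 + t * B) : ℝ) : ℂ) * (‖u‖ : ℂ) ^ 2 + 0 *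
        (inner ℝ (0 : ℂ) u : ℝ)) := fun u => by
    simp_rw [step2]
    have hre : (-1 : ℝ) < (t * B : ℂ).re := by
      rw [← Complex.ofReal_mul, Complex.ofReal_re]
      have : 0 ≤ t * B := by positivity
      linarith
    rw [integral_const_mul, integral_stdComplexGaussian_cexp _ _ _ hre, mul_left_comm,
      ← Complex.exp_add]
    congr 2
    have e1 : ((√s : ℝ) : ℂ) ^ 2 = s := by exact_mod_cast congrArg ((↑) : ℝ → ℂ) (Real.sq_sqrt hs)
    have e2 : ((√t : ℝ) : ℂ) ^ 2 = t := by exact_mod_cast congrArg ((↑) : ℝ → ℂ) (Real.sq_sqrt ht)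
    have e3 : (‖((-2 * √s * √t : ℝ) * u * K : ℂ)‖) ^ 2 = 4 * s * t * ‖u‖ ^ 2 * ‖K‖ ^ 2 := by
      rw [norm_mul, norm_mul, Complex.norm_real, mul_pow, mul_pow, Real.norm_eq_abs, sq_abs,
        mul_pow, mul_pow, Real.sq_sqrt hs, Real.sq_sqrt ht]; ring
    have htB' : (1 + t * B : ℂ) ≠ 0 := by exact_mod_cast htB.ne'
    rw [← Complex.ofReal_pow, e3]
    push_cast
    field_simp
    ring
  have hfin : Complex.ofReal (∫ ζ, Real.exp (-(s * ‖gef ζ z‖ ^ 2) - t * ‖gef ζ w‖ ^ 2) ∂coeffLaw)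
      = ((1 / ((1 + s * A) * (1 + t * B) - s * t * ‖K‖ ^ 2) : ℝ) : ℂ) := by
    rw [← integral_complex_ofReal]
    simp_rw [step1]
    rw [integral_integral_swap]
    · rw [integral_prod]
      · simp_rw [step3]
        rw [integral_const_mul, integral_stdComplexGaussian_cexp]
        · have h1 : (1 + t * B : ℂ) ≠ 0 := by exact_mod_cast htB.ne'
          have h2 : ((1 + s * A) * (1 + t * B) - s * t * ‖K‖ ^ 2 : ℂ) ≠ 0 := by
            exact_mod_cast hD.ne'
          have h3 : (1 + (s * A - s * t * ‖K‖ ^ 2 / (1 + t * B)) : ℂ) =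
            ((1 + s * A) * (1 + t * B) - s * t * ‖K‖ ^ 2 : ℂ) / (1 + t * B) := by
            field_simp; ring
          push_cast
          rw [h3]
          simp only [norm_zero, Complex.ofReal_zero, ne_eq, OfNat.ofNat_ne_zero,
            not_false_eq_true, zero_pow, mul_zero, zero_div, Complex.exp_zero, mul_one]
          field_simp
        · rw [Complex.ofReal_re]
          have : 0 < 1 + (s * A - s * t * ‖K‖ ^ 2 / (1 + t * B)) := by
            have e : 1 + (s * A - s * t * ‖K‖ ^ 2 / (1 + t * B)) =
              ((1 + s * A) * (1 + t * B) - s * t * ‖K‖ ^ 2) / (1 + t * B) := by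
              field_simp; ring
            rw [e]; positivity
          linarith
      · refine Integrable.of_bound (C := 1) ?_ (ae_of_all _ fun p => ?_)
        · exact (StronglyMeasurable.integral_prod_right (f := fun (p : ℂ × ℂ) ζ => Φ p.1 p.2 ζ)
            (hmeas.comp measurable_swap).stronglyMeasurable).aestronglyMeasurable
        · refine (norm_integral_le_integral_norm _).trans ?_
          simp [hΦ1]
    · exact Integrable.of_bound hmeas.aestronglyMeasurable 1 (ae_of_all _ fun q => (hΦ1 _ _ _).le)
  exact_mod_cast hfin

/-- The squared modulus of `gef ζ z`, normalized to have mean one: `‖F(z)‖² exp (-‖z‖²)`. -/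
def gefIntensity (ζ : ℕ → ℂ) (z : ℂ) : ℝ := ‖gef ζ z‖ ^ 2 * Real.exp (-‖z‖ ^ 2)

theorem measurable_gefIntensity (z : ℂ) : Measurable fun ζ : ℕ → ℂ => gefIntensity ζ z :=
  ((measurable_gef z).norm.pow_const 2).mul_const _

theorem gefIntensity_nonneg (ζ : ℕ → ℂ) (z : ℂ) : 0 ≤ gefIntensity ζ z := by
  unfold gefIntensity; positivity

/-- The joint Laplace transform of the normalized intensities depends on `z - w` only: these are
standard exponential variables with correlation `exp (-‖z - w‖²)`. -/
theorem integral_exp_neg_gefIntensity (z w : ℂ) (s t : ℝ) (hs : 0 ≤ s) (ht : 0 ≤ t) :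
    ∫ ζ, Real.exp (-(s * gefIntensity ζ z) - t * gefIntensity ζ w) ∂coeffLaw
      = 1 / ((1 + s) * (1 + t) - s * t * Real.exp (-‖z - w‖ ^ 2)) := by
  have h := integral_exp_neg_gef_sq (s * Real.exp (-‖z‖ ^ 2)) (t * Real.exp (-‖w‖ ^ 2))
    (by positivity) (by positivity) z w
  simp only [gefIntensity]
  have h1 : ∀ z : ℂ, Real.exp (-‖z‖ ^ 2) * Real.exp (‖z‖ ^ 2) = 1 := fun z => by
    rw [← Real.exp_add]; simp
  have h2 : Real.exp (-‖z‖ ^ 2) * Real.exp (-‖w‖ ^ 2) *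
      ‖Complex.exp (z * (starRingEnd ℂ) w)‖ ^ 2 = Real.exp (-‖z - w‖ ^ 2) := by
    rw [Complex.norm_exp, ← Real.exp_nat_mul, ← Real.exp_add, ← Real.exp_add]
    congr 1
    rw [← Complex.normSq_eq_norm_sq, ← Complex.normSq_eq_norm_sq, ← Complex.normSq_eq_norm_sq,
      Complex.normSq_sub]
    push_cast; ring
  rw [mul_assoc s, mul_assoc t, h1, h1, mul_one, mul_one,
    show s * Real.exp (-‖z‖ ^ 2) * (t * Real.exp (-‖w‖ ^ 2)) *
      ‖Complex.exp (z * (starRingEnd ℂ) w)‖ ^ 2 = s * t * (Real.exp (-‖z‖ ^ 2) *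
        Real.exp (-‖w‖ ^ 2) * ‖Complex.exp (z * (starRingEnd ℂ) w)‖ ^ 2) by ring, h2] at h
  rw [← h]
  congr 1; ext ζ; congr 1; ring

/-! ### Frullani integrals and the covariance of logarithms -/

/-- Lebesgue measure on the half-line `(0, ∞)`. -/
abbrev halfLine : Measure ℝ := volume.restrict (Set.Ioi 0)

/-- The Frullani integrand `(exp (-s) - exp (-s a)) / s`, with integral `log a` over `(0, ∞)`. -/
def frullani (s a : ℝ) : ℝ := s⁻¹ * (Real.exp (-s) - Real.exp (-(s * a)))

/-- The mean of `frullani s A` for a standard exponential variable `A`. -/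
def frullaniMean (s : ℝ) : ℝ := s⁻¹ * (Real.exp (-s) - 1 / (1 + s))

/-- The mean of the logarithm of a standard exponential variable, as a Frullani integral. -/
def logMean : ℝ := ∫ s, frullaniMean s ∂halfLine

theorem integrable_frullani {a : ℝ} (ha : 0 < a) : Integrable (fun s => frullani s a) halfLine := by
  have hm : 0 < min 1 a := lt_min one_pos ha
  -- the mean value inequality gives the majorant `|1 - a| exp (-s min(1, a))`
  have hE := (integrableOn_exp_mul_Ioi (a := -(min 1 a)) (by linarith) 0).const_mul |1 - a|
  refine hE.mono' (by unfold frullani; fun_prop) ?_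
  filter_upwards [self_mem_ae_restrict measurableSet_Ioi] with s (hs : 0 < s)
  have key : ∀ x y : ℝ, x ≤ y → |Real.exp (-x) - Real.exp (-y)| ≤ Real.exp (-x) * (y - x) := by
    intro x y hxy
    rw [abs_of_nonneg (sub_nonneg.2 (Real.exp_le_exp.2 (by linarith)))]
    have h1 : Real.exp (-y) = Real.exp (-x) * Real.exp (-(y - x)) := by
      rw [← Real.exp_add]; ring_nf
    have h2 := Real.add_one_le_exp (-(y - x))
    rw [h1]
    nlinarith [Real.exp_pos (-x)]
  rw [frullani, Real.norm_eq_abs, abs_mul, abs_of_pos (inv_pos.2 hs)]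
  rw [inv_mul_le_iff₀ hs]
  rcases le_total 1 a with h | h
  · have := key s (s * a) (by nlinarith)
    rw [min_eq_left h, abs_of_nonpos (by linarith : 1 - a ≤ 0), neg_one_mul]
    linarith
  · have := key (s * a) s (by nlinarith)
    rw [abs_sub_comm] at this
    rw [min_eq_right h, abs_of_nonneg (by linarith : 0 ≤ 1 - a)]
    rw [show -a * s = -(s * a) by ring]
    linarith

theorem integral_frullani {a : ℝ} (ha : 0 < a) : ∫ s, frullani s a ∂halfLine = Real.log a := by
  have hc : Continuous fun x : ℝ => Real.exp (-x) := by fun_prop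
  have h := Frullani.integral_Ioi_eq (f := fun x : ℝ => Real.exp (-x)) (a := 1) (b := a)
    (L := 1) (R := 0) (hc.continuousOn.locallyIntegrableOn measurableSet_Ioi) one_pos ha
    (by simpa using (hc.tendsto 0).mono_left nhdsWithin_le_nhds)
    (Real.tendsto_exp_neg_atTop_nhds_zero)
  have e : ∀ x : ℝ, x⁻¹ • (Real.exp (-(1 * x)) - Real.exp (-(a * x))) = frullani x a := fun x => by
    rw [frullani, smul_eq_mul, one_mul, mul_comm a]
  simp only [e] at h
  have := h (integrable_frullani ha)
  simpa using this

/-- For fixed `a`, the sign of `frullani s a` does not depend on `s`. -/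
theorem frullani_mul_frullani_nonneg {s t a : ℝ} (hs : 0 < s) (ht : 0 < t) :
    0 ≤ frullani s a * frullani t a := by
  unfold frullani
  rcases le_total 1 a with h | h
  · have h1 : Real.exp (-(s * a)) ≤ Real.exp (-s) := Real.exp_le_exp.2 (by nlinarith)
    have h2 : Real.exp (-(t * a)) ≤ Real.exp (-t) := Real.exp_le_exp.2 (by nlinarith)
    exact mul_nonneg (mul_nonneg (inv_pos.2 hs).le (by linarith))
      (mul_nonneg (inv_pos.2 ht).le (by linarith))
  · have h1 : Real.exp (-s) ≤ Real.exp (-(s * a)) := Real.exp_le_exp.2 (by nlinarith)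
    have h2 : Real.exp (-t) ≤ Real.exp (-(t * a)) := Real.exp_le_exp.2 (by nlinarith)
    exact mul_nonneg_of_nonpos_of_nonpos
      (mul_nonpos_of_nonneg_of_nonpos (inv_pos.2 hs).le (by linarith))
      (mul_nonpos_of_nonneg_of_nonpos (inv_pos.2 ht).le (by linarith))

theorem integral_norm_frullani {a : ℝ} (ha : 0 < a) :
    ∫ s, ‖frullani s a‖ ∂halfLine = |Real.log a| := by
  rcases le_total 1 a with h | h
  · rw [abs_of_nonneg (Real.log_nonneg h), ← integral_frullani ha]
    refine setIntegral_congr_fun measurableSet_Ioi fun s (hs : 0 < s) => ?_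
    have h1 : Real.exp (-(s * a)) ≤ Real.exp (-s) := Real.exp_le_exp.2 (by nlinarith)
    exact Real.norm_of_nonneg (mul_nonneg (inv_pos.2 hs).le (by linarith))
  · rw [abs_of_nonpos (Real.log_nonpos ha.le h), ← integral_frullani ha, ← integral_neg]
    refine setIntegral_congr_fun measurableSet_Ioi fun s (hs : 0 < s) => ?_
    have h1 : Real.exp (-s) ≤ Real.exp (-(s * a)) := Real.exp_le_exp.2 (by nlinarith)
    exact Real.norm_of_nonpos (mul_nonpos_of_nonneg_of_nonpos (inv_pos.2 hs).le (by linarith))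

theorem integrable_one_add_rpow :
    Integrable (fun s : ℝ => (1 + s) ^ (-(3 / 2) : ℝ)) halfLine := by
  have := integrableOn_add_rpow_Ioi_of_lt (a := (-(3 / 2) : ℝ)) (c := 0) (m := 1)
    (by norm_num) (by norm_num)
  simp only [add_comm _ (1 : ℝ)] at this
  exact this

theorem one_div_sq_le_rpow {s : ℝ} (hs : 0 < s) : 1 / (1 + s) ^ 2 ≤ (1 + s) ^ (-(3 / 2) : ℝ) := by
  rw [one_div, ← Real.rpow_natCast, ← Real.rpow_neg (by positivity)]
  exact Real.rpow_le_rpow_of_exponent_le (by linarith) (by norm_num)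

theorem abs_frullaniMean_le {s : ℝ} (hs : 0 < s) : |frullaniMean s| ≤ 2 * (1 / (1 + s) ^ 2) := by
  have h0 : 0 < 1 + s := by linarith
  have hE := Real.exp_pos (-s)
  have h1 : (1 + s) * Real.exp (-s) ≤ 1 := by
    have h := Real.add_one_le_exp s
    have : Real.exp s * Real.exp (-s) = 1 := by rw [← Real.exp_add]; simp
    nlinarith
  have h2 : 1 - (1 + s) * Real.exp (-s) ≤ s ^ 2 := by
    have h := Real.add_one_le_exp (-s)
    nlinarith
  have e : frullaniMean s = -((1 - (1 + s) * Real.exp (-s)) / (s * (1 + s))) := by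
    unfold frullaniMean; field_simp; ring
  rw [e, abs_neg, abs_of_nonneg (div_nonneg (by linarith) (by positivity)), mul_one_div,
    div_le_div_iff₀ (by positivity) (by positivity)]
  rcases le_total s 1 with h | h
  · nlinarith [mul_le_mul_of_nonneg_right h2 (by positivity : 0 ≤ (1 + s) ^ 2),
      mul_nonneg (mul_nonneg hs.le h0.le) (by nlinarith : 0 ≤ 2 - s * (1 + s))]
  · have h3 : 1 - (1 + s) * Real.exp (-s) ≤ 1 := by nlinarith
    nlinarith [mul_le_mul_of_nonneg_right h3 (by positivity : 0 ≤ (1 + s) ^ 2)]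

theorem integrable_frullaniMean : Integrable frullaniMean halfLine := by
  refine (integrable_one_add_rpow.const_mul 2).mono' (by unfold frullaniMean; fun_prop) ?_
  filter_upwards [self_mem_ae_restrict measurableSet_Ioi] with s (hs : 0 < s)
  exact (abs_frullaniMean_le hs).trans (by linarith [one_div_sq_le_rpow hs])

variable {Ω : Type*} [MeasurableSpace Ω]

/-- `A` and `B` have the joint Laplace transform of the squared moduli of two standard complex
Gaussian variables with squared correlation `p`; for `p = 1` it is that of `(A, A)` with `A` a
standard exponential variable. -/
structure HasExpLaplace (P : Measure Ω) (A B : Ω → ℝ) (p : ℝ) : Prop where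
  measurable_left : Measurable A
  measurable_right : Measurable B
  nonneg_left : ∀ ω, 0 ≤ A ω
  nonneg_right : ∀ ω, 0 ≤ B ω
  laplace : ∀ s t, 0 ≤ s → 0 ≤ t →
    ∫ ω, Real.exp (-(s * A ω) - t * B ω) ∂P = 1 / ((1 + s) * (1 + t) - s * t * p)

namespace HasExpLaplace

variable {P : Measure Ω} {A B : Ω → ℝ} {p : ℝ}

theorem laplace_left (h : HasExpLaplace P A B p) {s : ℝ} (hs : 0 ≤ s) :
    ∫ ω, Real.exp (-(s * A ω)) ∂P = 1 / (1 + s) := by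
  simpa using h.laplace s 0 hs le_rfl

theorem laplace_right (h : HasExpLaplace P A B p) {t : ℝ} (ht : 0 ≤ t) :
    ∫ ω, Real.exp (-(t * B ω)) ∂P = 1 / (1 + t) := by
  simpa using h.laplace 0 t le_rfl ht

variable [IsProbabilityMeasure P]

theorem integrable_exp {A : Ω → ℝ} (hm : Measurable A) (h0 : ∀ ω, 0 ≤ A ω) {s : ℝ} (hs : 0 ≤ s) :
    Integrable (fun ω => Real.exp (-(s * A ω))) P := by
  refine Integrable.of_bound (by fun_prop) 1 (ae_of_all _ fun ω => ?_)
  rw [Real.norm_of_nonneg (Real.exp_pos _).le, Real.exp_le_one_iff]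
  have := mul_nonneg hs (h0 ω); linarith

/-- The mass of `{A = 0}` is at most the Laplace transform `1 / (1 + n)`, for every `n`. -/
theorem ae_pos (h : HasExpLaplace P A B p) : ∀ᵐ ω ∂P, 0 < A ω := by
  have hms : MeasurableSet {ω | A ω = 0} := h.measurable_left (measurableSet_singleton 0)
  have h1 : ∀ n : ℕ, P.real {ω | A ω = 0} ≤ 1 / (1 + (n : ℝ)) := fun n => by
    rw [← h.laplace_left (Nat.cast_nonneg n), ← integral_indicator_one hms]
    refine integral_mono ((integrable_const 1).indicator hms)
      (integrable_exp h.measurable_left h.nonneg_left (Nat.cast_nonneg n)) fun ω => ?_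
    by_cases hω : A ω = 0
    · simp [hω]
    · simp [hω, Real.exp_nonneg]
  have h2 : Tendsto (fun n : ℕ => 1 / (1 + (n : ℝ))) atTop (𝓝 0) := by
    simpa [add_comm] using tendsto_one_div_add_atTop_nhds_zero_nat (𝕜 := ℝ)
  have h3 : P.real {ω | A ω = 0} = 0 :=
    le_antisymm (ge_of_tendsto' h2 h1) measureReal_nonneg
  have h4 : P {ω | A ω = 0} = 0 := by rwa [measureReal_eq_zero_iff] at h3
  filter_upwards [measure_eq_zero_iff_ae_notMem.1 h4] with ω hω
  exact lt_of_le_of_ne (h.nonneg_left ω) (Ne.symm hω)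

theorem integral_frullani_mul (h : HasExpLaplace P A B p) {s t : ℝ} (hs : 0 < s) (ht : 0 < t) :
    ∫ ω, frullani s (A ω) * frullani t (B ω) ∂P =
      (s * t)⁻¹ * (1 / ((1 + s) * (1 + t) - s * t * p) - 1 / ((1 + s) * (1 + t)))
        + frullaniMean s * frullaniMean t := by
  have i1 := integrable_exp (P := P) h.measurable_left h.nonneg_left hs.le
  have i2 := integrable_exp (P := P) h.measurable_right h.nonneg_right ht.le
  have i3 : Integrable (fun ω => Real.exp (-(s * A ω) - t * B ω)) P := by
    have hA := h.measurable_left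
    have hB := h.measurable_right
    refine Integrable.of_bound (by fun_prop) 1 (ae_of_all _ fun ω => ?_)
    rw [Real.norm_of_nonneg (Real.exp_pos _).le, Real.exp_le_one_iff]
    have := mul_nonneg hs.le (h.nonneg_left ω)
    have := mul_nonneg ht.le (h.nonneg_right ω); linarith
  have e : ∀ ω, frullani s (A ω) * frullani t (B ω) = (s * t)⁻¹ *
      (Real.exp (-s) * Real.exp (-t) - Real.exp (-s) * Real.exp (-(t * B ω))
        - Real.exp (-t) * Real.exp (-(s * A ω)) + Real.exp (-(s * A ω) - t * B ω)) := fun ω => by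
    rw [frullani, frullani, sub_eq_add_neg (-(s * A ω)), Real.exp_add, mul_inv]; ring
  simp_rw [e]
  have I1 : Integrable (fun ω => Real.exp (-s) * Real.exp (-t) -
      Real.exp (-s) * Real.exp (-(t * B ω))) P := (integrable_const _).sub (i2.const_mul _)
  have I2 : Integrable (fun ω => Real.exp (-s) * Real.exp (-t) -
      Real.exp (-s) * Real.exp (-(t * B ω)) - Real.exp (-t) * Real.exp (-(s * A ω))) P :=
    I1.sub (i1.const_mul _)
  rw [integral_const_mul, integral_add I2 i3, integral_sub I1 (i1.const_mul _),
    integral_sub (integrable_const _) (i2.const_mul _), integral_const_mul (Real.exp (-s)) fun ω =>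
      Real.exp (-(t * B ω)), integral_const_mul (Real.exp (-t)), h.laplace_left hs.le,
        h.laplace_right ht.le, h.laplace s t hs.le ht.le]
  simp only [integral_const, probReal_univ, smul_eq_mul, one_mul, frullaniMean, mul_inv]
  field_simp
  ring

/-- The logarithm of a standard exponential variable is square-integrable: `(log A)²` is the
double integral of the nonnegative function `frullani s A * frullani t A`. -/
theorem memLp_log (h : HasExpLaplace P A A 1) : MemLp (fun ω => Real.log (A ω)) 2 P := by
  have hA := h.measurable_left
  -- the double Frullani integrand is nonnegative, so by Tonelli it suffices to integrate over `Ω`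
  -- first, where the Laplace transform gives an explicit function of the two parameters
  have hint : Integrable (fun q : Ω × (ℝ × ℝ) => frullani q.2.1 (A q.1) * frullani q.2.2 (A q.1))
      (P.prod (halfLine.prod halfLine)) := by
    have hmeas : Measurable fun q : Ω × (ℝ × ℝ) =>
        frullani q.2.1 (A q.1) * frullani q.2.2 (A q.1) := by unfold frullani; fun_prop
    rw [integrable_prod_iff' hmeas.aestronglyMeasurable]
    have hpos : ∀ᵐ q : ℝ × ℝ ∂(halfLine.prod halfLine), 0 < q.1 ∧ 0 < q.2 := by
      rw [Measure.prod_restrict]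
      filter_upwards [self_mem_ae_restrict (measurableSet_Ioi.prod measurableSet_Ioi)] with q hq
      exact hq
    have hi : ∀ s t : ℝ, 0 < s → 0 < t →
        Integrable (fun ω => frullani s (A ω) * frullani t (A ω)) P := fun s t hs ht => by
      refine Integrable.of_bound (by unfold frullani; fun_prop) ((s⁻¹ * 2) * (t⁻¹ * 2))
        (ae_of_all _ fun ω => ?_)
      have hb : ∀ s, 0 < s → ‖frullani s (A ω)‖ ≤ s⁻¹ * 2 := fun s hs => by
        rw [frullani, norm_mul, Real.norm_of_nonneg (inv_pos.2 hs).le]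
        gcongr
        refine (norm_sub_le _ _).trans ?_
        rw [Real.norm_of_nonneg (Real.exp_pos _).le, Real.norm_of_nonneg (Real.exp_pos _).le]
        have h1 : Real.exp (-s) ≤ 1 := Real.exp_le_one_iff.2 (by linarith)
        have h2 : Real.exp (-(s * A ω)) ≤ 1 :=
          Real.exp_le_one_iff.2 (by have := mul_nonneg hs.le (h.nonneg_left ω); linarith)
        linarith
      rw [norm_mul]
      exact mul_le_mul (hb s hs) (hb t ht) (norm_nonneg _) (by positivity)
    refine ⟨hpos.mono fun q hq => hi _ _ hq.1 hq.2, ?_⟩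
    refine ((integrable_one_add_rpow.mul_prod integrable_one_add_rpow).const_mul 5).mono'
      (StronglyMeasurable.integral_prod_right
        (f := fun (q : ℝ × ℝ) ω => ‖frullani q.1 (A ω) * frullani q.2 (A ω)‖)
        (hmeas.norm.comp measurable_swap).stronglyMeasurable).aestronglyMeasurable
      (hpos.mono fun q hq => ?_)
    obtain ⟨hs, ht⟩ := hq
    have e : (fun ω => ‖frullani q.1 (A ω) * frullani q.2 (A ω)‖) =
      fun ω => frullani q.1 (A ω) * frullani q.2 (A ω) := by
      ext ω; exact Real.norm_of_nonneg (frullani_mul_frullani_nonneg hs ht)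
    rw [e, h.integral_frullani_mul hs ht]
    set s := q.1
    set t := q.2
    have e2 : (s * t)⁻¹ * (1 / ((1 + s) * (1 + t) - s * t * 1) - 1 / ((1 + s) * (1 + t))) =
        1 / ((1 + s) * (1 + t) * (1 + s + t)) := by
      have : (1 + s) * (1 + t) - s * t * 1 = 1 + s + t := by ring
      rw [this]; field_simp; ring
    -- `(1 + s)(1 + t) ≤ (1 + s + t)²` separates the variables
    have h1 : 1 / ((1 + s) * (1 + t) * (1 + s + t)) ≤
        (1 + s) ^ (-(3 / 2) : ℝ) * (1 + t) ^ (-(3 / 2) : ℝ) := by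
      rw [← Real.mul_rpow (by positivity) (by positivity), one_div,
        ← inv_inv (((1 + s) * (1 + t)) ^ _),
        ← Real.rpow_neg (by positivity), neg_neg]
      refine inv_anti₀ (by positivity) ?_
      have e3 : ((1 + s) * (1 + t)) ^ (3 / 2 : ℝ) =
          (1 + s) * (1 + t) * √((1 + s) * (1 + t)) := by
        rw [Real.sqrt_eq_rpow, ← Real.rpow_one_add' (by positivity) (by norm_num)]; norm_num
      rw [e3]
      gcongr
      rw [Real.sqrt_le_left (by positivity)]
      nlinarith [mul_pos hs ht]
    have h2 : ‖frullaniMean s * frullaniMean t‖ ≤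
        2 * (1 + s) ^ (-(3 / 2) : ℝ) * (2 * (1 + t) ^ (-(3 / 2) : ℝ)) := by
      rw [norm_mul]
      refine mul_le_mul ((abs_frullaniMean_le hs).trans ?_) ((abs_frullaniMean_le ht).trans ?_)
        (norm_nonneg _) (by positivity)
      · linarith [one_div_sq_le_rpow hs]
      · linarith [one_div_sq_le_rpow ht]
    rw [e2]
    refine (norm_add_le _ _).trans ?_
    rw [Real.norm_of_nonneg (by positivity : 0 ≤ 1 / ((1 + s) * (1 + t) * (1 + s + t)))]
    linarith
  rw [memLp_two_iff_integrable_sq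
    (hA.log.aestronglyMeasurable : AEStronglyMeasurable (fun ω => Real.log (A ω)) P)]
  refine hint.integral_prod_left.congr ?_
  filter_upwards [h.ae_pos] with ω hω
  rw [integral_prod_mul (fun s => frullani s (A ω)) (fun t => frullani t (A ω)),
    integral_frullani hω, sq]

theorem integral_log (h : HasExpLaplace P A B p) (hlog : Integrable (fun ω => Real.log (A ω)) P) :
    ∫ ω, Real.log (A ω) ∂P = logMean := by
  have hA := h.measurable_left
  have hmeas : Measurable fun q : Ω × ℝ => frullani q.2 (A q.1) := by unfold frullani; fun_prop
  have hint : Integrable (fun q : Ω × ℝ => frullani q.2 (A q.1)) (P.prod halfLine) := by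
    rw [integrable_prod_iff hmeas.aestronglyMeasurable]
    refine ⟨h.ae_pos.mono fun ω hω => integrable_frullani hω, hlog.norm.congr ?_⟩
    filter_upwards [h.ae_pos] with ω hω
    exact (integral_norm_frullani hω).symm
  calc ∫ ω, Real.log (A ω) ∂P = ∫ ω, ∫ s, frullani s (A ω) ∂halfLine ∂P := by
        refine integral_congr_ae ?_
        filter_upwards [h.ae_pos] with ω hω using (integral_frullani hω).symm
    _ = ∫ s, ∫ ω, frullani s (A ω) ∂P ∂halfLine := integral_integral_swap hint
    _ = logMean := by
        refine setIntegral_congr_fun measurableSet_Ioi fun s (hs : 0 < s) => ?_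
        simp only [frullani, frullaniMean]
        rw [integral_const_mul, integral_sub (integrable_const _)
          (integrable_exp h.measurable_left h.nonneg_left hs.le), h.laplace_left hs.le]
        simp

theorem integral_pow_div_one_add_pow (n : ℕ) :
    IntegrableOn (fun s : ℝ => s ^ n / (1 + s) ^ (n + 2)) (Set.Ioi 0) ∧
      ∫ s, s ^ n / (1 + s) ^ (n + 2) ∂halfLine = 1 / (n + 1) := by
  have hderiv : ∀ s ∈ Set.Ioi (0 : ℝ), HasDerivAt (fun s : ℝ => (s / (1 + s)) ^ (n + 1) / (n + 1))
      (s ^ n / (1 + s) ^ (n + 2)) s := fun s (hs : 0 < s) => by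
    have h0 : 1 + s ≠ 0 := by positivity
    have h1 := (((hasDerivAt_id s).div ((hasDerivAt_id s).const_add 1) h0).pow (n + 1)).div_const
      ((n : ℝ) + 1)
    refine h1.congr_deriv ?_
    have : (n : ℝ) + 1 ≠ 0 := by positivity
    simp only [Nat.cast_add, Nat.cast_one, id, add_tsub_cancel_right, Pi.div_apply, div_pow]
    field_simp
    ring
  have hcont : ContinuousWithinAt (fun s : ℝ => (s / (1 + s)) ^ (n + 1) / (n + 1)) (Set.Ici 0) 0 :=
    (((continuousAt_id.div (continuousAt_const.add continuousAt_id) (by simp)).pow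
      (n + 1)).div_const _).continuousWithinAt
  have hlim : Tendsto (fun s : ℝ => (s / (1 + s)) ^ (n + 1) / (n + 1)) atTop (𝓝 (1 / (n + 1))) := by
    have h1 : Tendsto (fun s : ℝ => s / (1 + s)) atTop (𝓝 1) := by
      have h2 : Tendsto (fun s : ℝ => 1 - (1 + s)⁻¹) atTop (𝓝 (1 - 0)) :=
        tendsto_const_nhds.sub (tendsto_inv_atTop_zero.comp
          (tendsto_atTop_add_const_left _ 1 tendsto_id))
      rw [sub_zero] at h2
      refine h2.congr' ?_
      filter_upwards [eventually_gt_atTop 0] with s hs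
      field_simp; ring
    simpa using (h1.pow (n + 1)).div_const ((n : ℝ) + 1)
  have hpos : ∀ s ∈ Set.Ioi (0 : ℝ), 0 ≤ s ^ n / (1 + s) ^ (n + 2) := fun s (hs : 0 < s) => by
    positivity
  refine ⟨integrableOn_Ioi_deriv_of_nonneg hcont hderiv hpos hlim, ?_⟩
  rw [integral_Ioi_of_hasDerivAt_of_nonneg hcont hderiv hpos hlim]
  simp

/-- The covariance of the logarithms of the squared moduli of two standard complex Gaussian
variables with squared correlation `p` is the dilogarithm `∑ pⁿ / n²`: after writing both logarithms
as Frullani integrals, the covariance of the integrands is a geometric series in `p`. -/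
theorem hasSum_integral_log_sub_mul (h : HasExpLaplace P A B p) (hA : HasExpLaplace P A A 1)
    (hB : HasExpLaplace P B B 1) (hp0 : 0 ≤ p) (hp1 : p ≤ 1) :
    HasSum (fun n : ℕ => p ^ (n + 1) / ((n : ℝ) + 1) ^ 2)
      (∫ ω, (Real.log (A ω) - logMean) * (Real.log (B ω) - logMean) ∂P) := by
  have hmA := h.measurable_left
  have hmB := h.measurable_right
  have hlA := hA.memLp_log
  have hlB := hB.memLp_log
  have hmk : Measurable frullaniMean := by unfold frullaniMean; fun_prop
  have hmeas : Measurable fun q : Ω × (ℝ × ℝ) =>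
      (frullani q.2.1 (A q.1) - frullaniMean q.2.1) *
      (frullani q.2.2 (B q.1) - frullaniMean q.2.2) := by
    unfold frullani; fun_prop
  have hsub : ∀ a : ℝ, 0 < a → Integrable (fun s => frullani s a - frullaniMean s) halfLine :=
    fun a ha => (integrable_frullani ha).sub integrable_frullaniMean
  have hval : ∀ a : ℝ, 0 < a →
      ∫ s, (frullani s a - frullaniMean s) ∂halfLine = Real.log a - logMean := fun a ha => by
    rw [integral_sub (integrable_frullani ha) integrable_frullaniMean, integral_frullani ha,
      logMean]
  set κ := ∫ s, ‖frullaniMean s‖ ∂halfLine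
  have hκ : 0 ≤ κ := integral_nonneg fun _ => norm_nonneg _
  have hbd : ∀ a : ℝ, 0 < a →
      ∫ s, ‖frullani s a - frullaniMean s‖ ∂halfLine ≤ |Real.log a| + κ := fun a ha => by
    rw [← integral_norm_frullani ha, ← integral_add (integrable_frullani ha).norm
      integrable_frullaniMean.norm]
    exact integral_mono (hsub a ha).norm
      ((integrable_frullani ha).norm.add integrable_frullaniMean.norm) fun s => norm_sub_le _ _
  have hint : Integrable (fun q : Ω × (ℝ × ℝ) => (frullani q.2.1 (A q.1) - frullaniMean q.2.1) *
      (frullani q.2.2 (B q.1) - frullaniMean q.2.2)) (P.prod (halfLine.prod halfLine)) := by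
    rw [integrable_prod_iff hmeas.aestronglyMeasurable]
    refine ⟨?_, ?_⟩
    · filter_upwards [hA.ae_pos, hB.ae_pos] with ω h1 h2
      exact (hsub _ h1).mul_prod (hsub _ h2)
    · have hdom : Integrable (fun ω => (|Real.log (A ω)| + κ) * (|Real.log (B ω)| + κ)) P := by
        have h1 : MemLp (fun ω => |Real.log (A ω)| + κ) 2 P := hlA.norm.add (memLp_const κ)
        have h2 : MemLp (fun ω => |Real.log (B ω)| + κ) 2 P := hlB.norm.add (memLp_const κ)
        exact h1.integrable_mul h2
      refine hdom.mono' hmeas.norm.stronglyMeasurable.integral_prod_right'.aestronglyMeasurable ?_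
      filter_upwards [hA.ae_pos, hB.ae_pos] with ω h1 h2
      simp only [norm_mul]
      rw [integral_prod_mul (fun s => ‖frullani s (A ω) - frullaniMean s‖)
        (fun t => ‖frullani t (B ω) - frullaniMean t‖), norm_mul,
        Real.norm_of_nonneg (integral_nonneg fun _ => norm_nonneg _),
        Real.norm_of_nonneg (integral_nonneg fun _ => norm_nonneg _)]
      exact mul_le_mul (hbd _ h1) (hbd _ h2) (integral_nonneg fun _ =>
        norm_nonneg _) (by positivity)
  have hpos : ∀ᵐ q : ℝ × ℝ ∂(halfLine.prod halfLine), 0 < q.1 ∧ 0 < q.2 := by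
    rw [Measure.prod_restrict]
    filter_upwards [self_mem_ae_restrict (measurableSet_Ioi.prod measurableSet_Ioi)] with q hq
    exact hq
  have hb : ∀ (A : Ω → ℝ), (∀ ω, 0 ≤ A ω) → Measurable A → ∀ s, 0 < s →
      MemLp (fun ω => frullani s (A ω)) 2 P := fun A h0 hm s hs => by
    refine MemLp.of_bound (by unfold frullani; fun_prop) (s⁻¹ * 2) (ae_of_all _ fun ω => ?_)
    rw [frullani, norm_mul, Real.norm_of_nonneg (inv_pos.2 hs).le]
    gcongr
    refine (norm_sub_le _ _).trans ?_
    rw [Real.norm_of_nonneg (Real.exp_pos _).le, Real.norm_of_nonneg (Real.exp_pos _).le]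
    have h1 : Real.exp (-s) ≤ 1 := Real.exp_le_one_iff.2 (by linarith)
    have h2 : Real.exp (-(s * A ω)) ≤ 1 :=
      Real.exp_le_one_iff.2 (by have := mul_nonneg hs.le (h0 ω); linarith)
    linarith
  have hmean : ∀ (A : Ω → ℝ), HasExpLaplace P A A 1 → ∀ s, 0 < s →
      ∫ ω, frullani s (A ω) ∂P = frullaniMean s := fun A h s hs => by
    simp only [frullani, frullaniMean]
    rw [integral_const_mul, integral_sub (integrable_const _)
      (integrable_exp h.measurable_left h.nonneg_left hs.le), h.laplace_left hs.le]
    simp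
  -- centring the Frullani integrands removes the product of the means
  have hcov : ∀ s t : ℝ, 0 < s → 0 < t →
      ∫ ω, (frullani s (A ω) - frullaniMean s) * (frullani t (B ω) - frullaniMean t) ∂P =
      (s * t)⁻¹ * (1 / ((1 + s) * (1 + t) - s * t * p) - 1 / ((1 + s) * (1 + t))) :=
    fun s t hs ht => by
    have m1 := hb A hA.nonneg_left hmA s hs
    have m2 := hb B hB.nonneg_left hmB t ht
    have e : ∀ ω, (frullani s (A ω) - frullaniMean s) * (frullani t (B ω) - frullaniMean t) =
        frullani s (A ω) * frullani t (B ω) - frullaniMean t * frullani s (A ω) -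
        (frullaniMean s * frullani t (B ω) - frullaniMean s * frullaniMean t) := fun ω => by ring
    have j1 : Integrable (fun ω => frullani s (A ω) * frullani t (B ω)) P := m1.integrable_mul m2
    have j2 := (m1.integrable one_le_two).const_mul (frullaniMean t)
    have j3 := (m2.integrable one_le_two).const_mul (frullaniMean s)
    have j4 : Integrable (fun ω => frullani s (A ω) * frullani t (B ω) -
        frullaniMean t * frullani s (A ω)) P := j1.sub j2
    have j5 : Integrable (fun ω => frullaniMean s * frullani t (B ω) -
        frullaniMean s * frullaniMean t) P := j3.sub (integrable_const _)
    simp_rw [e]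
    rw [integral_sub j4 j5, integral_sub j1 j2,
      integral_sub j3 (integrable_const _), integral_const_mul, integral_const_mul,
      h.integral_frullani_mul hs ht, hmean A hA s hs, hmean B hB t ht]
    simp only [integral_const, probReal_univ, smul_eq_mul, one_mul]
    ring
  -- the covariance at `(s, t)` is a geometric series, whose terms are products of functions of `s`
  -- and of `t`
  let g : ℕ → ℝ → ℝ := fun n s => s ^ n / (1 + s) ^ (n + 2)
  have hgi : ∀ n, Integrable (g n) halfLine := fun n => (integral_pow_div_one_add_pow n).1
  have hgv : ∀ n, ∫ s, g n s ∂halfLine = 1 / (n + 1) := fun n => (integral_pow_div_one_add_pow n).2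
  let F : ℕ → ℝ × ℝ → ℝ := fun n q => p ^ (n + 1) * (g n q.1 * g n q.2)
  have hFi : ∀ n, Integrable (F n) (halfLine.prod halfLine) := fun n =>
    ((hgi n).mul_prod (hgi n)).const_mul _
  have hFv : ∀ n, ∫ q, F n q ∂(halfLine.prod halfLine) = p ^ (n + 1) / ((n : ℝ) + 1) ^ 2 :=
    fun n => by
    simp only [F]
    rw [integral_const_mul, integral_prod_mul, hgv]
    field_simp
  have hFn : ∀ n, ∫ q, ‖F n q‖ ∂(halfLine.prod halfLine) = p ^ (n + 1) / ((n : ℝ) + 1) ^ 2 :=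
    fun n => by
    rw [← hFv n]
    refine integral_congr_ae (hpos.mono fun q hq => Real.norm_of_nonneg ?_)
    have := hq.1
    have := hq.2
    simp only [F, g]
    positivity
  have hsummable : Summable fun n : ℕ => ∫ q, ‖F n q‖ ∂(halfLine.prod halfLine) := by
    simp_rw [hFn]
    have hs : Summable fun n : ℕ => 1 / ((n : ℝ) + 1) ^ 2 := by
      have := (summable_nat_add_iff 1).2 (Real.summable_one_div_nat_pow.2 one_lt_two)
      exact_mod_cast this
    refine hs.of_nonneg_of_le (fun n => by positivity) fun n => ?_
    gcongr
    exact pow_le_one₀ hp0 hp1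
  have hmain := hasSum_integral_of_summable_integral_norm hFi hsummable
  simp_rw [hFv] at hmain
  have key : ∀ s t : ℝ, 0 < s → 0 < t → ∀ n : ℕ,
      p / ((1 + s) * (1 + t)) ^ 2 * (s * t * p / ((1 + s) * (1 + t))) ^ n =
        p ^ (n + 1) * (s ^ n / (1 + s) ^ (n + 2) * (t ^ n / (1 + t) ^ (n + 2))) :=
    fun s t hs ht n => by
    simp only [div_pow, mul_pow]
    field_simp
    ring
  have hfin : ∫ ω, (Real.log (A ω) - logMean) * (Real.log (B ω) - logMean) ∂P
      = ∫ q : ℝ × ℝ, ∑' n, F n q ∂(halfLine.prod halfLine) := by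
    calc _ = ∫ ω, ∫ q : ℝ × ℝ, (frullani q.1 (A ω) - frullaniMean q.1) *
            (frullani q.2 (B ω) - frullaniMean q.2) ∂(halfLine.prod halfLine) ∂P := by
          refine integral_congr_ae ?_
          filter_upwards [hA.ae_pos, hB.ae_pos] with ω h1 h2
          rw [integral_prod_mul (fun s => frullani s (A ω) - frullaniMean s)
            (fun t => frullani t (B ω) - frullaniMean t), hval _ h1, hval _ h2]
      _ = ∫ q : ℝ × ℝ, ∫ ω, (frullani q.1 (A ω) - frullaniMean q.1) *
            (frullani q.2 (B ω) - frullaniMean q.2) ∂P ∂(halfLine.prod halfLine) :=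
          integral_integral_swap hint
      _ = ∫ q : ℝ × ℝ, ∑' n, F n q ∂(halfLine.prod halfLine) := by
          refine integral_congr_ae (hpos.mono fun q hq => ?_)
          obtain ⟨hs, ht⟩ := hq
          simp only
          rw [hcov _ _ hs ht]
          set s := q.1
          set t := q.2
          -- ratio of the geometric series
          have hx0 : 0 ≤ s * t * p / ((1 + s) * (1 + t)) := by positivity
          have hst : s * t * p < (1 + s) * (1 + t) := by
            nlinarith [mul_le_mul_of_nonneg_left hp1 (mul_pos hs ht).le]
          have hx1 : s * t * p / ((1 + s) * (1 + t)) < 1 := by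
            rw [div_lt_one (by positivity)]; exact hst
          have hgeo := (hasSum_geometric_of_lt_one hx0 hx1).mul_left (p / ((1 + s) * (1 + t)) ^ 2)
          have e : ∀ n, p / ((1 + s) * (1 + t)) ^ 2 * (s * t * p / ((1 + s) * (1 + t))) ^ n =
              F n q := fun n => key _ _ hs ht n
          simp only [e] at hgeo
          rw [hgeo.tsum_eq]
          have hne : (1 + s) * (1 + t) - s * t * p ≠ 0 := (sub_pos.2 hst).ne'
          rw [one_sub_div (by positivity)]
          field_simp
          ring
  rw [hfin]
  exact hmain

end HasExpLaplace

/-! ### The logarithmic field and its spectral measure -/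

theorem hasExpLaplace_gefIntensity (z w : ℂ) :
    HasExpLaplace coeffLaw (fun ζ => gefIntensity ζ z) (fun ζ => gefIntensity ζ w)
      (Real.exp (-‖z - w‖ ^ 2)) where
  measurable_left := measurable_gefIntensity z
  measurable_right := measurable_gefIntensity w
  nonneg_left ζ := gefIntensity_nonneg ζ z
  nonneg_right ζ := gefIntensity_nonneg ζ w
  laplace s t hs ht := integral_exp_neg_gefIntensity z w s t hs ht

theorem hasExpLaplace_gefIntensity_self (z : ℂ) :
    HasExpLaplace coeffLaw (fun ζ => gefIntensity ζ z) (fun ζ => gefIntensity ζ z) 1 := by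
  simpa using hasExpLaplace_gefIntensity z z

/-- The centered logarithm `log ‖F(z)‖ - 𝔼 log ‖F(z)‖`, a stationary random field. -/
def gefLog (ζ : ℕ → ℂ) (z : ℂ) : ℝ := Real.log ‖gef ζ z‖ - ‖z‖ ^ 2 / 2 - logMean / 2

theorem ae_gef_ne_zero (z : ℂ) : ∀ᵐ ζ ∂coeffLaw, gef ζ z ≠ 0 := by
  filter_upwards [(hasExpLaplace_gefIntensity_self z).ae_pos] with ζ hζ h0
  simp [gefIntensity, h0] at hζ

theorem ae_gefLog_eq (z : ℂ) :
    (fun ζ => gefLog ζ z) =ᵐ[coeffLaw]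
      fun ζ => 1 / 2 * (Real.log (gefIntensity ζ z) - logMean) := by
  filter_upwards [ae_gef_ne_zero z] with ζ hζ
  rw [gefIntensity, Real.log_mul (by positivity) (Real.exp_ne_zero _), Real.log_exp, Real.log_pow,
    gefLog]
  push_cast; ring

theorem measurable_gef_uncurry : Measurable fun q : (ℕ → ℂ) × ℂ => gef q.1 q.2 := by
  simp only [gef_eq_tsum]
  refine Measurable.tsum fun n => ?_
  unfold gefCoeff
  fun_prop

theorem measurable_gefLog_uncurry : Measurable fun q : (ℕ → ℂ) × ℂ => gefLog q.1 q.2 := by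
  have := measurable_gef_uncurry
  unfold gefLog
  exact ((this.norm.log).sub (by fun_prop)).sub_const _

theorem memLp_gefLog (z : ℂ) : MemLp (fun ζ => gefLog ζ z) 2 coeffLaw := by
  have h := (hasExpLaplace_gefIntensity_self z).memLp_log
  exact ((h.sub (memLp_const logMean)).const_mul (1 / 2)).ae_eq (ae_gefLog_eq z).symm

theorem integral_gefLog (z : ℂ) : ∫ ζ, gefLog ζ z ∂coeffLaw = 0 := by
  have hL := hasExpLaplace_gefIntensity_self z
  have hi := hL.memLp_log.integrable one_le_two
  rw [integral_congr_ae (ae_gefLog_eq z), integral_const_mul, integral_sub hi (integrable_const _),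
    hL.integral_log hi]
  simp

/-- The covariance of the field `gefLog`, in the form `¼ ∑ exp (-n ‖z - w‖²) / n²`. -/
theorem hasSum_integral_gefLog_mul (z w : ℂ) :
    HasSum (fun n : ℕ => 1 / 4 * (Real.exp (-‖z - w‖ ^ 2) ^ (n + 1) / ((n : ℝ) + 1) ^ 2))
      (∫ ζ, gefLog ζ z * gefLog ζ w ∂coeffLaw) := by
  have h := (hasExpLaplace_gefIntensity z w).hasSum_integral_log_sub_mul
    (hasExpLaplace_gefIntensity_self z) (hasExpLaplace_gefIntensity_self w) (Real.exp_pos _).le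
    (Real.exp_le_one_iff.2 (by simp))
  have e : ∫ ζ, gefLog ζ z * gefLog ζ w ∂coeffLaw = 1 / 4 * ∫ ζ,
      (Real.log (gefIntensity ζ z) - logMean) * (Real.log (gefIntensity ζ w) - logMean)
        ∂coeffLaw := by
    rw [← integral_const_mul]
    refine integral_congr_ae ?_
    filter_upwards [ae_gefLog_eq z, ae_gefLog_eq w] with ζ h1 h2
    rw [h1, h2]; ring
  rw [e]
  exact h.mul_left _

/-- The character `z ↦ exp (-2πi ⟨z, w⟩)` of the plane with frequency `w`. -/
def planeWave (w z : ℂ) : ℂ := Complex.exp (((-2 * π * inner ℝ z w : ℝ) : ℂ) * Complex.I)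

theorem norm_planeWave (w z : ℂ) : ‖planeWave w z‖ = 1 := Complex.norm_exp_ofReal_mul_I _

theorem continuous_planeWave : Continuous fun q : ℂ × ℂ => planeWave q.1 q.2 := by
  unfold planeWave; fun_prop

theorem fourier_eq_integral_planeWave (f : ℂ → ℂ) (w : ℂ) :
    𝓕 f w = ∫ z, planeWave w z * f z := by
  rw [Real.fourier_eq']
  rfl

theorem planeWave_mul_conj (w z z' : ℂ) :
    planeWave w z * (starRingEnd ℂ) (planeWave w z') = planeWave (z - z') w := by
  simp only [planeWave, ← Complex.exp_conj, ← Complex.exp_add, map_mul, Complex.conj_ofReal,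
    Complex.conj_I]
  congr 1
  rw [inner_sub_right, real_inner_comm z w, real_inner_comm z' w]
  push_cast; ring

/-- The spectral density of the field `gefLog`: the Fourier transform of its covariance, computed
termwise from the Gaussian functions `exp (-n ‖z‖²)`. -/
def logSpectralDensity (w : ℂ) : ℝ :=
  π / 4 * ∑' n : ℕ, 1 / ((n : ℝ) + 1) ^ 3 * Real.exp (-(π ^ 2 / ((n : ℝ) + 1)) * ‖w‖ ^ 2)

/-- The variance kernel is the spectral density of `gefLog` times the square of `2π ‖w‖²`; this
factor is, up to sign, the Fourier multiplier of `(2π)⁻¹ Δ`, which maps `gefLog` to the centred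
counting measure of the zeros. -/
theorem varianceKernel_eq (w : ℂ) :
    varianceKernel w = (2 * π * ‖w‖ ^ 2) ^ 2 * logSpectralDensity w := by
  rw [varianceKernel, logSpectralDensity,
    tsum_pnat_eq_tsum_succ (f := fun n : ℕ =>
      1 / (n : ℝ) ^ 3 * Real.exp (-(π ^ 2 / (n : ℝ)) * ‖w‖ ^ 2))]
  push_cast
  ring

theorem summable_one_div_succ_pow {k : ℕ} (hk : 1 < k) :
    Summable fun n : ℕ => 1 / ((n : ℝ) + 1) ^ k := by
  have := (summable_nat_add_iff 1).2 (Real.summable_one_div_nat_pow.2 hk)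
  exact_mod_cast this

theorem summable_logSpectralDensity (w : ℂ) : Summable fun n : ℕ =>
    1 / ((n : ℝ) + 1) ^ 3 * Real.exp (-(π ^ 2 / ((n : ℝ) + 1)) * ‖w‖ ^ 2) := by
  refine (summable_one_div_succ_pow (k := 3) (by norm_num)).of_nonneg_of_le
    (fun n => by positivity) fun n => ?_
  refine mul_le_of_le_one_right (by positivity) (Real.exp_le_one_iff.2 ?_)
  have : 0 ≤ π ^ 2 / ((n : ℝ) + 1) * ‖w‖ ^ 2 := by positivity
  linarith

theorem logSpectralDensity_nonneg (w : ℂ) : 0 ≤ logSpectralDensity w :=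
  mul_nonneg (by positivity) (tsum_nonneg fun n => by positivity)

theorem measurable_logSpectralDensity : Measurable logSpectralDensity := by
  unfold logSpectralDensity
  exact (Measurable.tsum fun n => by fun_prop).const_mul _

theorem hasSum_integral_logSpectralDensity_mul (x : ℂ) :
    HasSum (fun n : ℕ => ((1 / 4 * (Real.exp (-‖x‖ ^ 2) ^ (n + 1) / ((n : ℝ) + 1) ^ 2) : ℝ) : ℂ))
      (∫ w, (logSpectralDensity w : ℂ) * planeWave x w) := by
  -- each term of the density is a Gaussian function, whose Fourier transform is again Gaussian
  let c : ℕ → ℝ := fun n => π / 4 * (1 / ((n : ℝ) + 1) ^ 3)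
  let b : ℕ → ℝ := fun n => π ^ 2 / ((n : ℝ) + 1)
  have hb : ∀ n, 0 < b n := fun n => by positivity
  let G : ℕ → ℂ → ℂ := fun n w => (c n : ℂ) * (planeWave x w * Complex.exp (-(b n : ℂ) * ‖w‖ ^ 2))
  have hval : ∀ n, ∫ w, G n w =
      ((1 / 4 * (Real.exp (-‖x‖ ^ 2) ^ (n + 1) / ((n : ℝ) + 1) ^ 2) : ℝ) : ℂ) := fun n => by
    have h := fourier_gaussian_innerProductSpace (V := ℂ) (b := (b n : ℂ)) (by simpa using hb n) x
    rw [fourier_eq_integral_planeWave, Complex.finrank_real_complex] at h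
    simp only [Nat.cast_ofNat, ne_eq, OfNat.ofNat_ne_zero, not_false_eq_true, div_self,
      Complex.cpow_one] at h
    simp only [G]
    rw [integral_const_mul, h, ← Real.exp_nat_mul]
    have hpi : (π : ℂ) ≠ 0 := by exact_mod_cast Real.pi_ne_zero
    have hn : ((n : ℂ) + 1) ≠ 0 := by exact_mod_cast (Nat.succ_ne_zero n)
    push_cast [b, c]
    rw [show -(π : ℂ) ^ 2 * (‖x‖ : ℂ) ^ 2 / ((π : ℂ) ^ 2 / ((n : ℂ) + 1)) =
      ((n : ℂ) + 1) * -(‖x‖ : ℂ) ^ 2 by field_simp]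
    field_simp
  have hnormG : ∀ n w, ‖G n w‖ = c n * Real.exp (-b n * ‖w‖ ^ 2) := fun n w => by
    simp only [G]
    rw [norm_mul, norm_mul, norm_planeWave, one_mul, Complex.norm_real,
      Real.norm_of_nonneg (by positivity)]
    congr 1
    rw [← Complex.ofReal_neg, ← Complex.ofReal_pow, ← Complex.ofReal_mul, Complex.norm_exp,
      Complex.ofReal_re]
  have hgauss : ∀ n, ∫ w : ℂ, Real.exp (-b n * ‖w‖ ^ 2) = π / b n := fun n => by
    have h := GaussianFourier.integral_rexp_neg_mul_sq_norm (V := ℂ) (hb n)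
    rw [Complex.finrank_real_complex] at h
    simpa using h
  have hgi : ∀ n, Integrable fun w : ℂ => Real.exp (-b n * ‖w‖ ^ 2) := fun n => by
    by_contra hc
    have h := hgauss n
    rw [integral_undef hc] at h
    exact (div_pos Real.pi_pos (hb n)).ne h
  have hGm : ∀ n, AEStronglyMeasurable (G n) volume := fun n => by
    have := continuous_planeWave.comp (Continuous.prodMk_right x)
    exact (Continuous.mul continuous_const (this.mul (by fun_prop))).aestronglyMeasurable
  have hGi : ∀ n, Integrable (G n) := fun n =>
    ((hgi n).const_mul (c n)).mono' (hGm n) (ae_of_all _ fun w => (hnormG n w).le)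
  have hsum : Summable fun n => ∫ w, ‖G n w‖ := by
    simp_rw [hnormG, integral_const_mul, hgauss]
    refine ((summable_one_div_succ_pow (k := 2) (by norm_num)).mul_left (1 / 4)).congr fun n => ?_
    simp only [c, b]; field_simp
  have h := hasSum_integral_of_summable_integral_norm hGi hsum
  simp_rw [hval] at h
  have hfun : (fun w => (logSpectralDensity w : ℂ) * planeWave x w) = fun w => ∑' n, G n w := by
    ext w
    have hs := (Complex.hasSum_ofReal.2 (summable_logSpectralDensity w).hasSum).mul_left
      (((π / 4 : ℝ) : ℂ) * planeWave x w)
    have e : (logSpectralDensity w : ℂ) * planeWave x w = ((π / 4 : ℝ) : ℂ) * planeWave x w *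
      ((∑' n : ℕ, 1 / ((n : ℝ) + 1) ^ 3 * Real.exp (-(π ^ 2 / ((n : ℝ) + 1)) *
        ‖w‖ ^ 2) : ℝ) : ℂ) := by
      rw [logSpectralDensity]; push_cast; ring
    rw [e, ← hs.tsum_eq]
    congr 1; ext n
    simp only [G, c, b]; push_cast; ring
  rw [hfun]
  exact h

/-- The covariance of `gefLog` as the Fourier transform of the spectral density. -/
theorem integral_gefLog_mul (z z' : ℂ) :
    ((∫ ζ, gefLog ζ z * gefLog ζ z' ∂coeffLaw : ℝ) : ℂ) =
      ∫ w, (logSpectralDensity w : ℂ) * (planeWave w z * (starRingEnd ℂ) (planeWave w z')) := by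
  simp_rw [planeWave_mul_conj]
  exact (Complex.hasSum_ofReal.2 (hasSum_integral_gefLog_mul z z')).unique
    (hasSum_integral_logSpectralDensity_mul (z - z'))

theorem integrable_logSpectralDensity : Integrable logSpectralDensity := by
  by_contra hc
  -- at the origin the series has a positive sum, so the integral is not the junk value `0`
  have h := hasSum_integral_logSpectralDensity_mul 0
  have hp : ∀ w, planeWave 0 w = 1 := fun w => by simp [planeWave]
  simp only [hp, mul_one] at h
  rw [integral_complex_ofReal, integral_undef hc] at h
  have h' := Complex.hasSum_ofReal.1 h
  have h0 := h'.tsum_eq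
  have := h'.summable.tsum_pos (fun n => by positivity) 0 (by positivity)
  rw [h0] at this
  exact lt_irrefl _ this

/-- The spectral measure of the field `gefLog`. -/
def logSpectralMeasure : Measure ℂ :=
  volume.withDensity fun w => ENNReal.ofReal (logSpectralDensity w)

instance isFiniteMeasure_logSpectralMeasure : IsFiniteMeasure logSpectralMeasure :=
  isFiniteMeasure_withDensity_ofReal integrable_logSpectralDensity.2

theorem integral_logSpectralMeasure {E : Type*} [NormedAddCommGroup E] [NormedSpace ℝ E]
    (f : ℂ → E) : ∫ w, f w ∂logSpectralMeasure = ∫ w, logSpectralDensity w • f w := by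
  rw [logSpectralMeasure, integral_withDensity_eq_integral_toReal_smul
    measurable_logSpectralDensity.ennreal_ofReal (by simp)]
  simp_rw [ENNReal.toReal_ofReal (logSpectralDensity_nonneg _)]

/-! ### Linear functionals of the logarithmic field -/

/-- The second moment of the average over `θ` of the random variables `Ψ (·, θ)` is the average of
their correlations over pairs of parameters. -/
theorem integral_norm_sq_integral {X T : Type*} [MeasurableSpace X] [MeasurableSpace T]
    {μ : Measure X} [IsFiniteMeasure μ] {τ : Measure T} [IsProbabilityMeasure τ]
    {Ψ : X × T → ℂ} (hm : Measurable Ψ) (hΨ : MemLp Ψ 2 (μ.prod τ)) :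
    MemLp (fun x => ∫ θ, Ψ (x, θ) ∂τ) 2 μ ∧
    ((∫ x, ‖∫ θ, Ψ (x, θ) ∂τ‖ ^ 2 ∂μ : ℝ) : ℂ) =
      ∫ q, ∫ x, Ψ (x, q.1) * (starRingEnd ℂ) (Ψ (x, q.2)) ∂μ ∂(τ.prod τ) := by
  let F : X × (T × T) → ℂ := fun y => Ψ (y.1, y.2.1) * (starRingEnd ℂ) (Ψ (y.1, y.2.2))
  have hsq : Integrable (fun y => ‖Ψ y‖ ^ 2) (μ.prod τ) :=
    (memLp_two_iff_integrable_sq_norm hΨ.1).1 hΨ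
  have mp1 : MeasurePreserving (fun y : X × (T × T) => (y.1, y.2.1)) (μ.prod (τ.prod τ))
      (μ.prod τ) := (MeasurePreserving.id μ).prod measurePreserving_fst
  have mp2 : MeasurePreserving (fun y : X × (T × T) => (y.1, y.2.2)) (μ.prod (τ.prod τ))
      (μ.prod τ) := (MeasurePreserving.id μ).prod measurePreserving_snd
  have hFm : Measurable F := by
    refine (hm.comp mp1.measurable).mul ?_
    exact Complex.continuous_conj.measurable.comp (hm.comp mp2.measurable)
  have hFi : Integrable F (μ.prod (τ.prod τ)) := by
    refine ((mp1.integrable_comp_of_integrable hsq).add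
      (mp2.integrable_comp_of_integrable hsq)).mono' hFm.aestronglyMeasurable
      (ae_of_all _ fun y => ?_)
    simp only [F, norm_mul, RCLike.norm_conj, Pi.add_apply, Function.comp_apply]
    nlinarith [sq_nonneg (‖Ψ (y.1, y.2.1)‖ - ‖Ψ (y.1, y.2.2)‖), sq_nonneg ‖Ψ (y.1, y.2.1)‖,
      sq_nonneg ‖Ψ (y.1, y.2.2)‖]
  have hinner : ∀ x, ∫ q, F (x, q) ∂(τ.prod τ) = ((‖∫ θ, Ψ (x, θ) ∂τ‖ ^ 2 : ℝ) : ℂ) := fun x => by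
    simp only [F]
    rw [integral_prod_mul (fun θ => Ψ (x, θ)) (fun θ => (starRingEnd ℂ) (Ψ (x, θ))),
      integral_conj, Complex.mul_conj, Complex.normSq_eq_norm_sq]
  refine ⟨?_, ?_⟩
  · rw [memLp_two_iff_integrable_sq_norm
      hm.stronglyMeasurable.integral_prod_right'.aestronglyMeasurable]
    have h := hFi.integral_prod_left.re
    simpa only [hinner, RCLike.re_to_complex, Complex.ofReal_re] using h
  · rw [← integral_complex_ofReal]
    simp_rw [← hinner]
    exact integral_integral_swap (f := fun x q => F (x, q)) hFi

/-- The index set of the test functions: pairs of a centre and a positive radius. -/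
abbrev Disk := ℂ × Set.Ioi (0 : ℝ)

/-- The uniform probability measure on the angles `(0, 2π]`. -/
def angleMeasure : Measure ℝ := ENNReal.ofReal (2 * π)⁻¹ • volume.restrict (Set.Ioc 0 (2 * π))

instance isProbabilityMeasure_angleMeasure : IsProbabilityMeasure angleMeasure := by
  constructor
  rw [angleMeasure, Measure.smul_apply, Measure.restrict_apply_univ, Real.volume_Ioc, sub_zero,
    smul_eq_mul, ← ENNReal.ofReal_mul (by positivity), inv_mul_cancel₀ (by positivity),
    ENNReal.ofReal_one]

theorem circleAverage_eq_integral {E : Type*} [NormedAddCommGroup E] [NormedSpace ℝ E]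
    (f : ℂ → E) (c : ℂ) (R : ℝ) :
    Real.circleAverage f c R = ∫ θ, f (circleMap c R θ) ∂angleMeasure := by
  rw [Real.circleAverage_def, angleMeasure, integral_smul_measure,
    ENNReal.toReal_ofReal (by positivity), intervalIntegral.integral_of_le (by positivity)]

theorem circleIntegrable_iff_angleMeasure {f : ℂ → ℂ} {c : ℂ} {R : ℝ} :
    CircleIntegrable f c R ↔ Integrable (fun θ => f (circleMap c R θ)) angleMeasure := by
  rw [CircleIntegrable, intervalIntegrable_iff_integrableOn_Ioc_of_le (by positivity), angleMeasure,
    integrable_smul_measure (by simp [Real.pi_pos]) (by simp), IntegrableOn]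

/-- The combination `∑ s(c, R) (f (c + R exp (i θ)) - f c)` of increments of `f`. -/
def diskJump (s : Disk →₀ ℂ) (f : ℂ → ℂ) (θ : ℝ) : ℂ :=
  s.sum fun i b => b * (f (circleMap i.1 i.2 θ) - f i.1)

/-- The combination `∑ s(c, R) (circleAverage f c R - f c)`. -/
def diskFunctional (s : Disk →₀ ℂ) (f : ℂ → ℂ) : ℂ :=
  s.sum fun i b => b * (Real.circleAverage f i.1 i.2 - f i.1)

theorem integral_diskJump (s : Disk →₀ ℂ) (f : ℂ → ℂ)
    (hf : ∀ i : Disk, CircleIntegrable f i.1 i.2) :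
    ∫ θ, diskJump s f θ ∂angleMeasure = diskFunctional s f := by
  have hi : ∀ i : Disk, Integrable (fun θ => f (circleMap i.1 i.2 θ)) angleMeasure := fun i =>
    circleIntegrable_iff_angleMeasure.1 (hf i)
  simp only [diskJump, diskFunctional, Finsupp.sum]
  have hj : ∀ i : Disk, Integrable (fun θ => f (circleMap i.1 i.2 θ) - f i.1) angleMeasure :=
    fun i => (hi i).sub (integrable_const _)
  rw [integral_finsetSum _ fun i _ => (hj i).const_mul _]
  refine Finset.sum_congr rfl fun i _ => ?_
  rw [integral_const_mul, integral_sub (hi i) (integrable_const _), circleAverage_eq_integral]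
  simp

/-- The points at which `diskJump s f θ` evaluates `f`: a point of the circle, labelled `true`, or
the centre, labelled `false`. -/
def jumpPoint (j : Disk × Bool) (θ : ℝ) : ℂ :=
  bif j.2 then circleMap j.1.1 j.1.2 θ else j.1.1

/-- Weights of the points that enter `diskJump`. -/
def jumpWeight (s : Disk →₀ ℂ) (j : Disk × Bool) : ℂ := bif j.2 then s j.1 else -s j.1

theorem diskJump_eq_sum (s : Disk →₀ ℂ) (f : ℂ → ℂ) (θ : ℝ) :
    diskJump s f θ = ∑ j ∈ s.support ×ˢ (Finset.univ : Finset Bool),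
      jumpWeight s j * f (jumpPoint j θ) := by
  rw [Finset.sum_product, diskJump, Finsupp.sum]
  refine Finset.sum_congr rfl fun i _ => ?_
  simp [jumpWeight, jumpPoint]
  ring

theorem continuous_jumpPoint (j : Disk × Bool) : Continuous (jumpPoint j) := by
  rcases j with ⟨i, _ | _⟩
  · exact continuous_const
  · exact continuous_circleMap _ _

section

variable {X : Type*} [MeasurableSpace X] {μ : Measure X} {Φ : X → ℂ → ℂ}

theorem memLp_comp_jumpPoint [IsFiniteMeasure μ] (hm : Measurable fun q : X × ℂ => Φ q.1 q.2)
    {C : ℝ} (h2 : ∀ z, MemLp (fun x => Φ x z) 2 μ) (hC : ∀ z, ∫ x, ‖Φ x z‖ ^ 2 ∂μ ≤ C)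
    {p : ℝ → ℂ} (hp : Measurable p) :
    Measurable (fun q : X × ℝ => Φ q.1 (p q.2)) ∧
    MemLp (fun q : X × ℝ => Φ q.1 (p q.2)) 2 (μ.prod angleMeasure) := by
  have hmj : Measurable fun q : X × ℝ => Φ q.1 (p q.2) :=
    hm.comp (measurable_fst.prodMk (hp.comp measurable_snd))
  refine ⟨hmj, ?_⟩
  have hsq : Measurable fun q : X × ℝ => ‖Φ q.1 (p q.2)‖ ^ 2 := hmj.norm.pow_const 2
  rw [memLp_two_iff_integrable_sq_norm hmj.aestronglyMeasurable,
    integrable_prod_iff' hsq.aestronglyMeasurable]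
  have hsec : ∀ θ, Integrable (fun x => ‖Φ x (p θ)‖ ^ 2) μ := fun θ =>
    (memLp_two_iff_integrable_sq_norm (h2 (p θ)).1).1 (h2 (p θ))
  refine ⟨ae_of_all _ hsec, ?_⟩
  have hsm : StronglyMeasurable fun θ : ℝ => ∫ x, ‖‖Φ x (p θ)‖ ^ 2‖ ∂μ :=
    StronglyMeasurable.integral_prod_left' (f := fun q : X × ℝ => ‖‖Φ q.1 (p q.2)‖ ^ 2‖)
      hsq.norm.stronglyMeasurable
  refine Integrable.of_bound (C := C) hsm.aestronglyMeasurable (ae_of_all _ fun θ => ?_)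
  simp only [norm_pow, norm_norm]
  rw [Real.norm_of_nonneg (integral_nonneg fun _ => by positivity)]
  exact hC _

theorem memLp_diskJump [IsFiniteMeasure μ] (hm : Measurable fun q : X × ℂ => Φ q.1 q.2) {C : ℝ}
    (h2 : ∀ z, MemLp (fun x => Φ x z) 2 μ) (hC : ∀ z, ∫ x, ‖Φ x z‖ ^ 2 ∂μ ≤ C)
    (s : Disk →₀ ℂ) :
    Measurable (fun q : X × ℝ => diskJump s (Φ q.1) q.2) ∧
    MemLp (fun q : X × ℝ => diskJump s (Φ q.1) q.2) 2 (μ.prod angleMeasure) := by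
  have h := fun j => memLp_comp_jumpPoint hm h2 hC (continuous_jumpPoint j).measurable
  have hsum : (fun q : X × ℝ => diskJump s (Φ q.1) q.2) = fun q =>
      ∑ j ∈ s.support ×ˢ (Finset.univ : Finset Bool),
        jumpWeight s j * Φ q.1 (jumpPoint j q.2) := funext fun q => diskJump_eq_sum _ _ _
  rw [hsum]
  exact ⟨Finset.measurable_sum _ fun j _ => (h j).1.const_mul _,
    memLp_finsetSum _ fun j _ => (h j).2.const_mul _⟩

theorem integral_diskJump_mul_conj (h2 : ∀ z, MemLp (fun x => Φ x z) 2 μ) (s : Disk →₀ ℂ)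
    (θ θ' : ℝ) :
    ∫ x, diskJump s (Φ x) θ * (starRingEnd ℂ) (diskJump s (Φ x) θ') ∂μ =
      ∑ j ∈ s.support ×ˢ (Finset.univ : Finset Bool), ∑ k ∈ s.support ×ˢ
        (Finset.univ : Finset Bool),
        jumpWeight s j * (starRingEnd ℂ) (jumpWeight s k) *
          ∫ x, Φ x (jumpPoint j θ) * (starRingEnd ℂ) (Φ x (jumpPoint k θ')) ∂μ := by
  have hi : ∀ z z', Integrable (fun x => Φ x z * (starRingEnd ℂ) (Φ x z')) μ := fun z z' =>
    (h2 z).integrable_mul (h2 z').star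
  simp only [diskJump_eq_sum, map_sum, map_mul, Finset.sum_mul_sum]
  have e : ∀ j k x, jumpWeight s j * Φ x (jumpPoint j θ) *
      ((starRingEnd ℂ) (jumpWeight s k) * (starRingEnd ℂ) (Φ x (jumpPoint k θ'))) =
      jumpWeight s j * (starRingEnd ℂ) (jumpWeight s k) *
        (Φ x (jumpPoint j θ) * (starRingEnd ℂ) (Φ x (jumpPoint k θ'))) := fun j k x => by ring
  simp only [e]
  rw [integral_finsetSum _ fun j _ => integrable_finsetSum _ fun k _ => (hi _ _).const_mul _]
  refine Finset.sum_congr rfl fun j _ => ?_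
  rw [integral_finsetSum _ fun k _ => (hi _ _).const_mul _]
  exact Finset.sum_congr rfl fun k _ => integral_const_mul _ _

end

theorem integral_gefLog_mul_conj (z z' : ℂ) :
    ∫ ζ, (gefLog ζ z : ℂ) * (starRingEnd ℂ) (gefLog ζ z' : ℂ) ∂coeffLaw =
      ∫ w, planeWave w z * (starRingEnd ℂ) (planeWave w z') ∂logSpectralMeasure := by
  rw [integral_logSpectralMeasure]
  simp only [Complex.conj_ofReal, ← Complex.ofReal_mul, Complex.real_smul]
  rw [integral_complex_ofReal, integral_gefLog_mul]

theorem memLp_gefLog_ofReal (z : ℂ) : MemLp (fun ζ => (gefLog ζ z : ℂ)) 2 coeffLaw :=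
  (memLp_gefLog z).ofReal

theorem memLp_diskJump_gefLog (s : Disk →₀ ℂ) :
    Measurable (fun q : (ℕ → ℂ) × ℝ => diskJump s (fun z => (gefLog q.1 z : ℂ)) q.2) ∧
    MemLp (fun q : (ℕ → ℂ) × ℝ => diskJump s (fun z => (gefLog q.1 z : ℂ)) q.2) 2
      (coeffLaw.prod angleMeasure) := by
  have m1 : Measurable fun q : (ℕ → ℂ) × ℂ => (gefLog q.1 q.2 : ℂ) :=
    Complex.measurable_ofReal.comp measurable_gefLog_uncurry
  -- the variance of `gefLog` at a point is the total mass of the spectral measure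
  have c1 : ∀ z, ∫ ζ, ‖(gefLog ζ z : ℂ)‖ ^ 2 ∂coeffLaw ≤ ∫ _, (1 : ℝ) ∂logSpectralMeasure :=
    fun z => by
    have h := integral_gefLog_mul_conj z z
    simp only [Complex.mul_conj, Complex.normSq_eq_norm_sq, norm_planeWave] at h
    rw [integral_complex_ofReal, integral_complex_ofReal] at h
    have h' := Complex.ofReal_injective h
    rw [h']
    simp
  exact memLp_diskJump m1 memLp_gefLog_ofReal c1 s

/-- Spectral representation: the field `gefLog` on the probability space and the characters on the
spectral measure have the same correlations, hence so have their linear functionals. -/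
theorem integral_norm_sq_diskJump_gefLog (s : Disk →₀ ℂ) :
    MemLp (fun ζ => ∫ θ, diskJump s (fun z => (gefLog ζ z : ℂ)) θ ∂angleMeasure) 2 coeffLaw ∧
    ∫ ζ, ‖∫ θ, diskJump s (fun z => (gefLog ζ z : ℂ)) θ ∂angleMeasure‖ ^ 2 ∂coeffLaw =
      ∫ w, ‖diskFunctional s (planeWave w)‖ ^ 2 ∂logSpectralMeasure := by
  have m2 : Measurable fun q : ℂ × ℂ => planeWave q.1 q.2 := continuous_planeWave.measurable
  have l2 : ∀ z, MemLp (fun w => planeWave w z) 2 logSpectralMeasure := fun z =>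
    MemLp.of_bound (m2.comp (measurable_id.prodMk measurable_const)).aestronglyMeasurable 1
      (ae_of_all _ fun w => (norm_planeWave w z).le)
  have c2 : ∀ z, ∫ w, ‖planeWave w z‖ ^ 2 ∂logSpectralMeasure ≤
      ∫ _, (1 : ℝ) ∂logSpectralMeasure := fun z => by simp [norm_planeWave]
  obtain ⟨j1, j2⟩ := memLp_diskJump_gefLog s
  obtain ⟨k1, k2⟩ := memLp_diskJump m2 l2 c2 s
  obtain ⟨a1, a2⟩ := integral_norm_sq_integral j1 j2
  obtain ⟨b1, b2⟩ := integral_norm_sq_integral k1 k2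
  refine ⟨a1, ?_⟩
  have hcirc : ∀ w, ∫ θ, diskJump s (planeWave w) θ ∂angleMeasure =
      diskFunctional s (planeWave w) := fun w =>
    integral_diskJump s _ fun i => (ContinuousOn.circleIntegrable'
      (continuous_planeWave.comp (Continuous.prodMk_right w)).continuousOn)
  simp only [hcirc] at b2
  have : ((∫ ζ, ‖∫ θ, diskJump s (fun z => (gefLog ζ z : ℂ)) θ ∂angleMeasure‖ ^ 2
      ∂coeffLaw : ℝ) : ℂ) =
        ((∫ w, ‖diskFunctional s (planeWave w)‖ ^ 2 ∂logSpectralMeasure : ℝ) : ℂ) := by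
    rw [a2, b2]
    congr 1; ext q
    rw [integral_diskJump_mul_conj memLp_gefLog_ofReal, integral_diskJump_mul_conj l2]
    simp only [integral_gefLog_mul_conj]
  exact_mod_cast this

/-! ### Logarithmic test functions and their Fourier transforms -/

/-- The moments `∫ ⟨exp (i θ), w⟩ⁿ dθ` over a full turn. -/
def angleMoment (w : ℂ) (n : ℕ) : ℝ := ∫ θ in (-π)..π, (inner ℝ (circleMap 0 1 θ) w : ℝ) ^ n

theorem inner_circleMap (w : ℂ) (θ : ℝ) :
    (inner ℝ (circleMap 0 1 θ) w : ℝ) = ‖w‖ * Real.cos (θ - w.arg) := by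
  have h1 := Complex.norm_mul_cos_arg w
  have h2 := Complex.norm_mul_sin_arg w
  rw [Real.cos_sub, Complex.inner]
  simp [circleMap, Complex.exp_ofReal_mul_I_re, Complex.exp_ofReal_mul_I_im]
  linear_combination -Real.cos θ * h1 - Real.sin θ * h2

theorem angleMoment_eq (w : ℂ) (n : ℕ) :
    angleMoment w n = ‖w‖ ^ n * ∫ θ in (-π - w.arg)..(π - w.arg), Real.cos θ ^ n := by
  simp only [angleMoment, inner_circleMap, mul_pow]
  rw [intervalIntegral.integral_const_mul,
    intervalIntegral.integral_comp_sub_right (fun θ => Real.cos θ ^ n)]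

theorem angleMoment_one (w : ℂ) : angleMoment w 1 = 0 := by
  rw [angleMoment_eq]
  simp only [pow_one, integral_cos]
  rw [show π - w.arg = (-π - w.arg) + 2 * π by ring, Real.sin_add_two_pi, sub_self, mul_zero]

/-- The reduction formula for powers of the cosine; the boundary terms cancel over a full period. -/
theorem angleMoment_add_two (w : ℂ) (n : ℕ) :
    angleMoment w (n + 2) = ‖w‖ ^ 2 * ((n + 1) / (n + 2)) * angleMoment w n := by
  rw [angleMoment_eq, angleMoment_eq, integral_cos_pow,
    show π - w.arg = (-π - w.arg) + 2 * π by ring, Real.sin_add_two_pi, Real.cos_add_two_pi,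
    sub_self, zero_div, zero_add]
  ring

/-- The Taylor coefficients in `t` of `∫ planeWave w (t exp (i θ)) dθ`. -/
def besselCoeff (w : ℂ) (n : ℕ) : ℂ :=
  (-2 * π * Complex.I) ^ n / (n.factorial : ℂ) * (angleMoment w n : ℂ)

theorem besselCoeff_one (w : ℂ) : besselCoeff w 1 = 0 := by
  simp [besselCoeff, angleMoment_one]

/-- The recurrence of the Taylor coefficients, equivalent to the equation
`Δ planeWave w = -4π² ‖w‖² planeWave w` for the circular means. -/
theorem besselCoeff_add_two (w : ℂ) (n : ℕ) :
    ((n : ℂ) + 2) ^ 2 * besselCoeff w (n + 2) = -4 * π ^ 2 * ‖w‖ ^ 2 * besselCoeff w n := by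
  rw [besselCoeff, besselCoeff, angleMoment_add_two, Nat.factorial_succ, Nat.factorial_succ]
  have h1 : (n : ℂ) + 1 ≠ 0 := by exact_mod_cast Nat.succ_ne_zero n
  have h2 : (n : ℂ) + 2 ≠ 0 := by exact_mod_cast Nat.succ_ne_zero (n + 1)
  have h3 : (n.factorial : ℂ) ≠ 0 := by exact_mod_cast Nat.factorial_ne_zero n
  have h4 : (n : ℂ) + 1 + 1 ≠ 0 := by exact_mod_cast Nat.succ_ne_zero (n + 1)
  push_cast
  rw [pow_add (-2 * (π : ℂ) * Complex.I) n 2, mul_pow (-2 * (π : ℂ)) Complex.I 2, Complex.I_sq]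
  field_simp
  ring

theorem hasSum_integral_planeWave_circleMap (w : ℂ) (t : ℝ) :
    HasSum (fun n => besselCoeff w n * (t : ℂ) ^ n)
      (∫ θ in (-π)..π, planeWave w (circleMap 0 t θ)) := by
  have hb : ∀ θ, |(inner ℝ (circleMap 0 1 θ) w : ℝ)| ≤ ‖w‖ := fun θ => by
    rw [inner_circleMap, abs_mul, abs_of_nonneg (norm_nonneg _)]
    exact mul_le_of_le_one_right (norm_nonneg _) (Real.abs_cos_le_one _)
  have hc : Continuous fun θ : ℝ => (inner ℝ (circleMap 0 1 θ) w : ℝ) :=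
    (continuous_circleMap 0 1).inner continuous_const
  have h := intervalIntegral.hasSum_integral_of_dominated_convergence (μ := volume)
    (a := -π) (b := π)
    (F := fun (n : ℕ) θ => (-2 * π * Complex.I) ^ n / (n.factorial : ℂ) *
      (((inner ℝ (circleMap 0 1 θ) w : ℝ) ^ n : ℝ) : ℂ) * (t : ℂ) ^ n)
    (f := fun θ => planeWave w (circleMap 0 t θ))
    (fun n _ => (2 * π * ‖w‖ * |t|) ^ n / n.factorial)
    (fun n => ((continuous_const.mul (Complex.continuous_ofReal.comp (hc.pow n))).mul
      continuous_const).aestronglyMeasurable)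
    (fun n => ae_of_all _ fun θ _ => by
      rw [norm_mul, norm_mul, norm_div, norm_pow, norm_pow, Complex.norm_real, Complex.norm_natCast,
        norm_pow, Complex.norm_real, Real.norm_eq_abs, Real.norm_eq_abs]
      have e : ‖-2 * (π : ℂ) * Complex.I‖ = 2 * π := by
        simp [Real.pi_nonneg]
      rw [e, mul_pow (2 * π * ‖w‖), mul_pow (2 * π), div_mul_eq_mul_div, div_mul_eq_mul_div]
      gcongr
      exact hb θ)
    (ae_of_all _ fun θ _ => Real.summable_pow_div_factorial _)
    (by simp)
    (ae_of_all _ fun θ _ => by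
      have h := NormedSpace.expSeries_div_hasSum_exp (𝔸 := ℂ)
        (((-2 * π * inner ℝ (circleMap 0 t θ) w : ℝ) : ℂ) * Complex.I)
      rw [← Complex.exp_eq_exp_ℂ] at h
      have hc : (inner ℝ (circleMap 0 t θ) w : ℝ) = t * inner ℝ (circleMap 0 1 θ) w := by
        rw [← real_inner_smul_left]; congr 1; simp [circleMap]
      rw [planeWave]
      have e : ∀ n : ℕ, (((-2 * π * inner ℝ (circleMap 0 t θ) w : ℝ) : ℂ) * Complex.I) ^ n /
          (n.factorial : ℂ) = (-2 * π * Complex.I) ^ n / (n.factorial : ℂ) *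
          (((inner ℝ (circleMap 0 1 θ) w : ℝ) ^ n : ℝ) : ℂ) * (t : ℂ) ^ n := fun n => by
        rw [hc]; push_cast
        rw [div_mul_eq_mul_div, div_mul_eq_mul_div, ← mul_pow, ← mul_pow]
        congr 2; ring
      simpa only [e] using h)
  have e : ∀ n : ℕ, (∫ θ in (-π)..π, (-2 * π * Complex.I) ^ n / (n.factorial : ℂ) *
      (((inner ℝ (circleMap 0 1 θ) w : ℝ) ^ n : ℝ) : ℂ) * (t : ℂ) ^ n) =
      besselCoeff w n * (t : ℂ) ^ n := fun n => by
    rw [intervalIntegral.integral_mul_const, intervalIntegral.integral_const_mul,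
      intervalIntegral.integral_ofReal, besselCoeff, angleMoment]
  simpa only [e] using h

theorem norm_besselCoeff_le (w : ℂ) (n : ℕ) :
    ‖besselCoeff w n‖ ≤ 2 * π * ((2 * π * ‖w‖) ^ n / n.factorial) := by
  have hb : ∀ θ, ‖(inner ℝ (circleMap 0 1 θ) w : ℝ) ^ n‖ ≤ ‖w‖ ^ n := fun θ => by
    rw [norm_pow, inner_circleMap, norm_mul, norm_norm]
    gcongr
    exact mul_le_of_le_one_right (norm_nonneg _) (Real.abs_cos_le_one _)
  have h := intervalIntegral.norm_integral_le_of_norm_le_const (a := -π) (b := π)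
    (f := fun θ => (inner ℝ (circleMap 0 1 θ) w : ℝ) ^ n) (C := ‖w‖ ^ n) fun θ _ => hb θ
  rw [besselCoeff, norm_mul, norm_div, norm_pow, Complex.norm_natCast, Complex.norm_real]
  have e : ‖-2 * (π : ℂ) * Complex.I‖ = 2 * π := by simp [Real.pi_nonneg]
  rw [e]
  calc _ ≤ (2 * π) ^ n / n.factorial * (‖w‖ ^ n * |π - -π|) := by gcongr; exact h
    _ = _ := by
      rw [show π - -π = 2 * π by ring, abs_of_nonneg (by positivity), mul_pow (2 * π)]; ring

theorem integral_pow_mul_log {R : ℝ} (hR : 0 < R) (n : ℕ) :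
    IntegrableOn (fun t : ℝ => t ^ (n + 1) * Real.log (R * t⁻¹)) (Set.Ioc 0 R) ∧
    ∫ t in Set.Ioc 0 R, t ^ (n + 1) * Real.log (R * t⁻¹) = R ^ (n + 2) / ((n : ℝ) + 2) ^ 2 := by
  -- an antiderivative, written with `t * log t` so that it is continuous at `0`
  let G : ℝ → ℝ := fun t => t ^ (n + 2) * (Real.log R / (n + 2) + 1 / ((n : ℝ) + 2) ^ 2) -
    t ^ (n + 1) * (t * Real.log t) / (n + 2)
  have hn : (n : ℝ) + 2 ≠ 0 := by positivity
  have hGc : Continuous G := by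
    have := Real.continuous_mul_log
    fun_prop
  have hd : ∀ t ∈ Set.Ioo 0 R, HasDerivAt G (t ^ (n + 1) * Real.log (R * t⁻¹)) t := fun t ht => by
    have h0 : t ≠ 0 := ht.1.ne'
    have h1 := ((hasDerivAt_pow (n + 2) t).mul_const
      (Real.log R / (n + 2) + 1 / ((n : ℝ) + 2) ^ 2)).sub
      (((hasDerivAt_pow (n + 1) t).mul (Real.hasDerivAt_mul_log h0)).div_const ((n : ℝ) + 2))
    refine h1.congr_deriv ?_
    rw [Real.log_mul hR.ne' (inv_ne_zero h0), Real.log_inv]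
    have e1 : n + 2 - 1 = n + 1 := by omega
    have e2 : n + 1 - 1 = n := by omega
    rw [e1, e2]
    push_cast
    field_simp
    ring
  have hpos : ∀ t ∈ Set.Ioo 0 R, 0 ≤ t ^ (n + 1) * Real.log (R * t⁻¹) := fun t ht => by
    refine mul_nonneg (pow_nonneg ht.1.le _) (Real.log_nonneg ?_)
    rw [← div_eq_mul_inv, le_div_iff₀ ht.1]; linarith [ht.2]
  have hi := intervalIntegral.integrableOn_deriv_of_nonneg hGc.continuousOn hd hpos
  refine ⟨hi, ?_⟩
  rw [← intervalIntegral.integral_of_le hR.le,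
    intervalIntegral.integral_eq_sub_of_hasDerivAt_of_le hR.le hGc.continuousOn hd
      ((intervalIntegrable_iff_integrableOn_Ioc_of_le hR.le).2 hi)]
  simp only [G]
  simp
  field_simp
  ring

/-- The radial integral of `planeWave w` against `log (R / t)`, multiplied by the eigenvalue of the
Laplacian, is the increment of the circular integral between the radii `0` and `R`. The integral
against `log (R / t)` divides the Taylor coefficients by `(n + 2)²`, which the recurrence for
`besselCoeff` undoes. -/
theorem integral_mul_log_mul_planeWave (w : ℂ) {R : ℝ} (hR : 0 < R) :
    -4 * (π : ℂ) ^ 2 * (‖w‖ : ℂ) ^ 2 * ∫ t in Set.Ioc 0 R, ((t * Real.log (R * t⁻¹) : ℝ) : ℂ) *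
        ∫ θ in (-π)..π, planeWave w (circleMap 0 t θ) =
      (∫ θ in (-π)..π, planeWave w (circleMap 0 R θ)) - 2 * π := by
  have hI := fun n => integral_pow_mul_log hR n
  let F : ℕ → ℝ → ℂ := fun n t => besselCoeff w n * ((t ^ (n + 1) * Real.log (R * t⁻¹) : ℝ) : ℂ)
  have hFi : ∀ n, Integrable (F n) (volume.restrict (Set.Ioc 0 R)) := fun n =>
    ((hI n).1.ofReal).const_mul _
  have hFv : ∀ n, ∫ t in Set.Ioc 0 R, F n t = besselCoeff w n *
    (R : ℂ) ^ (n + 2) / ((n : ℂ) + 2) ^ 2 :=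
    fun n => by
    simp only [F]
    rw [integral_const_mul, integral_complex_ofReal, (hI n).2]
    push_cast; ring
  have hFn : ∀ n, ∫ t in Set.Ioc 0 R, ‖F n t‖ = ‖besselCoeff w n‖ *
    (R ^ (n + 2) / ((n : ℝ) + 2) ^ 2) :=
    fun n => by
    rw [← (hI n).2, ← integral_const_mul]
    refine setIntegral_congr_fun measurableSet_Ioc fun t ht => ?_
    simp only [F]
    rw [norm_mul, Complex.norm_real, Real.norm_of_nonneg]
    refine mul_nonneg (pow_nonneg ht.1.le _) (Real.log_nonneg ?_)
    rw [← div_eq_mul_inv, le_div_iff₀ ht.1]; linarith [ht.2]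
  have hs : Summable fun n => ∫ t in Set.Ioc 0 R, ‖F n t‖ := by
    simp_rw [hFn]
    refine ((Real.summable_pow_div_factorial (2 * π * ‖w‖ * R)).mul_left
      (2 * π * R ^ 2)).of_nonneg_of_le (fun n => by positivity) fun n => ?_
    calc _ ≤ 2 * π * ((2 * π * ‖w‖) ^ n / n.factorial) * (R ^ (n + 2) / 1) := by
          gcongr
          · exact norm_besselCoeff_le w n
          · nlinarith [(Nat.cast_nonneg n : (0 : ℝ) ≤ n)]
      _ = _ := by rw [mul_pow (2 * π * ‖w‖)]; ring
  have hmain := hasSum_integral_of_summable_integral_norm hFi hs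
  simp_rw [hFv] at hmain
  have hfun : ∫ t in Set.Ioc 0 R, ∑' n, F n t = ∫ t in Set.Ioc 0 R,
      ((t * Real.log (R * t⁻¹) : ℝ) : ℂ) * ∫ θ in (-π)..π, planeWave w (circleMap 0 t θ) := by
    congr 1; ext t
    rw [← ((hasSum_integral_planeWave_circleMap w t).mul_left _).tsum_eq]
    congr 1; ext n
    simp only [F]; push_cast; ring
  rw [hfun] at hmain
  have h1 := hmain.mul_left (-4 * (π : ℂ) ^ 2 * (‖w‖ : ℂ) ^ 2)
  have e : ∀ n : ℕ, -4 * (π : ℂ) ^ 2 * (‖w‖ : ℂ) ^ 2 *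
      (besselCoeff w n * (R : ℂ) ^ (n + 2) / ((n : ℂ) + 2) ^ 2) =
      besselCoeff w (n + 2) * (R : ℂ) ^ (n + 2) := fun n => by
    have h2 : (n : ℂ) + 2 ≠ 0 := by exact_mod_cast Nat.succ_ne_zero (n + 1)
    have h3 := besselCoeff_add_two w n
    rw [← mul_div_assoc, ← mul_assoc, ← h3]
    field_simp
  simp only [e] at h1
  -- the shift by two loses the terms `n = 0`, equal to `2π`, and `n = 1`, equal to `0`
  have h2 := (hasSum_nat_add_iff' 2).2 (hasSum_integral_planeWave_circleMap w R)
  rw [h1.unique h2]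
  congr 1
  rw [Finset.sum_range_succ, Finset.sum_range_one, besselCoeff_one]
  simp [besselCoeff, angleMoment]
  ring

/-- The test function `z ↦ log⁺ (R / ‖c - z‖)`, for `i = (c, R)`. At the centre, where the true
value would be `∞`, it takes the junk value `0`; almost surely no zero of the random function lies
there. -/
def logBump (i : Disk) (z : ℂ) : ℝ := Real.posLog (i.2 * ‖i.1 - z‖⁻¹)

theorem logBump_nonneg (i : Disk) (z : ℂ) : 0 ≤ logBump i z := Real.posLog_nonneg

theorem measurable_logBump (i : Disk) : Measurable (logBump i) := by
  unfold logBump Real.posLog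
  exact measurable_const.max (Measurable.log (by fun_prop))

theorem logBump_eq_zero {i : Disk} {z : ℂ} (h : (i.2 : ℝ) ≤ ‖i.1 - z‖) : logBump i z = 0 := by
  have h0 : 0 < ‖i.1 - z‖ := i.2.2.trans_le h
  rw [logBump, Real.posLog_eq_zero_iff, abs_of_nonneg (mul_nonneg i.2.2.le (by positivity)),
    ← div_eq_mul_inv]
  exact (div_le_one h0).2 h

theorem logBump_eq_log {i : Disk} {z : ℂ} (h : ‖i.1 - z‖ ≤ i.2) :
    logBump i z = Real.log (i.2 * ‖i.1 - z‖⁻¹) := by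
  have hR : 0 < (i.2 : ℝ) := i.2.2
  rcases (norm_nonneg (i.1 - z)).eq_or_lt with h0 | h0
  · simp [logBump, ← h0]
  · rw [logBump, Real.posLog_eq_log]
    rw [abs_of_nonneg (by positivity), ← div_eq_mul_inv]
    exact (one_le_div h0).2 h

/-- The logarithmic singularity is milder than that of `‖z‖ ^ (-1/2)`. -/
theorem norm_mul_logBump_sq_le (i : Disk) (z : ℂ) : ‖i.1 - z‖ * logBump i z ^ 2 ≤ 4 * i.2 := by
  have hR : 0 < (i.2 : ℝ) := i.2.2
  rcases (norm_nonneg (i.1 - z)).eq_or_lt with h0 | h0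
  · rw [← h0]; simp [hR.le]
  · rcases le_total ‖i.1 - z‖ i.2 with h | h
    · rw [logBump_eq_log h]
      set x := (i.2 : ℝ) * ‖i.1 - z‖⁻¹ with hx
      have hx0 : 0 < x := by positivity
      have hx1 : 1 ≤ x := by rw [hx, ← div_eq_mul_inv]; exact (one_le_div h0).2 h
      have h1 : Real.log x ≤ 2 * √x := by
        have := Real.log_le_sub_one_of_pos (Real.sqrt_pos.2 hx0)
        rw [Real.log_sqrt hx0.le] at this
        linarith
      have h2 : Real.log x ^ 2 ≤ 4 * x := by
        calc Real.log x ^ 2 ≤ (2 * √x) ^ 2 := by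
              gcongr
              exact Real.log_nonneg hx1
          _ = 4 * x := by rw [mul_pow, Real.sq_sqrt hx0.le]; ring
      calc _ ≤ ‖i.1 - z‖ * (4 * x) := by gcongr
        _ = 4 * i.2 := by rw [hx]; field_simp
    · rw [logBump_eq_zero h]; simp [hR.le]

/-- A function on the plane with a singularity at most `1 / ‖z‖` and bounded support is
integrable. -/
theorem integrable_of_norm_mul_le {f : ℂ → ℝ} (hf : Measurable f) {C R : ℝ}
    (hC : ∀ z, ‖z‖ * ‖f z‖ ≤ C) (h0 : ∀ z, R < ‖z‖ → f z = 0) : Integrable f := by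
  refine ⟨hf.aestronglyMeasurable, ?_⟩
  rw [hasFiniteIntegral_iff_enorm, ← Complex.lintegral_comp_polarCoord_symm, polarCoord_target]
  refine lt_of_le_of_lt (setLIntegral_mono (g := Set.indicator (Set.Ioc 0 R ×ˢ Set.Ioo (-π) π)
    fun _ => ENNReal.ofReal C) (measurable_const.indicator
      (measurableSet_Ioc.prod measurableSet_Ioo)) fun p hp => ?_)
    (lt_of_le_of_lt (setLIntegral_le_lintegral _ _) ?_)
  · have hp1 : 0 < p.1 := hp.1
    have hn : ‖Complex.polarCoord.symm p‖ = p.1 := by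
      rw [Complex.norm_polarCoord_symm, abs_of_pos hp1]
    by_cases hR : p.1 ≤ R
    · have hmem : p ∈ Set.Ioc 0 R ×ˢ Set.Ioo (-π) π := ⟨⟨hp1, hR⟩, hp.2⟩
      rw [Set.indicator_of_mem hmem, smul_eq_mul, ← ofReal_norm, ← ENNReal.ofReal_mul hp1.le]
      refine ENNReal.ofReal_le_ofReal ?_
      have := hC (Complex.polarCoord.symm p)
      rwa [hn] at this
    · rw [h0 _ (by rw [hn]; linarith)]
      simp
  · rw [lintegral_indicator_const (measurableSet_Ioc.prod measurableSet_Ioo),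
      Measure.volume_eq_prod, Measure.prod_prod, Real.volume_Ioc, Real.volume_Ioo]
    exact ENNReal.mul_lt_top ENNReal.ofReal_lt_top
      (ENNReal.mul_lt_top ENNReal.ofReal_lt_top ENNReal.ofReal_lt_top)

theorem memLp_two_logBump (i : Disk) : MemLp (logBump i) 2 volume := by
  rw [memLp_two_iff_integrable_sq (measurable_logBump i).aestronglyMeasurable]
  rw [← integrable_comp_sub_left (fun z => logBump i z ^ 2) i.1]
  refine integrable_of_norm_mul_le (C := 4 * i.2) (R := i.2)
    (((measurable_logBump i).comp (measurable_const.sub measurable_id)).pow_const 2)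
    (fun z => ?_) fun z hz => ?_
  · have := norm_mul_logBump_sq_le i (i.1 - z)
    rw [sub_sub_cancel] at this
    rwa [Real.norm_of_nonneg (by positivity)]
  · rw [logBump_eq_zero (by rw [sub_sub_cancel]; exact hz.le)]; simp

theorem integrable_logBump (i : Disk) : Integrable (logBump i) := by
  have h1 := (memLp_two_logBump i).restrict (Metric.closedBall i.1 i.2)
  have : IsFiniteMeasure (volume.restrict (Metric.closedBall i.1 (i.2 : ℝ))) :=
    ⟨by rw [Measure.restrict_apply_univ]; exact measure_closedBall_lt_top⟩
  have h2 : IntegrableOn (logBump i) (Metric.closedBall i.1 i.2) := h1.integrable one_le_two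
  refine (integrableOn_iff_integrable_of_support_subset fun z hz => ?_).1 h2
  by_contra hc
  refine hz (logBump_eq_zero ?_)
  rw [Metric.mem_closedBall, not_le, dist_comm, dist_eq_norm] at hc
  exact hc.le

theorem planeWave_add (w z z' : ℂ) : planeWave w (z + z') = planeWave w z * planeWave w z' := by
  rw [planeWave, planeWave, planeWave, ← Complex.exp_add, inner_add_left]
  congr 1; push_cast; ring

theorem circleAverage_planeWave (w c : ℂ) (R : ℝ) :
    Real.circleAverage (planeWave w) c R =
      planeWave w c * ((2 * (π : ℂ))⁻¹ * ∫ θ in (-π)..π, planeWave w (circleMap 0 R θ)) := by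
  have hp : Function.Periodic (fun θ => planeWave w (circleMap 0 R θ)) (2 * π) := fun θ => by
    simp only [periodic_circleMap 0 R θ]
  have h := hp.intervalIntegral_add_eq (-π) 0
  rw [show -π + 2 * π = π by ring, zero_add] at h
  rw [h, Real.circleAverage_def, Complex.real_smul]
  have e : ∀ θ, planeWave w (circleMap c R θ) = planeWave w c * planeWave w (circleMap 0 R θ) :=
    fun θ => by rw [← planeWave_add]; congr 1; simp [circleMap]
  simp only [e]
  rw [intervalIntegral.integral_const_mul]
  push_cast; ring

/-- The distributional identity `Δ logBump = 2π (uniform measure on the circle - Dirac mass at the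
centre)`, on the Fourier side. -/
theorem fourier_logBump (i : Disk) (w : ℂ) :
    -2 * (π : ℂ) * (‖w‖ : ℂ) ^ 2 * 𝓕 (fun z => (logBump i z : ℂ)) w =
      Real.circleAverage (planeWave w) i.1 i.2 - planeWave w i.1 := by
  have hR : 0 < (i.2 : ℝ) := i.2.2
  set R : ℝ := (i.2 : ℝ) with hRdef
  have hpos : ∀ t : ℝ, 0 < t → ∀ θ, planeWave w (i.1 + Complex.polarCoord.symm (t, θ)) *
      (logBump i (i.1 + Complex.polarCoord.symm (t, θ)) : ℂ) = planeWave w i.1 *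
      ((Real.posLog (R * t⁻¹) : ℂ) * planeWave w (circleMap 0 t θ)) := fun t ht θ => by
    have e1 : Complex.polarCoord.symm (t, θ) = circleMap 0 t θ := by
      rw [Complex.polarCoord_symm_apply]
      simp [circleMap, Complex.exp_mul_I]
    have e2 : logBump i (i.1 + Complex.polarCoord.symm (t, θ)) = Real.posLog (R * t⁻¹) := by
      rw [logBump, sub_add_cancel_left, norm_neg, Complex.norm_polarCoord_symm, abs_of_pos ht]
    rw [e2, planeWave_add, e1]; ring
  -- in polar coordinates around the centre, the Jacobian `t` tames the logarithm:
  -- `t log (R / t) ≤ R`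
  have hpolar : IntegrableOn (fun p : ℝ × ℝ => ((p.1 * Real.posLog (R * p.1⁻¹) : ℝ) : ℂ) *
      planeWave w (circleMap 0 p.1 p.2)) (Set.Ioi 0 ×ˢ Set.Ioo (-π) π) := by
    have hm : Measurable fun p : ℝ × ℝ => ((p.1 * Real.posLog (R * p.1⁻¹) : ℝ) : ℂ) *
        planeWave w (circleMap 0 p.1 p.2) := by
      refine (Complex.measurable_ofReal.comp (measurable_fst.mul ?_)).mul ?_
      · unfold Real.posLog
        exact measurable_const.max (Measurable.log (by fun_prop))
      · have : Continuous fun p : ℝ × ℝ => circleMap 0 p.1 p.2 := by unfold circleMap; fun_prop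
        exact (continuous_planeWave.comp (continuous_const.prodMk this)).measurable
    have hdom : Integrable ((Set.Ioc 0 R ×ˢ Set.Ioo (-π) π).indicator fun _ : ℝ × ℝ => R) := by
      refine (integrable_indicator_iff (measurableSet_Ioc.prod measurableSet_Ioo)).2
        (integrableOn_const ?_)
      rw [Measure.volume_eq_prod, Measure.prod_prod, Real.volume_Ioc, Real.volume_Ioo]
      exact (ENNReal.mul_lt_top ENNReal.ofReal_lt_top ENNReal.ofReal_lt_top).ne
    refine hdom.integrableOn.mono' hm.aestronglyMeasurable ?_
    filter_upwards [self_mem_ae_restrict (measurableSet_Ioi.prod measurableSet_Ioo)] with p hp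
    have hp1 : 0 < p.1 := hp.1
    rw [norm_mul, norm_planeWave, mul_one, Complex.norm_real,
      Real.norm_of_nonneg (mul_nonneg hp1.le Real.posLog_nonneg)]
    by_cases h : p.1 ≤ R
    · have hmem : p ∈ Set.Ioc 0 R ×ˢ Set.Ioo (-π) π := ⟨⟨hp1, h⟩, hp.2⟩
      rw [Set.indicator_of_mem hmem]
      have h1 : 1 ≤ R * p.1⁻¹ := by rw [← div_eq_mul_inv]; exact (one_le_div hp1).2 h
      rw [Real.posLog_eq_log (by rwa [abs_of_nonneg (by positivity)])]
      calc p.1 * Real.log (R * p.1⁻¹) ≤ p.1 * (R * p.1⁻¹) := by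
            gcongr
            exact (Real.log_le_sub_one_of_pos (by positivity)).trans (by linarith)
        _ = R := by field_simp
    · have h1 : Real.posLog (R * p.1⁻¹) = 0 := by
        rw [Real.posLog_eq_zero_iff, abs_of_nonneg (by positivity), ← div_eq_mul_inv]
        exact (div_le_one hp1).2 (by linarith)
      rw [h1, mul_zero]
      exact Set.indicator_nonneg (fun _ _ => hR.le) _
  have hF : 𝓕 (fun z => (logBump i z : ℂ)) w = planeWave w i.1 *
      ∫ t in Set.Ioc 0 R, ((t * Real.log (R * t⁻¹) : ℝ) : ℂ) *
        ∫ θ in (-π)..π, planeWave w (circleMap 0 t θ) := by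
    rw [fourier_eq_integral_planeWave,
      ← integral_add_left_eq_self (fun z => planeWave w z * (logBump i z : ℂ)) i.1,
      ← Complex.integral_comp_polarCoord_symm, polarCoord_target]
    have e : ∫ p in Set.Ioi (0 : ℝ) ×ˢ Set.Ioo (-π) π, p.1 •
        (planeWave w (i.1 + Complex.polarCoord.symm p) *
          (logBump i (i.1 + Complex.polarCoord.symm p) : ℂ)) =
        ∫ p in Set.Ioi (0 : ℝ) ×ˢ Set.Ioo (-π) π, planeWave w i.1 *
          (((p.1 * Real.posLog (R * p.1⁻¹) : ℝ) : ℂ) * planeWave w (circleMap 0 p.1 p.2)) := by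
      refine setIntegral_congr_fun (measurableSet_Ioi.prod measurableSet_Ioo) fun p hp => ?_
      have := hpos p.1 hp.1 p.2
      rw [Complex.real_smul, this]
      push_cast; ring
    rw [e, integral_const_mul, Measure.volume_eq_prod, setIntegral_prod _ hpolar]
    congr 1
    rw [setIntegral_eq_of_subset_of_forall_sdiff_eq_zero measurableSet_Ioi
      (Set.Ioc_subset_Ioi_self : Set.Ioc 0 R ⊆ Set.Ioi 0)]
    · refine setIntegral_congr_fun measurableSet_Ioc fun t ht => ?_
      simp only
      have h1 : 1 ≤ R * t⁻¹ := by rw [← div_eq_mul_inv]; exact (one_le_div ht.1).2 ht.2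
      rw [integral_const_mul, Real.posLog_eq_log (by rwa [abs_of_nonneg (by linarith)]),
        intervalIntegral.integral_of_le (by linarith [Real.pi_pos]), integral_Ioc_eq_integral_Ioo]
    · intro t ht
      have ht0 : 0 < t := ht.1
      have htR : R < t := by
        by_contra hc
        exact ht.2 ⟨ht0, not_lt.1 hc⟩
      have h1 : Real.posLog (R * t⁻¹) = 0 := by
        rw [Real.posLog_eq_zero_iff, abs_of_nonneg (by positivity), ← div_eq_mul_inv]
        exact (div_le_one ht0).2 htR.le
      simp [h1]
  rw [hF, circleAverage_planeWave]
  have h := integral_mul_log_mul_planeWave w hR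
  have hpi : (π : ℂ) ≠ 0 := by exact_mod_cast Real.pi_ne_zero
  have : -2 * (π : ℂ) * (‖w‖ : ℂ) ^ 2 * (planeWave w i.1 *
      ∫ t in Set.Ioc 0 R, ((t * Real.log (R * t⁻¹) : ℝ) : ℂ) *
        ∫ θ in (-π)..π, planeWave w (circleMap 0 t θ)) = planeWave w i.1 * (2 * (π : ℂ))⁻¹ *
      (-4 * (π : ℂ) ^ 2 * (‖w‖ : ℂ) ^ 2 * ∫ t in Set.Ioc 0 R, ((t * Real.log (R * t⁻¹) : ℝ) : ℂ) *
        ∫ θ in (-π)..π, planeWave w (circleMap 0 t θ)) := by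
    field_simp
    ring
  rw [this, h]
  field_simp

/-! ### Simplicity of the zeros -/

/-- The coefficient sequences for which the series `gef ζ` converges absolutely on the plane. -/
def IsEntireSeq (ζ : ℕ → ℂ) : Prop := ∀ z, Summable fun n => ‖ζ n‖ * ‖gefCoeff n z‖

theorem norm_gefCoeff_le {z w : ℂ} (h : ‖z‖ ≤ ‖w‖) (n : ℕ) : ‖gefCoeff n z‖ ≤ ‖gefCoeff n w‖ := by
  simp only [gefCoeff, norm_div, norm_pow]
  gcongr

theorem differentiable_gefCoeff (n : ℕ) : Differentiable ℂ (gefCoeff n) := by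
  unfold gefCoeff; fun_prop

theorem gefCoeff_zero (z : ℂ) : gefCoeff 0 z = 1 := by simp [gefCoeff]

/-- The termwise derivative of the series `gef ζ`. -/
def gefDeriv (ζ : ℕ → ℂ) (z : ℂ) : ℂ := ∑' n, ζ n * deriv (gefCoeff n) z

theorem measurable_gefDeriv (z : ℂ) : Measurable fun ζ : ℕ → ℂ => gefDeriv ζ z := by
  unfold gefDeriv
  exact Measurable.tsum fun n => by fun_prop

namespace IsEntireSeq

variable {ζ : ℕ → ℂ} (h : IsEntireSeq ζ)
include h

theorem differentiable : Differentiable ℂ (gef ζ) := fun z => by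
  have hd := Complex.differentiableOn_tsum_of_summable_norm (U := Metric.ball (0 : ℂ) (‖z‖ + 1))
    (F := fun n w => ζ n * gefCoeff n w) (h (‖z‖ + 1 : ℝ))
    (fun n => ((differentiable_gefCoeff n).const_mul _).differentiableOn) Metric.isOpen_ball
    (fun n w hw => by
      rw [norm_mul]
      have hw' : ‖w‖ < ‖z‖ + 1 := by simpa using hw
      refine mul_le_mul_of_nonneg_left (norm_gefCoeff_le ?_ n) (norm_nonneg _)
      rw [Complex.norm_real, Real.norm_of_nonneg (by positivity)]
      exact hw'.le)
  exact hd.differentiableAt (Metric.isOpen_ball.mem_nhds (by simp))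

theorem deriv_eq (z : ℂ) : deriv (gef ζ) z = gefDeriv ζ z := by
  have hd := Complex.hasSum_deriv_of_summable_norm (U := Metric.ball (0 : ℂ) (‖z‖ + 1))
    (F := fun n w => ζ n * gefCoeff n w) (h (‖z‖ + 1 : ℝ))
    (fun n => ((differentiable_gefCoeff n).const_mul _).differentiableOn) Metric.isOpen_ball
    (fun n w hw => by
      rw [norm_mul]
      have hw' : ‖w‖ < ‖z‖ + 1 := by simpa using hw
      refine mul_le_mul_of_nonneg_left (norm_gefCoeff_le ?_ n) (norm_nonneg _)
      rw [Complex.norm_real, Real.norm_of_nonneg (by positivity)]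
      exact hw'.le) (z := z) (by simp)
  refine hd.tsum_eq.symm.trans (tsum_congr fun n => ?_)
  rw [deriv_const_mul _ (differentiable_gefCoeff n).differentiableAt]

theorem update (x : ℂ) : IsEntireSeq (Function.update ζ 0 x) := fun z => by
  refine (summable_nat_add_iff 1).1 ?_
  simpa using (summable_nat_add_iff 1).2 (h z)

theorem gef_update (x z : ℂ) :
    gef (Function.update ζ 0 x) z = x + gef (Function.update ζ 0 0) z := by
  have hs : ∀ x, Summable fun n => Function.update ζ 0 x n * gefCoeff n z := fun x =>
    Summable.of_norm (by simpa only [norm_mul] using h.update x z)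
  rw [gef_eq_tsum, gef_eq_tsum, (hs x).tsum_eq_zero_add, (hs 0).tsum_eq_zero_add]
  simp [gefCoeff_zero]

theorem analyticOnNhd (s : Set ℂ) : AnalyticOnNhd ℂ (gef ζ) s := fun z _ =>
  h.differentiable.analyticAt z

end IsEntireSeq

/-- The derivative does not depend on the constant coefficient. -/
theorem gefDeriv_update (ζ : ℕ → ℂ) (x z : ℂ) :
    gefDeriv (Function.update ζ 0 x) z = gefDeriv ζ z := by
  unfold gefDeriv
  refine tsum_congr fun n => ?_
  rcases n with _ | n
  · have : gefCoeff 0 = fun _ => 1 := funext gefCoeff_zero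
    simp [this]
  · simp

theorem gefDeriv_zero (ζ : ℕ → ℂ) : gefDeriv ζ 0 = ζ 1 := by
  unfold gefDeriv
  have hd : ∀ n, deriv (gefCoeff n) 0 = if n = 1 then 1 else 0 := fun n => by
    unfold gefCoeff
    rw [deriv_div_const, deriv_pow_field]
    rcases n with _ | _ | n <;> simp
  simp [hd]

theorem ae_isEntireSeq : ∀ᵐ ζ ∂coeffLaw, IsEntireSeq ζ := ae_forall_summable_norm_mul_gefCoeff

theorem ae_apply_ne_zero (n : ℕ) : ∀ᵐ ζ ∂coeffLaw, ζ n ≠ 0 := by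
  have h := (measurePreserving_eval_infinitePi (fun _ : ℕ => stdComplexGaussian) n)
  have h0 : ∀ᵐ x ∂stdComplexGaussian, x ≠ 0 := by
    rw [ae_iff]; simpa using stdComplexGaussian_countable (Set.countable_singleton (0 : ℂ))
  exact h.quasiMeasurePreserving.ae h0

/-- Resampling the first coefficient does not change the law. -/
theorem measurePreserving_update_zero :
    MeasurePreserving (fun p : ℂ × (ℕ → ℂ) => Function.update p.2 0 p.1)
      (stdComplexGaussian.prod coeffLaw) coeffLaw := by
  have hm : Measurable fun p : ℂ × (ℕ → ℂ) => Function.update p.2 0 p.1 := by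
    refine measurable_pi_lambda _ fun n => ?_
    rcases n with _ | n
    · simpa using measurable_fst
    · have : Measurable fun p : ℂ × (ℕ → ℂ) => p.2 (n + 1) :=
        (measurable_pi_apply _).comp measurable_snd
      simpa using this
  refine ⟨hm, ?_⟩
  refine Measure.eq_infinitePi _ fun s t ht => ?_
  rw [Measure.map_apply hm (MeasurableSet.pi s.countable_toSet fun i _ => ht i)]
  have e : (fun p : ℂ × (ℕ → ℂ) => Function.update p.2 0 p.1) ⁻¹' (Set.pi s t) =
      (if 0 ∈ s then t 0 else Set.univ) ×ˢ (Set.pi (s.erase 0 : Finset ℕ) t) := by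
    ext ⟨x, y⟩
    simp only [Set.mem_preimage, Set.mem_pi, Finset.mem_coe, Set.mem_prod, Finset.mem_erase]
    constructor
    · intro h
      refine ⟨?_, fun i hi => by simpa [hi.1] using h i hi.2⟩
      split_ifs with h0
      · simpa using h 0 h0
      · trivial
    · rintro ⟨h1, h2⟩ i hi
      rcases eq_or_ne i 0 with rfl | hi0
      · simpa [hi] using h1
      · simpa [hi0] using h2 i ⟨hi0, hi⟩
  rw [e, Measure.prod_prod, Measure.infinitePi_pi _ fun i _ => ht i]
  split_ifs with h0
  · exact Finset.mul_prod_erase s (fun i => stdComplexGaussian (t i)) h0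
  · simp [Finset.erase_eq_of_notMem h0]

theorem countable_gefDeriv_eq_zero {ζ : ℕ → ℂ} (h : IsEntireSeq ζ) (h1 : ζ 1 ≠ 0) :
    {z | gefDeriv ζ z = 0}.Countable := by
  have ha : AnalyticOnNhd ℂ (gefDeriv ζ) Set.univ := by
    rw [← funext h.deriv_eq]
    exact (h.analyticOnNhd _).deriv
  have hc := ha.preimage_zero_mem_codiscrete (x := 0) (by rwa [gefDeriv_zero])
  have hd := (mem_codiscrete'.mp hc).2
  have := (HereditarilyLindelofSpace.isLindelof _).countable_of_isDiscrete hd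
  refine this.mono fun z hz => ?_
  simpa using hz

/-- The infimum of `‖gef ζ z‖ + ‖gefDeriv ζ z‖` over a countable dense set of points of the open
ball of radius `K`. It is measurable in `ζ`. For an entire function it vanishes if there is a
multiple zero in the open ball, and only if there is one in the plane. -/
def doubleZeroGap (ζ : ℕ → ℂ) (K : ℕ) : ENNReal :=
  ⨅ n : ℕ, ⨅ _ : TopologicalSpace.denseSeq ℂ n ∈ Metric.ball (0 : ℂ) K,
    (‖gef ζ (TopologicalSpace.denseSeq ℂ n)‖ₑ + ‖gefDeriv ζ (TopologicalSpace.denseSeq ℂ n)‖ₑ)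

theorem measurable_doubleZeroGap (K : ℕ) : Measurable fun ζ => doubleZeroGap ζ K := by
  unfold doubleZeroGap
  refine Measurable.iInf fun n => Measurable.iInf fun _ => ?_
  exact (measurable_gef _).enorm.add (measurable_gefDeriv _).enorm

theorem IsEntireSeq.continuous_gap {ζ : ℕ → ℂ} (h : IsEntireSeq ζ) :
    Continuous fun z => ‖gef ζ z‖ₑ + ‖gefDeriv ζ z‖ₑ := by
  have h1 : Continuous (gef ζ) := h.differentiable.continuous
  have h2 : Continuous (gefDeriv ζ) := by
    rw [← funext h.deriv_eq]
    exact continuousOn_univ.1 (h.analyticOnNhd Set.univ).deriv.continuousOn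
  exact h1.enorm.add h2.enorm

theorem IsEntireSeq.doubleZeroGap_eq_zero {ζ : ℕ → ℂ} (h : IsEntireSeq ζ) {z : ℂ}
    (h0 : gef ζ z = 0) (h1 : gefDeriv ζ z = 0) {K : ℕ} (hK : ‖z‖ < K) : doubleZeroGap ζ K = 0 := by
  refine le_antisymm (le_of_forall_gt fun ε hε => ?_) zero_le
  have hz : (fun z => ‖gef ζ z‖ₑ + ‖gefDeriv ζ z‖ₑ) z < ε := by simpa [h0, h1] using hε
  have hU : IsOpen ({w | ‖gef ζ w‖ₑ + ‖gefDeriv ζ w‖ₑ < ε} ∩ Metric.ball (0 : ℂ) K) :=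
    (isOpen_lt h.continuous_gap continuous_const).inter Metric.isOpen_ball
  obtain ⟨n, hw⟩ := (TopologicalSpace.denseRange_denseSeq ℂ).exists_mem_open hU
    ⟨z, hz, by simpa using hK⟩
  refine lt_of_le_of_lt ?_ (show _ < ε from hw.1)
  exact iInf₂_le (f := fun m (_ : TopologicalSpace.denseSeq ℂ m ∈ Metric.ball (0 : ℂ) K) =>
    ‖gef ζ (TopologicalSpace.denseSeq ℂ m)‖ₑ + ‖gefDeriv ζ (TopologicalSpace.denseSeq ℂ m)‖ₑ) n hw.2

theorem IsEntireSeq.exists_double_zero {ζ : ℕ → ℂ} (h : IsEntireSeq ζ) {K : ℕ}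
    (hK : doubleZeroGap ζ K = 0) : ∃ z, gef ζ z = 0 ∧ gefDeriv ζ z = 0 := by
  obtain ⟨z, hz, hmin⟩ := (isCompact_closedBall (0 : ℂ) K).exists_isMinOn
    ⟨0, by simp⟩ h.continuous_gap.continuousOn
  have : ‖gef ζ z‖ₑ + ‖gefDeriv ζ z‖ₑ ≤ doubleZeroGap ζ K :=
    le_iInf₂ fun n hn => hmin (Metric.ball_subset_closedBall hn)
  rw [hK, nonpos_iff_eq_zero, add_eq_zero] at this
  exact ⟨z, by simpa using this.1, by simpa using this.2⟩

/-- Almost surely all zeros are simple: given the coefficients of positive index, a multiple zero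
forces minus the constant coefficient to be one of countably many critical values. -/
theorem ae_gefDeriv_ne_zero :
    ∀ᵐ ζ ∂coeffLaw, ∀ z, gef ζ z = 0 → gefDeriv ζ z ≠ 0 := by
  -- Fubini: a null set of values of the coefficient `ζ 0`, for almost all values of the others
  have hB : ∀ K : ℕ, ∀ᵐ ζ ∂coeffLaw, doubleZeroGap ζ K ≠ 0 := fun K => by
    have hS : MeasurableSet {ζ | ¬ doubleZeroGap ζ K ≠ 0} := by
      have h := measurable_doubleZeroGap K (measurableSet_singleton 0)
      simp only [ne_eq, not_not]
      exact h
    rw [ae_iff, ← measurePreserving_update_zero.measure_preimage hS.nullMeasurableSet,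
      Measure.prod_apply_symm (measurePreserving_update_zero.measurable hS),
      lintegral_eq_zero_iff (measurable_measure_prodMk_right
        (measurePreserving_update_zero.measurable hS))]
    filter_upwards [ae_isEntireSeq, ae_apply_ne_zero 1] with y hy hy1
    refine measure_mono_null (t := (fun z => - gef (Function.update y 0 0) z) ''
      {z | gefDeriv y z = 0}) (fun x hx => ?_)
      (stdComplexGaussian_countable ((countable_gefDeriv_eq_zero hy hy1).image _))
    obtain ⟨z, h0, h1⟩ := (hy.update x).exists_double_zero (K := K) (by simpa using hx)
    rw [gefDeriv_update] at h1
    rw [hy.gef_update] at h0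
    exact ⟨z, h1, (eq_neg_of_add_eq_zero_left h0).symm⟩
  filter_upwards [ae_isEntireSeq, ae_all_iff.2 hB] with ζ hζ hK z h0 h1
  obtain ⟨K, hzK⟩ := exists_nat_gt ‖z‖
  exact hK K (hζ.doubleZeroGap_eq_zero h0 h1 hzK)

/-! ### Linear statistics of test functions -/

/-- When all zeros are simple, the terms of the sum in Jensen's formula are the values of `logBump`
at the zeros. -/
theorem gefZeros_indicator_logBump {ζ : ℕ → ℂ} (h : IsEntireSeq ζ)
    (hsimple : ∀ z, gef ζ z = 0 → gefDeriv ζ z ≠ 0) (i : Disk) (u : ℂ) :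
    (MeromorphicOn.divisor (gef ζ) (Metric.closedBall i.1 |(i.2 : ℝ)|) u : ℝ) *
      Real.log (i.2 * ‖i.1 - u‖⁻¹) = (gefZeros ζ).indicator (logBump i) u := by
  have hR : (0 : ℝ) < i.2 := i.2.2
  have ha := h.analyticOnNhd (Metric.closedBall i.1 |(i.2 : ℝ)|)
  by_cases hu : u ∈ Metric.closedBall i.1 |(i.2 : ℝ)|
  · rw [MeromorphicOn.AnalyticOnNhd.divisor_apply ha hu]
    have hn : ‖i.1 - u‖ ≤ i.2 := by
      rwa [Metric.mem_closedBall, abs_of_pos hR, dist_eq_norm, norm_sub_rev] at hu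
    by_cases hz : gef ζ u = 0
    · rw [Set.indicator_of_mem (show u ∈ gefZeros ζ from hz),
        (ha u hu).analyticOrderAt_eq_one_of_zero_deriv_ne_zero hz
          (by rw [h.deriv_eq]; exact hsimple u hz), logBump_eq_log hn]
      simp
    · rw [Set.indicator_of_notMem (show u ∉ gefZeros ζ from hz),
        (ha u hu).analyticOrderAt_eq_zero.mpr hz]
      simp
  · rw [Function.locallyFinsuppWithin.apply_eq_zero_of_notMem _ hu]
    have hn : (i.2 : ℝ) ≤ ‖i.1 - u‖ := by
      rw [Metric.mem_closedBall, abs_of_pos hR, dist_eq_norm, norm_sub_rev, not_le] at hu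
      exact hu.le
    simp only [Set.indicator, logBump_eq_zero hn]
    simp

/-- Jensen's formula, for a function with simple zeros only, as a formula for the linear statistic
of `logBump`. -/
theorem hasSum_logBump_gefZeros {ζ : ℕ → ℂ} (h : IsEntireSeq ζ)
    (hsimple : ∀ z, gef ζ z = 0 → gefDeriv ζ z ≠ 0) (i : Disk) (h0 : gef ζ i.1 ≠ 0) :
    HasSum (fun a : gefZeros ζ => logBump i a)
      (Real.circleAverage (fun z => Real.log ‖gef ζ z‖) i.1 i.2 - Real.log ‖gef ζ i.1‖) := by
  have hR : (0 : ℝ) < i.2 := i.2.2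
  have hj := AnalyticOnNhd.circleAverage_log_norm hR.ne' (h.analyticOnNhd _) h0
  have hi := gefZeros_indicator_logBump h hsimple i
  have hfin := (MeromorphicOn.divisor (gef ζ) (Metric.closedBall i.1 |(i.2 : ℝ)|)).finiteSupport
    (isCompact_closedBall _ _)
  have hsupp : (Function.support ((gefZeros ζ).indicator (logBump i))).Finite := by
    refine hfin.subset fun u hu => ?_
    rw [Function.mem_support, ← hi u] at hu
    intro h0
    simp [h0] at hu
  have hs : Summable ((gefZeros ζ).indicator (logBump i)) := summable_of_hasFiniteSupport hsupp
  rw [hj, add_sub_cancel_right, finsum_congr hi,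
    ← tsum_eq_finsum (L := SummationFilter.unconditional ℂ) hsupp]
  exact hasSum_subtype_iff_indicator.2 hs.hasSum

/-- The increment `R²` of the circular mean of `‖z‖²` produces the mean of the linear statistics. -/
theorem circleAverage_norm_sq (c : ℂ) (R : ℝ) :
    Real.circleAverage (fun z => ‖z‖ ^ 2) c R = ‖c‖ ^ 2 + R ^ 2 := by
  have e : ∀ θ, ‖circleMap c R θ‖ ^ 2 =
      (‖c‖ ^ 2 + R ^ 2) + 2 * R * (inner ℝ (circleMap 0 1 θ) c : ℝ) := fun θ => by
    have : circleMap c R θ = c + R • circleMap 0 1 θ := by simp [circleMap]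
    rw [this, norm_add_sq_real, norm_smul, inner_smul_right, real_inner_comm]
    simp
    ring
  have hc : Continuous fun θ : ℝ => (inner ℝ (circleMap 0 1 θ) c : ℝ) :=
    (continuous_circleMap 0 1).inner continuous_const
  have h0 : ∫ θ in (0 : ℝ)..(2 * π), (inner ℝ (circleMap 0 1 θ) c : ℝ) = 0 := by
    have h1 := angleMoment_one c
    simp only [angleMoment, pow_one] at h1
    have hp : Function.Periodic (fun θ : ℝ => (inner ℝ (circleMap 0 1 θ) c : ℝ)) (2 * π) :=
      fun θ => by simp only [periodic_circleMap 0 1 θ]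
    have := hp.intervalIntegral_add_eq 0 (-π)
    rw [zero_add] at this
    rw [this, ← h1]; congr 1; ring
  rw [Real.circleAverage_def]
  simp only [e]
  rw [intervalIntegral.integral_add (by simp) ((hc.const_mul _).intervalIntegrable _ _),
    intervalIntegral.integral_const_mul, h0]
  simp
  field_simp

/-- Finite linear combinations of the functions `logBump`. -/
def testFun (s : Disk →₀ ℂ) (z : ℂ) : ℂ := s.sum fun i b => b * (logBump i z : ℂ)

/-- The centred linear statistic of `testFun s`, expressed through increments of `gefLog`. -/
def centredStat (s : Disk →₀ ℂ) (ζ : ℕ → ℂ) : ℂ :=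
  ∫ θ, diskJump s (fun z => (gefLog ζ z : ℂ)) θ ∂angleMeasure

/-- The mean of the linear statistic of `testFun s`: the zeros have intensity `1 / π`, and the
integral of `logBump (c, R)` is `π R² / 2`. -/
def meanStat (s : Disk →₀ ℂ) : ℂ := s.sum fun i b => b * ((i.2 : ℝ) ^ 2 / 2 : ℝ)

theorem IsEntireSeq.circleIntegrable_log {ζ : ℕ → ℂ} (h : IsEntireSeq ζ) (c : ℂ) (R : ℝ) :
    CircleIntegrable (fun z => Real.log ‖gef ζ z‖) c R :=
  (h.analyticOnNhd _).meromorphicOn.circleIntegrable_log_norm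

theorem IsEntireSeq.circleIntegrable_gefLog {ζ : ℕ → ℂ} (h : IsEntireSeq ζ) (c : ℂ) (R : ℝ) :
    CircleIntegrable (gefLog ζ) c R := by
  have h2 : CircleIntegrable (fun z : ℂ => ‖z‖ ^ 2 / 2) c R :=
    ContinuousOn.circleIntegrable' (by fun_prop)
  exact ((h.circleIntegrable_log c R).sub h2).sub (circleIntegrable_const _ _ _)

theorem IsEntireSeq.integrable_gefLog_circleMap {ζ : ℕ → ℂ} (h : IsEntireSeq ζ) (i : Disk) :
    Integrable (fun θ => gefLog ζ (circleMap i.1 i.2 θ)) angleMeasure := by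
  have h1 := h.circleIntegrable_gefLog i.1 i.2
  rw [CircleIntegrable, intervalIntegrable_iff_integrableOn_Ioc_of_le (by positivity)] at h1
  exact h1.smul_measure (by simp)

theorem IsEntireSeq.circleAverage_gefLog_sub {ζ : ℕ → ℂ} (h : IsEntireSeq ζ) (c : ℂ) (R : ℝ) :
    Real.circleAverage (gefLog ζ) c R - gefLog ζ c =
      Real.circleAverage (fun z => Real.log ‖gef ζ z‖) c R - Real.log ‖gef ζ c‖ - R ^ 2 / 2 := by
  have h2 : CircleIntegrable (fun z : ℂ => (1 / 2 : ℝ) * ‖z‖ ^ 2) c R :=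
    ContinuousOn.circleIntegrable' (by fun_prop)
  have e : gefLog ζ = ((fun z => Real.log ‖gef ζ z‖) - fun z => (1 / 2 : ℝ) * ‖z‖ ^ 2) -
      fun _ => logMean / 2 := by
    ext z; simp [gefLog]; ring
  have h3 := Real.circleAverage_fun_smul (a := (1 / 2 : ℝ)) (f := fun z : ℂ => ‖z‖ ^ 2)
    (c := c) (R := R)
  simp only [smul_eq_mul] at h3
  rw [e, Real.circleAverage_sub ((h.circleIntegrable_log c R).sub h2)
    (circleIntegrable_const _ _ _),
    Real.circleAverage_sub (h.circleIntegrable_log c R) h2, h3, circleAverage_norm_sq,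
    Real.circleAverage_const]
  simp
  ring

theorem IsEntireSeq.centredStat_eq {ζ : ℕ → ℂ} (h : IsEntireSeq ζ) (s : Disk →₀ ℂ) :
    centredStat s ζ = s.sum fun i b => b *
      ((Real.circleAverage (gefLog ζ) i.1 i.2 - gefLog ζ i.1 : ℝ) : ℂ) := by
  rw [centredStat, integral_diskJump, diskFunctional]
  · refine Finsupp.sum_congr fun i _ => ?_
    rw [circleAverage_eq_integral, circleAverage_eq_integral, integral_complex_ofReal]
    push_cast; rfl
  · exact fun i => (circleIntegrable_iff_angleMeasure).2 (h.integrable_gefLog_circleMap i).ofReal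

/-- The linear statistic of a test function converges absolutely and is the sum of its centred part
and its mean. -/
theorem ae_hasSum_testFun (s : Disk →₀ ℂ) :
    ∀ᵐ ζ ∂coeffLaw, HasSum (fun a : gefZeros ζ => testFun s a) (centredStat s ζ + meanStat s) := by
  have hne : ∀ᵐ ζ ∂coeffLaw, ∀ i ∈ s.support, gef ζ i.1 ≠ 0 :=
    (Finset.eventually_all s.support).2 fun i _ => ae_gef_ne_zero i.1
  filter_upwards [hne, ae_isEntireSeq, ae_gefDeriv_ne_zero] with ζ h0 h hs
  have := hasSum_sum (s := s.support) (f := fun i (a : gefZeros ζ) => s i * (logBump i a : ℂ))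
    fun i hi => (Complex.hasSum_ofReal.2 (hasSum_logBump_gefZeros h hs i (h0 i hi))).mul_left (s i)
  rw [h.centredStat_eq, meanStat, Finsupp.sum, Finsupp.sum, ← Finset.sum_add_distrib]
  simp only [testFun, Finsupp.sum]
  convert this using 2 with i _
  rw [h.circleAverage_gefLog_sub, ← mul_add]
  congr 1
  push_cast; ring

theorem memLp_centredStat (s : Disk →₀ ℂ) : MemLp (centredStat s) 2 coeffLaw :=
  (integral_norm_sq_diskJump_gefLog s).1

theorem integral_centredStat (s : Disk →₀ ℂ) : ∫ ζ, centredStat s ζ ∂coeffLaw = 0 := by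
  have hi := (memLp_diskJump_gefLog s).2.integrable (by norm_num)
  simp only [centredStat]
  rw [integral_integral_swap (f := fun ζ θ => diskJump s (fun z => (gefLog ζ z : ℂ)) θ) hi]
  have h1 : ∀ z, Integrable (fun ζ => (gefLog ζ z : ℂ)) coeffLaw := fun z =>
    (memLp_gefLog_ofReal z).integrable (by norm_num)
  have h0 : ∀ θ, ∫ ζ, diskJump s (fun z => (gefLog ζ z : ℂ)) θ ∂coeffLaw = 0 := fun θ => by
    simp only [diskJump_eq_sum]
    rw [integral_finsetSum _ fun j _ => (h1 _).const_mul _]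
    refine Finset.sum_eq_zero fun j _ => ?_
    rw [integral_const_mul, integral_complex_ofReal, integral_gefLog]
    simp
  simp [h0]

/-- Multiplication of the Fourier transform of a test function by `-2π ‖w‖²` gives the values of
`diskFunctional s` at the characters. -/
theorem fourier_testFun (s : Disk →₀ ℂ) (w : ℂ) :
    -2 * π * ‖w‖ ^ 2 * 𝓕 (testFun s) w = diskFunctional s (planeWave w) := by
  have e : testFun s = fun z => ∑ i ∈ s.support, s i * (logBump i z : ℂ) := rfl
  have hi : ∀ i, Integrable fun z => planeWave w z * (s i * (logBump i z : ℂ)) := fun i => by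
    refine Integrable.bdd_mul (c := 1) ((integrable_logBump i).ofReal.const_mul (s i))
      (continuous_planeWave.comp (Continuous.prodMk_right w)).aestronglyMeasurable
      (ae_of_all _ fun z => (norm_planeWave w z).le)
  rw [fourier_eq_integral_planeWave, e]
  simp only [Finset.mul_sum]
  rw [integral_finsetSum _ fun i _ => hi i, diskFunctional, Finsupp.sum, Finset.mul_sum]
  refine Finset.sum_congr rfl fun i _ => ?_
  rw [← fourier_logBump, fourier_eq_integral_planeWave]
  have : ∀ z, planeWave w z * (s i * (logBump i z : ℂ)) = s i *
    (planeWave w z * (logBump i z : ℂ)) :=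
    fun z => by ring
  simp only [this]
  rw [integral_const_mul]
  ring

/-- The variance formula for test functions. -/
theorem integral_norm_sq_centredStat (s : Disk →₀ ℂ) :
    ∫ ζ, ‖centredStat s ζ‖ ^ 2 ∂coeffLaw = ∫ w, ‖𝓕 (testFun s) w‖ ^ 2 * varianceKernel w := by
  have h := (integral_norm_sq_diskJump_gefLog s).2
  rw [integral_logSpectralMeasure] at h
  refine h.trans ?_
  congr 1; ext w
  rw [← fourier_testFun, varianceKernel_eq]
  simp only [norm_mul, norm_neg, norm_pow, Complex.norm_real, Complex.norm_ofNat, norm_norm,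
    Real.norm_of_nonneg Real.pi_pos.le, smul_eq_mul]
  ring

/-! ### First moment bound for linear statistics -/

/-- `HasBumpCost g t`: the function `g` has a majorant of the form `∑ aⱼ logBump iⱼ` with mean
linear statistic at most `t`. -/
def HasBumpCost (g : ℂ → ℝ≥0∞) (t : ℝ≥0∞) : Prop :=
  ∃ (κ : Type) (_ : Countable κ) (a : κ → ℝ≥0∞) (i : κ → Disk),
    (∀ z, g z ≤ ∑' j, a j * ENNReal.ofReal (logBump (i j) z)) ∧
    ∑' j, a j * ENNReal.ofReal ((i j).2 ^ 2 / 2) ≤ t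

theorem HasBumpCost.tsum {α : Type} [Countable α] {g : α → ℂ → ℝ≥0∞} {t : α → ℝ≥0∞}
    (h : ∀ j, HasBumpCost (g j) (t j)) : HasBumpCost (fun z => ∑' j, g j z) (∑' j, t j) := by
  choose κ hκ a i h1 h2 using h
  refine ⟨Σ j, κ j, inferInstance, fun p => a p.1 p.2, fun p => i p.1 p.2, fun z => ?_, ?_⟩
  · rw [ENNReal.tsum_sigma' fun p : Σ j, κ j => a p.1 p.2 * ENNReal.ofReal (logBump (i p.1 p.2) z)]
    exact ENNReal.tsum_le_tsum fun j => h1 j z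
  · rw [ENNReal.tsum_sigma' fun p : Σ j, κ j => a p.1 p.2 * ENNReal.ofReal ((i p.1 p.2).2 ^ 2 / 2)]
    exact ENNReal.tsum_le_tsum fun j => h2 j

theorem HasBumpCost.mono {g g' : ℂ → ℝ≥0∞} {t t' : ℝ≥0∞} (h : HasBumpCost g t)
    (hg : ∀ z, g' z ≤ g z) (ht : t ≤ t') : HasBumpCost g' t' := by
  obtain ⟨κ, hκ, a, i, h1, h2⟩ := h
  exact ⟨κ, hκ, a, i, fun z => (hg z).trans (h1 z), h2.trans ht⟩

theorem HasBumpCost.const_mul {g : ℂ → ℝ≥0∞} {t : ℝ≥0∞} (h : HasBumpCost g t) (c : ℝ≥0∞) :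
    HasBumpCost (fun z => c * g z) (c * t) := by
  obtain ⟨κ, hκ, a, i, h1, h2⟩ := h
  refine ⟨κ, hκ, fun j => c * a j, i, fun z => ?_, ?_⟩
  · simp only [mul_assoc, ENNReal.tsum_mul_left]
    gcongr
    exact h1 z
  · simp only [mul_assoc, ENNReal.tsum_mul_left]
    gcongr

theorem one_le_two_mul_logBump {c z : ℂ} {R : ℝ} (hR : 0 < R) (hne : z ≠ c) (hz : ‖c - z‖ ≤ R) :
    1 ≤ 2 * ENNReal.ofReal (logBump (c, ⟨2 * R, by simp [hR]⟩) z) := by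
  have hpos : 0 < ‖c - z‖ := norm_pos_iff.2 (sub_ne_zero.2 hne.symm)
  rw [logBump_eq_log (by simp; linarith)]
  have h1 : Real.log 2 ≤ Real.log (2 * R * ‖c - z‖⁻¹) := by
    refine Real.log_le_log (by norm_num) ?_
    rw [← div_eq_mul_inv, le_div_iff₀ hpos]; linarith
  have h2 := Real.log_two_gt_d9
  rw [show (2 : ℝ≥0∞) = ENNReal.ofReal 2 by simp, ← ENNReal.ofReal_mul (by norm_num),
    ← ENNReal.ofReal_one]
  refine ENNReal.ofReal_le_ofReal ?_
  dsimp only at h1 ⊢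
  linarith

/-- A function `logBump` is bounded below on the disk of half its radius, except at its centre,
where it takes the junk value `0`; the centre is dealt with by a second function of the same
kind. -/
theorem hasBumpCost_closedBall (c : ℂ) {R : ℝ} (hR : 0 < R) :
    HasBumpCost ((Metric.closedBall c R).indicator 1) (4 * volume (Metric.closedBall c R)) := by
  refine ⟨Bool, inferInstance, fun _ => 2, fun b => (bif b then c else c + R,
    ⟨2 * R, by simp [hR]⟩),
    fun z => ?_, ?_⟩
  · simp only [tsum_fintype, Fintype.sum_bool, cond_true, cond_false]
    by_cases hz : z ∈ Metric.closedBall c R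
    swap
    · simp [hz]
    rw [Set.indicator_of_mem hz, Pi.one_apply]
    rcases eq_or_ne z c with rfl | hne
    · refine (one_le_two_mul_logBump (c := z + R) hR ?_ ?_).trans le_add_self
      · simpa using hR.ne'
      · simp [abs_of_pos hR]
    · refine (one_le_two_mul_logBump hR hne ?_).trans le_self_add
      rwa [← dist_eq_norm, dist_comm]
  · simp only [tsum_fintype, Fintype.sum_bool]
    rw [Complex.volume_closedBall, ← two_mul, ← mul_assoc]
    have hpi : ENNReal.ofReal 2 ≤ (NNReal.pi : ℝ≥0∞) := by
      rw [← ENNReal.ofReal_coe_nnreal]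
      exact ENNReal.ofReal_le_ofReal (by simpa using Real.two_le_pi)
    calc (2 * 2 : ℝ≥0∞) * ENNReal.ofReal ((2 * R) ^ 2 / 2)
        = 4 * (ENNReal.ofReal R ^ 2 * ENNReal.ofReal 2) := by
          rw [← ENNReal.ofReal_pow hR.le, ← ENNReal.ofReal_mul (by positivity)]
          norm_num
          congr 2; ring
      _ ≤ 4 * (ENNReal.ofReal R ^ 2 * (NNReal.pi : ℝ≥0∞)) := by gcongr
      _ = _ := by ring

/-- An arbitrary set is covered by countably many disks whose total area is close to its measure. -/
theorem hasBumpCost_indicator (s : Set ℂ) {ε : ℝ≥0∞} (hε : ε ≠ 0) :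
    HasBumpCost (s.indicator 1) (4 * volume s + ε) := by
  have hε4 : ε / 4 ≠ 0 := by simp [hε]
  obtain ⟨t, r, htc, -, hr, hcov, hsum⟩ := Besicovitch.exists_closedBall_covering_tsum_measure_le
    (volume : Measure ℂ) hε4 (fun _ => Set.Ioi 0) s
    (fun x _ δ hδ => ⟨δ / 2, by simp [hδ], by simp [hδ]⟩)
  have : Countable t := htc
  refine (HasBumpCost.tsum fun x : t => hasBumpCost_closedBall (x : ℂ) (hr x x.2)).mono
    (fun z => ?_) ?_
  · by_cases hz : z ∈ s
    swap
    · simp [hz]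
    obtain ⟨x, hx, hzx⟩ := Set.mem_iUnion₂.1 (hcov hz)
    rw [Set.indicator_of_mem hz, Pi.one_apply]
    refine le_trans ?_ (ENNReal.le_tsum ⟨x, hx⟩)
    simp [Set.indicator_of_mem hzx]
  · rw [ENNReal.tsum_mul_left]
    calc _ ≤ 4 * (volume s + ε / 4) := by gcongr
      _ = _ := by rw [mul_add, ENNReal.mul_div_cancel (by simp) (by simp)]

theorem hasBumpCost_const_mul_indicator (c : NNReal) (s : Set ℂ) {ε : ℝ≥0∞} (hε : ε ≠ 0) :
    HasBumpCost (fun z => c * s.indicator 1 z) (4 * (c * volume s) + ε) := by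
  rcases eq_or_ne c 0 with rfl | hc
  · exact ⟨Empty, inferInstance, Empty.rec, Empty.rec, fun z => by simp, by simp⟩
  have hc' : (c : ℝ≥0∞) ≠ 0 := by simpa using hc
  refine ((hasBumpCost_indicator s (ε := ε / c) (by simp [hε])).const_mul c).mono
    (fun z => le_rfl) ?_
  rw [mul_add, ENNReal.mul_div_cancel hc' (by simp), mul_left_comm]

theorem hasBumpCost_simpleFunc (f : SimpleFunc ℂ NNReal) {ε : ℝ≥0∞} (hε : ε ≠ 0) :
    HasBumpCost (fun z => ((f z : NNReal) : ℝ≥0∞)) (4 * (∫⁻ z, ((f z : NNReal) : ℝ≥0∞)) + ε) := by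
  obtain ⟨δ, hδ, hδε⟩ := ENNReal.exists_pos_sum_of_countable' hε f.range
  refine (HasBumpCost.tsum fun c : f.range =>
    hasBumpCost_const_mul_indicator (c : NNReal) (f ⁻¹' {(c : NNReal)}) (hδ c).ne').mono
    (fun z => ?_) ?_
  · refine le_trans ?_ (ENNReal.le_tsum ⟨f z, f.mem_range_self z⟩)
    simp
  · have h : ∫⁻ z, ((f z : NNReal) : ℝ≥0∞) =
        ∑' c : f.range, ((c : NNReal) : ℝ≥0∞) * volume (f ⁻¹' {(c : NNReal)}) := by
      rw [tsum_fintype, Finset.sum_coe_sort f.range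
        fun c => (c : ℝ≥0∞) * volume (f ⁻¹' {c}), ← SimpleFunc.map_lintegral,
        ← SimpleFunc.lintegral_eq_lintegral]
      simp
    rw [h, ENNReal.tsum_add, ENNReal.tsum_mul_left]
    gcongr

theorem hasBumpCost_of_measurable {g : ℂ → ℝ≥0∞} (hg : Measurable g) {ε : ℝ≥0∞} (hε : ε ≠ 0) :
    HasBumpCost g (4 * (∫⁻ z, g z) + ε) := by
  let e := SimpleFunc.eapproxDiff g
  obtain ⟨δ, hδ, hδε⟩ := ENNReal.exists_pos_sum_of_countable' hε ℕ
  have h1 : ∀ n, HasBumpCost (fun z => ((e n z : NNReal) : ℝ≥0∞))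
      (4 * (∫⁻ z, ((e n z : NNReal) : ℝ≥0∞)) + δ n) := fun n =>
    hasBumpCost_simpleFunc _ (hδ n).ne'
  refine (HasBumpCost.tsum h1).mono (fun z => ?_) ?_
  · rw [SimpleFunc.tsum_eapproxDiff g hg]
  · rw [ENNReal.tsum_add, ENNReal.tsum_mul_left, ← lintegral_tsum fun n => by fun_prop]
    simp only [e, SimpleFunc.tsum_eapproxDiff g hg]
    gcongr

/-- The bound for arbitrary functions, decomposed into a series of simple functions. -/
theorem hasBumpCost_of_aemeasurable {g : ℂ → ℝ≥0∞} (hg : AEMeasurable g) {ε : ℝ≥0∞} (hε : ε ≠ 0) :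
    HasBumpCost g (4 * (∫⁻ z, g z) + ε) := by
  -- the zeros may visit the null set where `g` differs from its measurable version, so the value
  -- `∞` is prescribed there
  let t := toMeasurable volume {z | g z ≠ hg.mk g z}
  have ht : volume t = 0 := by rw [measure_toMeasurable]; exact hg.ae_eq_mk
  have htm : MeasurableSet t := measurableSet_toMeasurable _ _
  have h := hasBumpCost_of_measurable (g := fun z => hg.mk g z + t.indicator (fun _ => ∞) z)
    (hg.measurable_mk.add (measurable_const.indicator htm)) hε
  refine h.mono (fun z => ?_) ?_
  · by_cases hz : z ∈ t
    · simp [hz]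
    · have : g z = hg.mk g z := by
        by_contra hne
        exact hz (subset_toMeasurable _ _ hne)
      simp [this]
  · rw [lintegral_add_left hg.measurable_mk, lintegral_indicator htm,
      lintegral_congr_ae hg.ae_eq_mk]
    simp [ht]

/-- The mean of the linear statistic of `logBump`, as a Lebesgue integral. -/
theorem lintegral_tsum_logBump (i : Disk) :
    AEMeasurable (fun ζ => ∑' a : gefZeros ζ, ENNReal.ofReal (logBump i a)) coeffLaw ∧
    ∫⁻ ζ, ∑' a : gefZeros ζ, ENNReal.ofReal (logBump i a) ∂coeffLaw =
      ENNReal.ofReal (i.2 ^ 2 / 2) := by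
  let V : (ℕ → ℂ) → ℝ := fun ζ => (centredStat (Finsupp.single i 1) ζ).re + i.2 ^ 2 / 2
  have hint := (memLp_centredStat (Finsupp.single i 1)).integrable (by norm_num)
  have hV : Integrable V coeffLaw := hint.re.add (integrable_const _)
  have hs : ∀ᵐ ζ ∂coeffLaw, HasSum (fun a : gefZeros ζ => logBump i a) (V ζ) := by
    filter_upwards [ae_hasSum_testFun (Finsupp.single i 1)] with ζ h
    have h' := Complex.hasSum_re h
    simpa [testFun, meanStat, V, ← Complex.ofReal_pow, ← Complex.ofReal_ofNat, ← Complex.ofReal_div]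
      using h'
  have he : (fun ζ => ∑' a : gefZeros ζ, ENNReal.ofReal (logBump i a)) =ᵐ[coeffLaw]
      fun ζ => ENNReal.ofReal (V ζ) := by
    filter_upwards [hs] with ζ h
    rw [← ENNReal.ofReal_tsum_of_nonneg (fun _ => logBump_nonneg _ _) h.summable, h.tsum_eq]
  have hV0 : 0 ≤ᵐ[coeffLaw] V := by
    filter_upwards [hs] with ζ h
    exact h.nonneg fun _ => logBump_nonneg _ _
  refine ⟨hV.aemeasurable.ennreal_ofReal.congr he.symm, ?_⟩
  rw [lintegral_congr_ae he, ← ofReal_integral_eq_lintegral_ofReal hV hV0]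
  have h0 : ∫ ζ, (centredStat (Finsupp.single i 1) ζ).re ∂coeffLaw = 0 := by
    have := integral_re hint
    simp only [RCLike.re_to_complex] at this
    rw [this, integral_centredStat]; simp
  have hre : Integrable (fun ζ => (centredStat (Finsupp.single i 1) ζ).re) coeffLaw := hint.re
  simp only [V]
  rw [integral_add hre (integrable_const _)]
  simp [h0]

/-- First moment bound for linear statistics. The majorant `Y` is measurable, while the
linear statistic of an arbitrary `g` need not be. -/
theorem exists_linearStat_majorant {g : ℂ → ℝ≥0∞} (hg : AEMeasurable g) {ε : ℝ≥0∞} (hε : ε ≠ 0) :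
    ∃ Y : (ℕ → ℂ) → ℝ≥0∞, AEMeasurable Y coeffLaw ∧ (∀ ζ, ∑' a : gefZeros ζ, g a ≤ Y ζ) ∧
      ∫⁻ ζ, Y ζ ∂coeffLaw ≤ 4 * (∫⁻ z, g z) + ε := by
  obtain ⟨κ, hκ, a, i, h1, h2⟩ := hasBumpCost_of_aemeasurable hg hε
  have hm : ∀ j, AEMeasurable (fun ζ => a j * ∑' x : gefZeros ζ, ENNReal.ofReal (logBump (i j) x))
      coeffLaw := fun j => (lintegral_tsum_logBump (i j)).1.const_mul _
  refine ⟨fun ζ => ∑' j, a j * ∑' x : gefZeros ζ, ENNReal.ofReal (logBump (i j) x),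
    AEMeasurable.tsum hm, fun ζ => ?_, ?_⟩
  · simp only [← ENNReal.tsum_mul_left]
    rw [ENNReal.tsum_comm]
    exact ENNReal.tsum_le_tsum fun x => h1 x
  · rw [lintegral_tsum hm]
    refine le_trans (le_of_eq (tsum_congr fun j => ?_)) h2
    rw [lintegral_const_mul'' _ (lintegral_tsum_logBump (i j)).1, (lintegral_tsum_logBump (i j)).2]

/-! ### Density of test functions -/

/-- The norm of `L¹ ∩ L²`. -/
def jointNorm (f : ℂ → ℂ) : ℝ≥0∞ := eLpNorm f 1 volume + eLpNorm f 2 volume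

theorem jointNorm_add_le {f g : ℂ → ℂ} (hf : AEStronglyMeasurable f volume)
    (hg : AEStronglyMeasurable g volume) : jointNorm (f + g) ≤ jointNorm f + jointNorm g := by
  unfold jointNorm
  refine (add_le_add (eLpNorm_add_le hf hg le_rfl) (eLpNorm_add_le hf hg (by norm_num))).trans ?_
  rw [add_add_add_comm]

theorem jointNorm_const_smul (c : ℂ) (f : ℂ → ℂ) : jointNorm (c • f) = ‖c‖ₑ * jointNorm f := by
  simp [jointNorm, eLpNorm_const_smul, mul_add]

theorem jointNorm_congr_ae {f g : ℂ → ℂ} (h : f =ᵐ[volume] g) : jointNorm f = jointNorm g := by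
  simp [jointNorm, eLpNorm_congr_ae h]

theorem indicator_one_nonneg {α : Type*} (E : Set α) (z : α) : (0 : ℝ) ≤ E.indicator 1 z :=
  Set.indicator_nonneg (fun _ _ => zero_le_one) z

theorem jointNorm_le_of_indicator {f : ℂ → ℂ} {E : Set ℂ} (hE : MeasurableSet E)
    (h : ∀ z, ‖f z‖ ≤ E.indicator 1 z) : jointNorm f ≤ volume E + volume E ^ (1 / 2 : ℝ) := by
  have h' : ∀ z, ‖f z‖ ≤ ‖E.indicator (fun _ => (1 : ℝ)) z‖ := fun z =>
    (h z).trans (le_of_eq (by by_cases hz : z ∈ E <;> simp [hz]))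
  refine add_le_add ((eLpNorm_mono h').trans ?_) ((eLpNorm_mono h').trans ?_)
  · rw [eLpNorm_indicator_const hE (by simp) (by simp)]
    simp
  · rw [eLpNorm_indicator_const hE (by simp) (by simp)]
    simp

theorem exists_add_sqrt_le {ε : ℝ≥0∞} (hε : ε ≠ 0) :
    ∃ η : ℝ≥0∞, η ≠ 0 ∧ ∀ x ≤ η, x + x ^ (1 / 2 : ℝ) ≤ ε := by
  have hc : Tendsto (fun x : ℝ≥0∞ => x + x ^ (1 / 2 : ℝ)) (𝓝 0) (𝓝 0) := by
    have : Continuous fun x : ℝ≥0∞ => x + x ^ (1 / 2 : ℝ) := by fun_prop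
    simpa using this.tendsto 0
  have := ENNReal.nhds_zero_basis_Iic.eventually_iff.1
    (hc.eventually (ge_mem_nhds (pos_iff_ne_zero.2 hε)))
  obtain ⟨η, h0, h⟩ := this
  exact ⟨η, h0.ne', fun x hx => h hx⟩

theorem testFun_zero : testFun 0 = 0 := by ext z; simp [testFun]

theorem testFun_add (s t : Disk →₀ ℂ) : testFun (s + t) = testFun s + testFun t := by
  ext z
  exact Finsupp.sum_add_index' (by simp) (by intros; ring)

theorem testFun_smul (c : ℂ) (s : Disk →₀ ℂ) : testFun (c • s) = c • testFun s := by
  ext z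
  simp only [testFun, Pi.smul_apply, smul_eq_mul]
  rw [Finsupp.sum_smul_index (by simp), Finsupp.mul_sum]
  simp [mul_assoc]

theorem testFun_sub (s t : Disk →₀ ℂ) : testFun (s - t) = testFun s - testFun t := by
  rw [sub_eq_add_neg, ← neg_one_smul ℂ t, testFun_add, testFun_smul]
  simp [sub_eq_add_neg]

theorem testFun_single (i : Disk) (b : ℂ) (z : ℂ) :
    testFun (Finsupp.single i b) z = b * (logBump i z : ℂ) := by simp [testFun]

theorem memLp_one_testFun (s : Disk →₀ ℂ) : MemLp (testFun s) 1 volume :=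
  memLp_finsetSum _ fun i _ =>
    (memLp_one_iff_integrable.2 (integrable_logBump i).ofReal).const_mul (s i)

theorem memLp_two_testFun (s : Disk →₀ ℂ) : MemLp (testFun s) 2 volume :=
  memLp_finsetSum _ fun i _ => (memLp_two_logBump i).ofReal.const_mul (s i)

/-- Functions in the closure of the test functions for the norm of `L¹ ∩ L²`. -/
def IsTestLimit (f : ℂ → ℂ) : Prop :=
  AEStronglyMeasurable f volume ∧ ∀ ε : ℝ≥0∞, ε ≠ 0 → ∃ s, jointNorm (f - testFun s) ≤ ε

namespace IsTestLimit

theorem add {f g : ℂ → ℂ} (hf : IsTestLimit f) (hg : IsTestLimit g) : IsTestLimit (f + g) := by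
  refine ⟨hf.1.add hg.1, fun ε hε => ?_⟩
  obtain ⟨s, hs⟩ := hf.2 (ε / 2) (by simp [hε])
  obtain ⟨t, ht⟩ := hg.2 (ε / 2) (by simp [hε])
  refine ⟨s + t, ?_⟩
  rw [testFun_add, add_sub_add_comm, ← ENNReal.add_halves ε]
  exact (jointNorm_add_le (hf.1.sub (memLp_one_testFun s).1)
    (hg.1.sub (memLp_one_testFun t).1)).trans (add_le_add hs ht)

theorem zero : IsTestLimit 0 :=
  ⟨aestronglyMeasurable_zero, fun ε _ => ⟨0, by simp [testFun_zero, jointNorm]⟩⟩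

theorem const_smul {f : ℂ → ℂ} (hf : IsTestLimit f) (c : ℂ) : IsTestLimit (c • f) := by
  rcases eq_or_ne c 0 with rfl | hc
  · rw [zero_smul]; exact zero
  refine ⟨hf.1.const_smul c, fun ε hε => ?_⟩
  obtain ⟨s, hs⟩ := hf.2 (ε / ‖c‖ₑ) (by simp [hε])
  refine ⟨c • s, ?_⟩
  rw [testFun_smul, ← smul_sub, jointNorm_const_smul]
  exact (mul_le_mul_right hs _).trans (le_of_eq (ENNReal.mul_div_cancel (by simpa) (by simp)))

theorem sum {κ : Type*} {f : κ → ℂ → ℂ} (F : Finset κ) (h : ∀ j ∈ F, IsTestLimit (f j)) :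
    IsTestLimit (∑ j ∈ F, f j) := by
  classical
  induction F using Finset.induction_on with
  | empty => simpa using zero
  | insert j F hj ih =>
    rw [Finset.sum_insert hj]
    exact (h j (by simp)).add (ih fun k hk => h k (by simp [hk]))

theorem of_limit {f : ℂ → ℂ} (hf : AEStronglyMeasurable f volume)
    (h : ∀ ε : ℝ≥0∞, ε ≠ 0 → ∃ g, IsTestLimit g ∧ jointNorm (f - g) ≤ ε) : IsTestLimit f := by
  refine ⟨hf, fun ε hε => ?_⟩
  obtain ⟨g, hg, hfg⟩ := h (ε / 2) (by simp [hε])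
  obtain ⟨s, hs⟩ := hg.2 (ε / 2) (by simp [hε])
  refine ⟨s, ?_⟩
  rw [← sub_add_sub_cancel f g, ← ENNReal.add_halves ε]
  exact (jointNorm_add_le (hf.sub hg.1) (hg.1.sub (memLp_one_testFun s).1)).trans
    (add_le_add hfg hs)

end IsTestLimit

/-- The indicator function of a disk is the limit of the truncated logarithmic potentials
`(logBump (c, R') - logBump (c, R)) / log (R' / R)` as `R'` decreases to `R`. -/
theorem isTestLimit_closedBall (c : ℂ) {R : ℝ} (hR : 0 < R) :
    IsTestLimit ((Metric.closedBall c R).indicator 1) := by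
  refine ⟨(measurable_const.indicator measurableSet_closedBall).aestronglyMeasurable,
    fun ε hε => ?_⟩
  obtain ⟨η, hη, hηε⟩ := exists_add_sqrt_le hε
  -- the annulus between the circles of radii `R` and `R'` has small area
  have hlim : Tendsto (fun R' : ℝ => ENNReal.ofReal (R' ^ 2 - R ^ 2) * NNReal.pi)
      (𝓝[>] R) (𝓝 0) := by
    have : Continuous fun R' : ℝ => ENNReal.ofReal (R' ^ 2 - R ^ 2) * NNReal.pi :=
      ENNReal.continuous_mul_const (by simp) |>.comp (ENNReal.continuous_ofReal.comp (by fun_prop))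
    simpa using (this.tendsto R).mono_left nhdsWithin_le_nhds
  obtain ⟨R', hvol, hR'⟩ := ((hlim.eventually (ge_mem_nhds (pos_iff_ne_zero.2 hη))).and
    (eventually_mem_nhdsWithin (a := R) (s := Set.Ioi R))).exists
  have hRR : R < R' := hR'
  have hR'0 : 0 < R' := hR.trans hRR
  have hL : 0 < Real.log (R' / R) := Real.log_pos ((one_lt_div hR).2 hRR)
  set L := Real.log (R' / R) with hLdef
  -- the exceptional set contains `c`, where `logBump` takes the junk value `0`
  let E : Set ℂ := (Metric.closedBall c R' \ Metric.closedBall c R) ∪ {c}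
  have hE : MeasurableSet E := (measurableSet_closedBall.diff measurableSet_closedBall).union
    (measurableSet_singleton c)
  have hvolE : volume E ≤ η := by
    refine (measure_union_le _ _).trans ?_
    rw [measure_singleton, add_zero, measure_sdiff (Metric.closedBall_subset_closedBall hRR.le)
      measurableSet_closedBall.nullMeasurableSet measure_closedBall_lt_top.ne,
      Complex.volume_closedBall, Complex.volume_closedBall, ← ENNReal.sub_mul (by simp),
      ← ENNReal.ofReal_pow hR'0.le, ← ENNReal.ofReal_pow hR.le,
        ← ENNReal.ofReal_sub _ (by positivity)]
    exact hvol
  refine ⟨Finsupp.single (c, ⟨R', hR'0⟩) (L⁻¹ : ℂ) - Finsupp.single (c, ⟨R, hR⟩) (L⁻¹ : ℂ),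
    (jointNorm_le_of_indicator hE fun z => ?_).trans (hηε _ hvolE)⟩
  rw [testFun_sub, Pi.sub_apply, Pi.sub_apply, testFun_single, testFun_single, ← mul_sub]
  rcases eq_or_ne z c with rfl | hne
  · have hzE : z ∈ E := Or.inr rfl
    simp [logBump, hzE, hR.le]
  have hd : 0 < ‖c - z‖ := norm_pos_iff.2 (sub_ne_zero.2 hne.symm)
  have hball : ∀ r, z ∈ Metric.closedBall c r ↔ ‖c - z‖ ≤ r := fun r => by
    rw [Metric.mem_closedBall, dist_comm, dist_eq_norm]
  rcases le_or_gt ‖c - z‖ R with h1 | h1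
  · rw [logBump_eq_log (i := (c, ⟨R', hR'0⟩)) (h1.trans hRR.le),
      logBump_eq_log (i := (c, ⟨R, hR⟩)) h1, Set.indicator_of_mem ((hball R).2 h1)]
    dsimp only
    rw [← Complex.ofReal_sub, Real.log_mul hR'0.ne' (by positivity),
      Real.log_mul hR.ne' (by positivity), add_sub_add_right_eq_sub,
      ← Real.log_div hR'0.ne' hR.ne', ← hLdef, inv_mul_cancel₀ (by exact_mod_cast hL.ne')]
    simpa using indicator_one_nonneg E z
  · rw [logBump_eq_zero (i := (c, ⟨R, hR⟩)) h1.le, Set.indicator_of_notMem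
      (by rw [hball]; exact not_le.2 h1)]
    rcases le_or_gt ‖c - z‖ R' with h2 | h2
    · have hzE : z ∈ E := Or.inl ⟨(hball _).2 h2, fun h => not_le.2 h1 ((hball _).1 h)⟩
      rw [Set.indicator_of_mem hzE]
      have h3 : logBump (c, ⟨R', hR'0⟩) z ≤ L := by
        rw [logBump_eq_log h2, hLdef]
        refine Real.log_le_log (by positivity) ?_
        rw [div_eq_mul_inv]
        exact mul_le_mul_of_nonneg_left (inv_anti₀ hR h1.le) hR'0.le
      simp only [Complex.ofReal_zero, sub_zero, zero_sub, norm_neg, norm_mul, norm_inv,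
        Complex.norm_real, Real.norm_of_nonneg hL.le, Real.norm_of_nonneg (logBump_nonneg _ _),
        Pi.one_apply]
      rw [← div_eq_inv_mul]
      exact (div_le_one hL).2 h3
    · rw [logBump_eq_zero (i := (c, ⟨R', hR'0⟩)) h2.le]
      simpa using indicator_one_nonneg E z

/-- By the covering theorem of Besicovitch, a set of finite measure is, up to small measure, a
finite disjoint union of disks. -/
theorem isTestLimit_indicator {A : Set ℂ} (hA : MeasurableSet A) (hfin : volume A ≠ ∞) :
    IsTestLimit (A.indicator 1) := by
  refine IsTestLimit.of_limit (measurable_const.indicator hA).aestronglyMeasurable fun ε hε => ?_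
  obtain ⟨η, hη, hηε⟩ := exists_add_sqrt_le hε
  have hη2 : η / 2 ≠ 0 := by simp [hη]
  obtain ⟨U, hAU, hUo, hUfin, hU⟩ := hA.exists_isOpen_sdiff_lt hfin hη2
  have hrad : ∀ x ∈ A, ∀ δ > 0, ({r | Metric.closedBall x r ⊆ U} ∩ Set.Ioo 0 δ).Nonempty :=
    fun x hx δ hδ => by
    obtain ⟨r, hr, hrU⟩ := Metric.nhds_basis_closedBall.mem_iff.1 (hUo.mem_nhds (hAU hx))
    refine ⟨min r (δ / 2), (Metric.closedBall_subset_closedBall (min_le_left _ _)).trans hrU,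
      by positivity, (min_le_right _ _).trans_lt (by linarith)⟩
  obtain ⟨t, r, htc, -, hr, hcov, hdisj⟩ := Besicovitch.exists_disjoint_closedBall_covering_ae
    (volume : Measure ℂ) _ A hrad (fun _ => 1) (fun _ _ => one_pos)
  have : Countable t := htc
  let B : t → Set ℂ := fun x => Metric.closedBall x (r x)
  have hBm : ∀ x, MeasurableSet (B x) := fun x => measurableSet_closedBall
  have hBd : Pairwise (Function.onFun Disjoint B) := fun x y hxy =>
    hdisj x.2 y.2 (fun h => hxy (Subtype.ext h))
  have hBU : ∀ x, B x ⊆ U := fun x => (hr x x.2).1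
  have hsum : ∑' x, volume (B x) ≠ ∞ := by
    rw [← measure_iUnion hBd hBm]
    exact ((measure_mono (Set.iUnion_subset hBU)).trans_lt hUfin).ne
  obtain ⟨F, hF⟩ := ((ENNReal.tendsto_tsum_compl_atTop_zero hsum).eventually
    (ge_mem_nhds (pos_iff_ne_zero.2 hη2))).exists
  let G : Set ℂ := ⋃ x ∈ F, B x
  have hGm : MeasurableSet G := F.measurableSet_biUnion fun x _ => hBm x
  -- the set where the indicator functions of `A` and of finitely many disjoint disks can differ
  let E : Set ℂ := (U \ A) ∪ (A \ G)
  have hE : MeasurableSet E := (hUo.measurableSet.diff hA).union (hA.diff hGm)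
  have hvolE : volume E ≤ η := by
    refine (measure_union_le _ _).trans ?_
    rw [← ENNReal.add_halves η]
    refine add_le_add hU.le ?_
    have hsub : A \ G ⊆ (A \ ⋃ x ∈ t, Metric.closedBall x (r x)) ∪ ⋃ x : {x // x ∉ F}, B x := by
      intro z hz
      by_cases hzt : z ∈ ⋃ x ∈ t, Metric.closedBall x (r x)
      · obtain ⟨x, hx, hzx⟩ := Set.mem_iUnion₂.1 hzt
        refine Or.inr (Set.mem_iUnion.2 ⟨⟨⟨x, hx⟩, fun hxF => hz.2 ?_⟩, hzx⟩)
        exact Set.mem_iUnion₂.2 ⟨⟨x, hx⟩, hxF, hzx⟩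
      · exact Or.inl ⟨hz.1, hzt⟩
    refine (measure_mono hsub).trans ((measure_union_le _ _).trans ?_)
    rw [hcov, zero_add]
    exact (measure_iUnion_le _).trans hF
  refine ⟨G.indicator 1, ?_, (jointNorm_le_of_indicator hE fun z => ?_).trans (hηε _ hvolE)⟩
  · have hG : G.indicator (1 : ℂ → ℂ) = ∑ x ∈ F, (B x).indicator 1 := by
      rw [Finset.indicator_biUnion F B (fun x _ y _ hxy => hBd hxy)]
      ext z; simp
    rw [hG]
    exact IsTestLimit.sum _ fun x _ => isTestLimit_closedBall _ (hr x x.2).2.1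
  · have hGU : z ∈ G → z ∈ U := fun h => by
      obtain ⟨x, _, hx⟩ := Set.mem_iUnion₂.1 h
      exact hBU x hx
    have hAU' : z ∈ A → z ∈ U := fun h => hAU h
    by_cases hzA : z ∈ A <;> by_cases hzG : z ∈ G
    · simpa [hzA, hzG] using indicator_one_nonneg E z
    · simp [hzA, hzG, E]
    · simp [hzA, hzG, E, hGU hzG]
    · simpa [hzA, hzG] using indicator_one_nonneg E z

theorem isTestLimit_simpleFunc (f : SimpleFunc ℂ ℂ) (hf : MemLp f 1 volume) : IsTestLimit f := by
  have e : (f : ℂ → ℂ) = ∑ c ∈ f.range, c • (f ⁻¹' {c}).indicator 1 := by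
    ext z
    simp only [Finset.sum_apply, Pi.smul_apply, smul_eq_mul]
    rw [Finset.sum_eq_single (f z)]
    · simp
    · intro c _ hc
      simp [hc.symm]
    · intro h; exact absurd (f.mem_range_self z) h
  rw [e]
  refine IsTestLimit.sum _ fun c _ => ?_
  rcases eq_or_ne c 0 with rfl | hc
  · rw [zero_smul]; exact IsTestLimit.zero
  exact (isTestLimit_indicator (f.measurableSet_fiber c)
    (SimpleFunc.measure_preimage_lt_top_of_memLp (by simp) (by simp) f hf c hc).ne).const_smul c

/-- The test functions are dense in `L¹ ∩ L²`. -/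
theorem isTestLimit_of_memLp {f : ℂ → ℂ} (h1 : MemLp f 1 volume) (h2 : MemLp f 2 volume) :
    IsTestLimit f := by
  refine IsTestLimit.of_limit h1.1 fun ε hε => ?_
  let g := h1.1.mk f
  have hfg : f =ᵐ[volume] g := h1.1.ae_eq_mk
  have hg : Measurable g := h1.1.stronglyMeasurable_mk.measurable
  have hg1 : MemLp g 1 volume := (memLp_congr_ae hfg).1 h1
  have hg2 : MemLp g 2 volume := (memLp_congr_ae hfg).1 h2
  have t1 := SimpleFunc.tendsto_approxOn_range_Lp_eLpNorm (by simp) hg hg1.2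
  have t2 := SimpleFunc.tendsto_approxOn_range_Lp_eLpNorm (by simp) hg hg2.2
  have t := t1.add t2
  rw [add_zero] at t
  obtain ⟨n, hn⟩ := (t.eventually (ge_mem_nhds (pos_iff_ne_zero.2 hε))).exists
  refine ⟨_, isTestLimit_simpleFunc _ (SimpleFunc.memLp_approxOn_range hg hg1 n), ?_⟩
  rw [jointNorm_congr_ae (hfg.sub (ae_eq_refl _)), ← neg_sub, jointNorm, eLpNorm_neg, eLpNorm_neg]
  exact hn

/-! ### Plancherel's identity and the variance kernel -/

open scoped ContDiff in
/-- Plancherel's identity for the Fourier integral on `L¹ ∩ L²`: the Fourier integral agrees with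
the Fourier transform of `L²`, as both represent the Fourier transform of the same tempered
distribution. -/
theorem eLpNorm_fourier {f : ℂ → ℂ} (h1 : MemLp f 1 volume) (h2 : MemLp f 2 volume) :
    eLpNorm (𝓕 f) 2 volume = eLpNorm f 2 volume := by
  have hi : Integrable f := memLp_one_iff_integrable.1 h1
  have hcont : Continuous (𝓕 f) := VectorFourier.fourierIntegral_continuous
    Real.continuous_fourierChar (L := innerₗ ℂ) continuous_inner hi
  let g : Lp ℂ 2 (volume : Measure ℂ) := h2.toLp f
  have hae : ∀ᵐ w, 𝓕 f w = (𝓕 g : Lp ℂ 2 (volume : Measure ℂ)) w := by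
    refine ae_eq_of_integral_contDiff_smul_eq hcont.locallyIntegrable
      ((Lp.memLp _).locallyIntegrable (by norm_num)) fun φ hφ hφc => ?_
    have c1 : HasCompactSupport (Complex.ofRealCLM ∘ φ) := hφc.comp_left rfl
    have c2 : ContDiff ℝ ∞ (Complex.ofRealCLM ∘ φ) := by fun_prop
    let ψ := c1.toSchwartzMap c2
    have e1 := congrArg (fun T => T ψ) (Lp.fourier_toTemperedDistribution_eq g)
    simp only [TemperedDistribution.fourier_apply, Lp.toTemperedDistribution_apply] at e1
    have e2 : ∫ x, (𝓕 ψ) x • g x = ∫ x, 𝓕 (ψ : ℂ → ℂ) x • f x := by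
      refine integral_congr_ae ?_
      filter_upwards [h2.coeFn_toLp] with x hx
      rw [hx]; rfl
    have e3 : ∫ w, 𝓕 (ψ : ℂ → ℂ) w • f w = ∫ w, (ψ : ℂ → ℂ) w • 𝓕 f w := by
      simpa using! VectorFourier.integral_fourierIntegral_smul_eq_flip (L := innerₗ ℂ)
        Real.continuous_fourierChar continuous_inner ψ.integrable hi
    rw [e2, e3] at e1
    simpa [ψ] using e1
  rw [eLpNorm_congr_ae hae]
  have h3 := Lp.norm_fourier_eq g
  rw [Lp.norm_def, Lp.norm_def, ENNReal.toReal_eq_toReal_iff' (Lp.eLpNorm_ne_top _)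
    (Lp.eLpNorm_ne_top _)] at h3
  rw [h3]
  exact eLpNorm_congr_ae h2.coeFn_toLp

theorem varianceKernel_nonneg (w : ℂ) : 0 ≤ varianceKernel w := by
  rw [varianceKernel_eq]
  exact mul_nonneg (by positivity) (logSpectralDensity_nonneg w)

theorem measurable_varianceKernel : Measurable varianceKernel := by
  have : varianceKernel = fun w => (2 * π * ‖w‖ ^ 2) ^ 2 * logSpectralDensity w :=
    funext varianceKernel_eq
  rw [this]
  have := measurable_logSpectralDensity
  fun_prop

theorem cube_div_six_le_exp {t : ℝ} (ht : 0 ≤ t) : (1 + t) ^ 3 / 6 ≤ Real.exp t := by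
  have h := Real.sum_le_exp_of_nonneg ht 4
  simp [Finset.sum_range_succ, Nat.factorial] at h
  nlinarith [pow_nonneg ht 2, pow_nonneg ht 3]

/-- A term of the series for the variance kernel, with `x = π² ‖w‖²`, is bounded by a difference of
consecutive terms of a null sequence, by means of `exp (-t) ≤ 6 / (1 + t)³`. -/
theorem sq_mul_exp_neg_div_le {x a : ℝ} (hx : 0 < x) (ha : 0 ≤ a) :
    x ^ 2 * (1 / (a + 1) ^ 3 * Real.exp (-(x / (a + 1)))) ≤
      6 * x * (1 / (a + x) - 1 / (a + 1 + x)) := by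
  have h1 := cube_div_six_le_exp (t := x / (a + 1)) (by positivity)
  have h2 : Real.exp (-(x / (a + 1))) ≤ 6 * (a + 1) ^ 3 / (a + 1 + x) ^ 3 := by
    rw [Real.exp_neg]
    refine (inv_anti₀ (by positivity) h1).trans (le_of_eq ?_)
    field_simp
  have h3 : 6 * x * (1 / (a + x) - 1 / (a + 1 + x)) = 6 * x / ((a + x) * (a + 1 + x)) := by
    field_simp; ring
  rw [h3]
  calc _ ≤ x ^ 2 * (1 / (a + 1) ^ 3 * (6 * (a + 1) ^ 3 / (a + 1 + x) ^ 3)) := by gcongr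
    _ = 6 * x * x / (a + 1 + x) ^ 3 := by field_simp
    _ ≤ _ := by
      rw [div_le_div_iff₀ (by positivity) (by positivity)]
      have : x * (a + x) ≤ (a + 1 + x) * (a + 1 + x) := by nlinarith
      calc 6 * x * x * ((a + x) * (a + 1 + x)) = 6 * x * (a + 1 + x) * (x * (a + x)) := by ring
        _ ≤ 6 * x * (a + 1 + x) * ((a + 1 + x) * (a + 1 + x)) := by gcongr
        _ = _ := by ring

/-- The variance kernel is bounded: its series is dominated by a telescoping one. -/
theorem varianceKernel_le (w : ℂ) : varianceKernel w ≤ 2 := by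
  rcases eq_or_ne w 0 with rfl | hw
  · simp [varianceKernel]
  let x : ℝ := π ^ 2 * ‖w‖ ^ 2
  have hx : 0 < x := by have := norm_pos_iff.2 hw; positivity
  have e : varianceKernel w = 1 / π * ∑' n : ℕ,
      x ^ 2 * (1 / ((n : ℝ) + 1) ^ 3 * Real.exp (-(x / ((n : ℝ) + 1)))) := by
    rw [varianceKernel_eq, logSpectralDensity, tsum_mul_left]
    have : ∀ n : ℕ, -(π ^ 2 / ((n : ℝ) + 1)) * ‖w‖ ^ 2 = -(x / ((n : ℝ) + 1)) := fun n => by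
      simp only [x]; ring
    simp only [this]
    simp only [x]
    field_simp
    ring
  rw [e]
  have hb : ∑' n : ℕ, x ^ 2 * (1 / ((n : ℝ) + 1) ^ 3 * Real.exp (-(x / ((n : ℝ) + 1)))) ≤ 6 := by
    refine Real.tsum_le_of_sum_range_le (fun n => by positivity) fun N => ?_
    refine (Finset.sum_le_sum fun n _ => sq_mul_exp_neg_div_le hx (Nat.cast_nonneg n)).trans ?_
    rw [← Finset.mul_sum]
    have := Finset.sum_range_sub' (fun n : ℕ => 1 / ((n : ℝ) + x)) N
    push_cast at this
    rw [this]
    have h0 : 0 ≤ 1 / ((N : ℝ) + x) := by positivity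
    calc 6 * x * (1 / (0 + x) - 1 / ((N : ℝ) + x)) ≤ 6 * x * (1 / (0 + x)) := by
          gcongr; linarith
      _ = 6 := by rw [zero_add]; field_simp
  have := Real.pi_gt_three
  calc _ ≤ 1 / π * 6 := by gcongr
    _ ≤ 2 := by rw [one_div_mul_eq_div, div_le_iff₀ Real.pi_pos]; linarith

/-! ### The variance of linear statistics -/

theorem integral_norm_sq_eq_eLpNorm_sq {α : Type*} [MeasurableSpace α] {μ : Measure α}
    {f : α → ℂ} (hf : MemLp f 2 μ) : ∫ x, ‖f x‖ ^ 2 ∂μ = (eLpNorm f 2 μ).toReal ^ 2 := by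
  have h0 : 0 ≤ ∫ x, ‖f x‖ ^ 2 ∂μ := integral_nonneg fun _ => by positivity
  rw [hf.eLpNorm_eq_integral_rpow_norm (by simp) (by simp)]
  simp only [ENNReal.toReal_ofNat, Real.rpow_ofNat]
  rw [ENNReal.toReal_ofReal (by positivity), ← Real.rpow_natCast, ← Real.rpow_mul h0]
  simp

/-- The measure with density `varianceKernel`. -/
def varianceMeasure : Measure ℂ := volume.withDensity fun w => ENNReal.ofReal (varianceKernel w)

theorem eLpNorm_varianceMeasure_le (f : ℂ → ℂ) :
    eLpNorm f 2 varianceMeasure ≤ 2 * eLpNorm f 2 volume := by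
  have h1 : varianceMeasure ≤ (2 : ℝ≥0∞) • volume := by
    rw [varianceMeasure, ← withDensity_const]
    refine withDensity_mono (ae_of_all _ fun w => ?_)
    exact ENNReal.ofReal_le_of_le_toReal (by simpa using varianceKernel_le w)
  refine (eLpNorm_mono_measure f h1).trans ?_
  rw [eLpNorm_smul_measure_of_ne_top (by simp), smul_eq_mul]
  gcongr
  have h2 : (1 / (2 : ℝ≥0∞)).toReal ≤ 1 := by simp; norm_num
  exact (ENNReal.rpow_le_rpow_of_exponent_le (by norm_num) h2).trans_eq (ENNReal.rpow_one 2)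

theorem continuous_fourier {f : ℂ → ℂ} (h1 : MemLp f 1 volume) : Continuous (𝓕 f) :=
  VectorFourier.fourierIntegral_continuous
    Real.continuous_fourierChar (L := innerₗ ℂ) continuous_inner (memLp_one_iff_integrable.1 h1)

/-- Continuity of the right-hand side of the variance formula with respect to the norm of `L²`. -/
theorem eLpNorm_fourier_varianceMeasure_le {f : ℂ → ℂ} (h1 : MemLp f 1 volume)
    (h2 : MemLp f 2 volume) : eLpNorm (𝓕 f) 2 varianceMeasure ≤ 2 * eLpNorm f 2 volume :=
  (eLpNorm_varianceMeasure_le _).trans_eq (by rw [eLpNorm_fourier h1 h2])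

theorem memLp_fourier_varianceMeasure {f : ℂ → ℂ} (h1 : MemLp f 1 volume)
    (h2 : MemLp f 2 volume) : MemLp (𝓕 f) 2 varianceMeasure :=
  ⟨(continuous_fourier h1).aestronglyMeasurable,
    (eLpNorm_fourier_varianceMeasure_le h1 h2).trans_lt (ENNReal.mul_lt_top (by simp) h2.2)⟩

theorem integral_varianceMeasure (f : ℂ → ℝ) :
    ∫ w, f w ∂varianceMeasure = ∫ w, f w * varianceKernel w := by
  rw [varianceMeasure, integral_withDensity_eq_integral_toReal_smul
    measurable_varianceKernel.ennreal_ofReal (by simp)]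
  simp_rw [ENNReal.toReal_ofReal (varianceKernel_nonneg _), smul_eq_mul, mul_comm]

theorem fourier_sub {f g : ℂ → ℂ} (hf : MemLp f 1 volume) (hg : MemLp g 1 volume) :
    𝓕 (f - g) = 𝓕 f - 𝓕 g := by
  have hi : ∀ {u : ℂ → ℂ} (_ : MemLp u 1 volume) (w : ℂ),
      Integrable fun z => planeWave w z * u z := fun {u} hu w =>
    Integrable.bdd_mul (c := 1) (memLp_one_iff_integrable.1 hu)
      (continuous_planeWave.comp (Continuous.prodMk_right w)).aestronglyMeasurable
      (ae_of_all _ fun z => (norm_planeWave w z).le)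
  ext w
  simp only [Pi.sub_apply, fourier_eq_integral_planeWave, mul_sub]
  exact integral_sub (hi hf w) (hi hg w)

/-- The variance of the linear statistic of a test function, as an identity of norms. -/
theorem eLpNorm_centredStat (s : Disk →₀ ℂ) :
    eLpNorm (centredStat s) 2 coeffLaw = eLpNorm (𝓕 (testFun s)) 2 varianceMeasure := by
  have h1 := memLp_centredStat s
  have h2 := memLp_fourier_varianceMeasure (memLp_one_testFun s) (memLp_two_testFun s)
  have h := integral_norm_sq_centredStat s
  rw [← integral_varianceMeasure fun w => ‖𝓕 (testFun s) w‖ ^ 2, integral_norm_sq_eq_eLpNorm_sq h1,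
    integral_norm_sq_eq_eLpNorm_sq h2] at h
  refine (ENNReal.toReal_eq_toReal_iff' h1.2.ne h2.2.ne).1 ?_
  exact (pow_left_inj₀ ENNReal.toReal_nonneg ENNReal.toReal_nonneg two_ne_zero).1 h

theorem meanStat_sub (s t : Disk →₀ ℂ) : meanStat (s - t) = meanStat s - meanStat t := by
  exact Finsupp.sum_sub_index fun i b c => by ring

/-- Equality holds almost surely only, as `diskJump` need not be integrable over the angles for
exceptional coefficients. -/
theorem centredStat_sub (s t : Disk →₀ ℂ) :
    centredStat (s - t) =ᵐ[coeffLaw] centredStat s - centredStat t := by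
  filter_upwards [ae_hasSum_testFun s, ae_hasSum_testFun t,
    ae_hasSum_testFun (s - t)] with ζ hs ht hst
  rw [testFun_sub, meanStat_sub] at hst
  have := hst.unique (hs.sub ht)
  rw [Pi.sub_apply]
  linear_combination this

/-- Fatou's lemma for a Cauchy sequence in `L²` with an almost everywhere limit. -/
theorem memLp_two_of_tendsto {α : Type*} [MeasurableSpace α] {μ : Measure α} {f : ℕ → α → ℂ}
    {g : α → ℂ} (hf : ∀ k, MemLp (f k) 2 μ) (hg : ∀ᵐ x ∂μ, Tendsto (fun k => f k x) atTop (𝓝 (g x)))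
    {b : ℕ → ℝ≥0∞} (hb : Tendsto b atTop (𝓝 0)) (hbt : ∀ k, b k ≠ ∞)
    (hc : ∀ k l, eLpNorm (f k - f l) 2 μ ≤ b k + b l) :
    MemLp g 2 μ ∧ ∀ k, eLpNorm (f k - g) 2 μ ≤ b k := by
  have hgm : AEStronglyMeasurable g μ := aestronglyMeasurable_of_tendsto_ae _ (fun k => (hf k).1) hg
  have h1 : ∀ k, eLpNorm (f k - g) 2 μ ≤ b k := fun k => by
    have h2 := Lp.eLpNorm_lim_le_liminf_eLpNorm (p := 2) (f := fun l => f k - f l)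
      (fun l => (hf k).1.sub (hf l).1) (f k - g)
      (hg.mono fun x hx => by simpa using tendsto_const_nhds.sub hx)
    refine h2.trans ?_
    have h3 : Tendsto (fun l => b k + b l) atTop (𝓝 (b k)) := by
      simpa using (tendsto_const_nhds (x := b k)).add hb
    exact (liminf_le_liminf (Eventually.of_forall fun l => hc k l)).trans_eq h3.liminf_eq
  have h2 : MemLp (f 0 - g) 2 μ := ⟨(hf 0).1.sub hgm, (h1 0).trans_lt (hbt 0).lt_top⟩
  have h3 := (hf 0).sub h2
  rw [sub_sub_cancel] at h3
  exact ⟨h3, h1⟩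

/-- Two limits of the same sequence agree. -/
theorem eq_of_forall_le_add {A B : ℝ≥0∞} {a b : ℕ → ℝ≥0∞} (hb : Tendsto b atTop (𝓝 0))
    (h1 : ∀ k, A ≤ a k + b k) (h2 : ∀ k, a k ≤ A + b k) (h3 : ∀ k, B ≤ a k + b k)
    (h4 : ∀ k, a k ≤ B + b k) : A = B := by
  have key : ∀ {A B : ℝ≥0∞}, (∀ k, A ≤ a k + b k) → (∀ k, a k ≤ B + b k) → A ≤ B := by
    intro A B h h'
    have ht : Tendsto (fun k => B + b k + b k) atTop (𝓝 B) := by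
      simpa using ((tendsto_const_nhds (x := B)).add hb).add hb
    exact ge_of_tendsto' ht fun k => (h k).trans (add_le_add_left (h' k) _)
  exact le_antisymm (key h1 h4) (key h3 h2)

theorem eLpNorm_le_add_of_sub_le {α : Type*} [MeasurableSpace α] {μ : Measure α} {f g : α → ℂ}
    (hf : AEStronglyMeasurable f μ) (hg : AEStronglyMeasurable g μ) {b : ℝ≥0∞}
    (h : eLpNorm (f - g) 2 μ ≤ b) :
    eLpNorm g 2 μ ≤ eLpNorm f 2 μ + b ∧ eLpNorm f 2 μ ≤ eLpNorm g 2 μ + b := by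
  constructor
  · have := eLpNorm_sub_le (p := 2) hf (hf.sub hg) (by norm_num)
    rw [sub_sub_cancel] at this
    exact this.trans (by gcongr)
  · have := eLpNorm_add_le (p := 2) hg (hf.sub hg) (by norm_num)
    rw [add_sub_cancel] at this
    exact this.trans (by gcongr)

/-- An approximating sequence of test functions together with random bounds for the error of the
linear statistics, whose expectations are summable. -/
theorem exists_testFun_approximation {h : ℂ → ℂ} (h1 : MemLp h 1 volume) (h2 : MemLp h 2 volume) :
    ∃ (s : ℕ → Disk →₀ ℂ) (Y : ℕ → (ℕ → ℂ) → ℝ≥0∞),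
      (∀ k, jointNorm (h - testFun (s k)) ≤ 2⁻¹ ^ k) ∧ (∀ k, AEMeasurable (Y k) coeffLaw) ∧
      (∀ k ζ, ∑' a : gefZeros ζ, ‖h a - testFun (s k) a‖ₑ ≤ Y k ζ) ∧
      (∀ k, ∫⁻ ζ, Y k ζ ∂coeffLaw ≤ 5 * 2⁻¹ ^ k) := by
  have hδ : ∀ k : ℕ, (2⁻¹ : ℝ≥0∞) ^ k ≠ 0 := fun k => by simp
  have hlim := isTestLimit_of_memLp h1 h2
  choose s hs using fun k : ℕ => hlim.2 _ (hδ k)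
  have hg : ∀ k, AEMeasurable fun z => ‖h z - testFun (s k) z‖ₑ := fun k =>
    (h1.1.sub (memLp_one_testFun (s k)).1).enorm
  choose Y hY1 hY2 hY3 using fun k : ℕ => exists_linearStat_majorant (hg k) (hδ k)
  refine ⟨s, Y, hs, hY1, hY2, fun k => (hY3 k).trans ?_⟩
  have h3 : ∫⁻ z, ‖h z - testFun (s k) z‖ₑ ≤ 2⁻¹ ^ k := by
    refine le_trans (le_of_eq ?_) (le_self_add.trans (hs k))
    rw [eLpNorm_one_eq_lintegral_enorm]; rfl
  calc _ ≤ (4 : ℝ≥0∞) * 2⁻¹ ^ k + 2⁻¹ ^ k := by gcongr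
    _ = ((4 : ℝ≥0∞) + 1) * 2⁻¹ ^ k := by rw [add_mul, one_mul]
    _ = _ := by norm_num

/-- The variance formula for `r = 1` and the canonical sequence of coefficients. -/
theorem linearStat_variance {h : ℂ → ℂ} (h1 : MemLp h 1 volume) (h2 : MemLp h 2 volume) :
    (∀ᵐ ζ ∂coeffLaw, Summable fun a : gefZeros ζ => h a) ∧
    MemLp (fun ζ => ∑' a : gefZeros ζ, h a) 2 coeffLaw ∧
    complexVariance (fun ζ => ∑' a : gefZeros ζ, h a) coeffLaw =
      ∫ w, ‖𝓕 h w‖ ^ 2 * varianceKernel w := by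
  obtain ⟨s, Y, hs, hYm, hY, hYi⟩ := exists_testFun_approximation h1 h2
  have hδ0 : Tendsto (fun k : ℕ => (2⁻¹ : ℝ≥0∞) ^ k) atTop (𝓝 0) :=
    ENNReal.tendsto_pow_atTop_nhds_zero_of_lt_one (by simp)
  -- the errors `Y k` are summable, hence tend to zero almost surely
  have hYs : ∀ᵐ ζ ∂coeffLaw, ∑' k, Y k ζ < ∞ := by
    refine ae_lt_top' (AEMeasurable.tsum hYm) ?_
    rw [lintegral_tsum hYm]
    refine ((ENNReal.tsum_le_tsum hYi).trans_lt ?_).ne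
    rw [ENNReal.tsum_mul_left, ENNReal.tsum_geometric]
    exact ENNReal.mul_lt_top (by simp) (by simp)
  let X : (ℕ → ℂ) → ℂ := fun ζ => ∑' a : gefZeros ζ, h a
  let Xs : ℕ → (ℕ → ℂ) → ℂ := fun k ζ => centredStat (s k) ζ + meanStat (s k)
  have hXs : ∀ᵐ ζ ∂coeffLaw, ∀ k, HasSum (fun a : gefZeros ζ => testFun (s k) a) (Xs k ζ) :=
    ae_all_iff.2 fun k => ae_hasSum_testFun (s k)
  have hgood : ∀ᵐ ζ ∂coeffLaw, (Summable fun a : gefZeros ζ => h a) ∧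
      (∀ k, ‖Xs k ζ - X ζ‖ₑ ≤ Y k ζ) ∧ Tendsto (fun k => Xs k ζ) atTop (𝓝 (X ζ)) := by
    filter_upwards [hYs, hXs] with ζ hζ hX
    have hY0 : Tendsto (fun k => Y k ζ) atTop (𝓝 0) := ENNReal.tendsto_atTop_zero_of_tsum_ne_top
      hζ.ne
    have hd : ∀ k, Summable fun a : gefZeros ζ => h a - testFun (s k) a := fun k => by
      refine Summable.of_norm ?_
      have := ENNReal.summable_toReal
        ((hY k ζ).trans_lt ((ENNReal.le_tsum k).trans_lt hζ)).ne
      simpa using this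
    have hsum : Summable fun a : gefZeros ζ => h a := by
      simpa using (hd 0).add (hX 0).summable
    have hle : ∀ k, ‖Xs k ζ - X ζ‖ₑ ≤ Y k ζ := fun k => by
      refine le_trans ?_ (hY k ζ)
      rw [enorm_sub_rev, ← (hX k).tsum_eq, ← hsum.tsum_sub (hX k).summable]
      exact enorm_tsum_le_tsum_enorm
    refine ⟨hsum, hle, ?_⟩
    rw [tendsto_iff_edist_tendsto_0]
    refine tendsto_of_tendsto_of_tendsto_of_le_of_le tendsto_const_nhds hY0 (fun _ =>
      zero_le) fun k => ?_
    rw [edist_eq_enorm_sub]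
    exact hle k
  have hXsi : ∀ k, Integrable (Xs k) coeffLaw := fun k =>
    ((memLp_centredStat (s k)).integrable (by norm_num)).add (integrable_const _)
  have hXsm : ∀ k, ∫ ζ, Xs k ζ ∂coeffLaw = meanStat (s k) := fun k => by
    have hi := (memLp_centredStat (s k)).integrable (by norm_num)
    simp only [Xs]
    rw [integral_add hi (integrable_const _), integral_centredStat]
    simp
  have hXm : AEStronglyMeasurable X coeffLaw :=
    aestronglyMeasurable_of_tendsto_ae _ (fun k => (hXsi k).1) (hgood.mono fun ζ h => h.2.2)
  -- convergence of the means
  have hmean : Tendsto (fun k => meanStat (s k)) atTop (𝓝 (∫ ζ, X ζ ∂coeffLaw)) := by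
    simp only [← hXsm]
    refine tendsto_integral_of_L1 X hXm (Eventually.of_forall hXsi) ?_
    have h5 : Tendsto (fun k : ℕ => 5 * (2⁻¹ : ℝ≥0∞) ^ k) atTop (𝓝 0) := by
      simpa using ENNReal.Tendsto.const_mul hδ0 (Or.inr (by simp))
    refine tendsto_of_tendsto_of_tendsto_of_le_of_le tendsto_const_nhds h5 (fun _ =>
      zero_le) fun k => ?_
    exact (lintegral_mono_ae (hgood.mono fun ζ h => h.2.1 k)).trans (hYi k)
  set D := ∫ ζ, X ζ ∂coeffLaw with hD
  have hT : ∀ᵐ ζ ∂coeffLaw, Tendsto (fun k => centredStat (s k) ζ) atTop (𝓝 (X ζ - D)) := by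
    filter_upwards [hgood] with ζ hζ
    have := hζ.2.2.sub hmean
    simpa [Xs] using this
  have hb0 : Tendsto (fun k : ℕ => 2 * (2⁻¹ : ℝ≥0∞) ^ k) atTop (𝓝 0) := by
    simpa using ENNReal.Tendsto.const_mul hδ0 (Or.inr (by simp))
  have hs2 : ∀ k, eLpNorm (h - testFun (s k)) 2 volume ≤ 2⁻¹ ^ k := fun k =>
    le_add_self.trans (hs k)
  -- the variance formula for the test function `testFun (s k - s l)`
  have hcauchy : ∀ k l, eLpNorm (centredStat (s k) - centredStat (s l)) 2 coeffLaw ≤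
      2 * 2⁻¹ ^ k + 2 * 2⁻¹ ^ l := fun k l => by
    rw [← eLpNorm_congr_ae (centredStat_sub (s k) (s l)), eLpNorm_centredStat]
    refine (eLpNorm_fourier_varianceMeasure_le (memLp_one_testFun _) (memLp_two_testFun _)).trans ?_
    rw [← mul_add]
    gcongr
    rw [testFun_sub, ← sub_sub_sub_cancel_left _ _ h, add_comm]
    exact (eLpNorm_sub_le (h2.sub (memLp_two_testFun _)).1 (h2.sub (memLp_two_testFun _)).1
      (by norm_num)).trans (add_le_add (hs2 l) (hs2 k))
  -- by Plancherel, convergence in `L²` of the test functions carries over to both sides of the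
  -- variance formula
  obtain ⟨hXL, hXk⟩ := memLp_two_of_tendsto (g := fun ζ => X ζ - D) (fun k =>
    memLp_centredStat (s k))
    hT hb0 (fun k => ENNReal.mul_ne_top (by simp) (by simp)) hcauchy
  have hF := memLp_fourier_varianceMeasure h1 h2
  have hFs := fun k => memLp_fourier_varianceMeasure (memLp_one_testFun (s k))
    (memLp_two_testFun (s k))
  have hFk : ∀ k, eLpNorm (𝓕 h - 𝓕 (testFun (s k))) 2 varianceMeasure ≤ 2 * 2⁻¹ ^ k := fun k => by
    rw [← fourier_sub h1 (memLp_one_testFun _)]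
    refine (eLpNorm_fourier_varianceMeasure_le (h1.sub (memLp_one_testFun _))
      (h2.sub (memLp_two_testFun _))).trans ?_
    gcongr
    exact hs2 k
  have hnorm : eLpNorm (fun ζ => X ζ - D) 2 coeffLaw = eLpNorm (𝓕 h) 2 varianceMeasure := by
    have e1 := fun k => eLpNorm_le_add_of_sub_le (memLp_centredStat (s k)).1 hXL.1 (hXk k)
    have e2 := fun k => eLpNorm_le_add_of_sub_le hF.1 (hFs k).1 (hFk k)
    simp only [← eLpNorm_centredStat] at e2
    exact eq_of_forall_le_add hb0 (fun k => (e1 k).1) (fun k => (e1 k).2) (fun k => (e2 k).2)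
      fun k => (e2 k).1
  refine ⟨hgood.mono fun ζ h => h.1, ?_, ?_⟩
  · have e : (fun ζ => ∑' a : gefZeros ζ, h a) = (fun ζ => X ζ - D) + fun _ => D := by
      ext ζ; simp [X]
    rw [e]
    exact hXL.add (memLp_const D)
  · rw [complexVariance, ← integral_varianceMeasure fun w => ‖𝓕 h w‖ ^ 2,
      integral_norm_sq_eq_eLpNorm_sq hXL,
      integral_norm_sq_eq_eLpNorm_sq hF, hnorm]

/-! ### Scaling -/

theorem memLp_comp_inv_smul {h : ℂ → ℂ} {p : ℝ≥0∞} (hh : MemLp h p volume) {r : ℝ} (hr : r ≠ 0) :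
    MemLp (fun z => h (r⁻¹ • z)) p volume := by
  have hmap := Measure.map_addHaar_smul (volume : Measure ℂ) (inv_ne_zero hr)
  have h1 : MemLp h p (Measure.map (fun z : ℂ => r⁻¹ • z) volume) := by
    rw [hmap]; exact hh.smul_measure (by simp)
  exact (memLp_map_measure_iff h1.1 (by fun_prop)).1 h1

theorem planeWave_smul (r : ℝ) (w z : ℂ) : planeWave w (r • z) = planeWave (r • w) z := by
  simp only [planeWave, real_inner_smul_left, real_inner_smul_right]

theorem fourier_comp_inv_smul (h : ℂ → ℂ) {r : ℝ} (hr : r ≠ 0) (w : ℂ) :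
    𝓕 (fun z => h (r⁻¹ • z)) w = (r ^ 2 : ℝ) • 𝓕 h (r • w) := by
  have e : ∀ z : ℂ, planeWave w z * h (r⁻¹ • z) =
      (fun u => planeWave w (r • u) * h u) (r⁻¹ • z) := fun z => by
    dsimp only
    rw [smul_inv_smul₀ hr]
  rw [fourier_eq_integral_planeWave, fourier_eq_integral_planeWave]
  simp only [e]
  rw [Measure.integral_comp_inv_smul volume (fun u => planeWave w (r • u) * h u) r,
    Complex.finrank_real_complex, abs_of_nonneg (by positivity)]
  simp only [planeWave_smul]

theorem integrable_norm_sq_fourier_mul_varianceKernel {h : ℂ → ℂ} (h1 : MemLp h 1 volume)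
    (h2 : MemLp h 2 volume) (r : ℝ) :
    Integrable fun w => ‖𝓕 h w‖ ^ 2 * varianceKernel (r • w) := by
  have hF : MemLp (𝓕 h) 2 volume :=
    ⟨(continuous_fourier h1).aestronglyMeasurable, by rw [eLpNorm_fourier h1 h2]; exact h2.2⟩
  have hsq : Integrable fun w => ‖𝓕 h w‖ ^ 2 := (memLp_two_iff_integrable_sq_norm hF.1).1 hF
  refine hsq.mul_bdd (c := 2) ?_ (ae_of_all _ fun w => ?_)
  · exact (measurable_varianceKernel.comp (by fun_prop)).aestronglyMeasurable
  · rw [Real.norm_of_nonneg (varianceKernel_nonneg _)]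
    exact varianceKernel_le _

end

theorem mainTheorem4 {Ω : Type*} [MeasurableSpace Ω] (P : Measure Ω) [IsProbabilityMeasure P]
    (ζ : ℕ → Ω → ℂ) (hζ_indep : iIndepFun ζ P)
    (hζ_law : ∀ n, HasLaw (ζ n) stdComplexGaussian P)
    (h : ℂ → ℂ) (h_L1 : MemLp h 1 (volume : Measure ℂ)) (h_L2 : MemLp h 2 (volume : Measure ℂ))
    (h_ne : ¬ h =ᵐ[(volume : Measure ℂ)] 0) (r : ℝ) (hr : 0 < r) :
    -- the power series converges on the whole plane, almost surely
    (∀ᵐ ω ∂P, ∀ z : ℂ,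
      Summable fun n : ℕ => ζ n ω * (z ^ n / ((√(n.factorial : ℝ) : ℝ) : ℂ))) ∧
    -- the sum over the zeros converges absolutely, almost surely
    (∀ᵐ ω ∂P, Summable fun a : gefZeros (fun n => ζ n ω) => h ((a : ℂ) / (r : ℂ))) ∧
    -- the linear statistic has a finite second moment
    MemLp (fun ω => linearStat (fun n => ζ n ω) r h) 2 P ∧
    Integrable (fun w : ℂ => ‖𝓕 h w‖ ^ 2 * varianceKernel (r⁻¹ • w)) (volume : Measure ℂ) ∧
    complexVariance (fun ω => linearStat (fun n => ζ n ω) r h) P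
      = r ^ 2 * ∫ w : ℂ, ‖𝓕 h w‖ ^ 2 * varianceKernel (r⁻¹ • w) := by
  have hZ : HasLaw (fun ω n => ζ n ω) coeffLaw P :=
    iIndepFun.hasLaw_infinitePi hζ_law hζ_indep
      (aemeasurable_pi_lambda _ fun n => (hζ_law n).aemeasurable)
  have hdiv : ∀ a : ℂ, a / (r : ℂ) = r⁻¹ • a := fun a => by
    rw [Complex.real_smul, Complex.ofReal_inv, div_eq_inv_mul]
  have transfer : ∀ {p : (ℕ → ℂ) → Prop}, (∀ᵐ ξ ∂coeffLaw, p ξ) → ∀ᵐ ω ∂P, p fun n => ζ n ω :=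
    fun {p} hp => ae_of_ae_map hZ.aemeasurable (by rw [hZ.map_eq]; exact hp)
  obtain ⟨hsum, hL2, hvar⟩ := linearStat_variance (memLp_comp_inv_smul h_L1 hr.ne')
    (memLp_comp_inv_smul h_L2 hr.ne')
  have hstat : ∀ ξ, linearStat ξ r h = ∑' a : gefZeros ξ, h (r⁻¹ • (a : ℂ)) := fun ξ => by
    simp only [linearStat, hdiv]
  simp only [hstat, hdiv]
  refine ⟨transfer (p := fun ξ => ∀ z : ℂ, Summable fun n => ξ n * gefCoeff n z)
      (ae_hasSum_gef.mono fun ξ hξ z => (hξ z).summable), transfer hsum, ?_,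
    integrable_norm_sq_fourier_mul_varianceKernel h_L1 h_L2 r⁻¹, ?_⟩
  · rw [← hZ.map_eq] at hL2
    exact hL2.comp_of_map hZ.aemeasurable
  · have hcov : complexVariance (fun ω => ∑' a : gefZeros (fun n => ζ n ω), h (r⁻¹ • (a : ℂ))) P =
        complexVariance (fun ξ => ∑' a : gefZeros ξ, h (r⁻¹ • (a : ℂ))) coeffLaw := by
      have e1 := hZ.integral_comp hL2.1
      simp only [Function.comp_def] at e1
      have e2 := hZ.integral_comp
        (f := fun ξ => ‖(∑' a : gefZeros ξ, h (r⁻¹ • (a : ℂ))) -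
          ∫ ξ', ∑' a : gefZeros ξ', h (r⁻¹ • (a : ℂ)) ∂coeffLaw‖ ^ 2)
        ((hL2.1.sub aestronglyMeasurable_const).norm.pow 2)
      simp only [Function.comp_def] at e2
      rw [complexVariance, complexVariance, e1, ← e2]
    -- the substitution `u = r • w` turns the factor `r⁴` of the Fourier transforms into `r²`
    rw [hcov, hvar]
    simp only [fourier_comp_inv_smul h hr.ne']
    have e : ∀ w : ℂ, ‖(r ^ 2 : ℝ) • 𝓕 h (r • w)‖ ^ 2 * varianceKernel w =
        (fun u => r ^ 4 * (‖𝓕 h u‖ ^ 2 * varianceKernel (r⁻¹ • u))) (r • w) := fun w => by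
      simp only [norm_smul, inv_smul_smul₀ hr.ne', norm_pow, Real.norm_eq_abs, mul_pow, sq_abs]
      ring
    simp only [e]
    rw [Measure.integral_comp_smul volume
        (fun u => r ^ 4 * (‖𝓕 h u‖ ^ 2 * varianceKernel (r⁻¹ • u))) r,
      Complex.finrank_real_complex, abs_of_nonneg (by positivity), integral_const_mul, smul_eq_mul]
    field_simp
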